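/- Let $Q$ (multiplication by $x$, on its maximal domain) and $P=-i\,d/dx$ (on $H^1(\mathbb{R})$) act in $L^2(\mathbb{R})$, let $a_b=\sqrt{1/2}\,(Q+iP)$ and $b_{\mu,\nu}=\mu a_b+\nu a_b^*$. For $\mu,\nu\in\mathbb{C}$ with $|\mu|^2-|\nu|^2=1$, a squeezed state $|0;\mu,\nu\rangle$ is a unit vector of $L^2(\mathbb{R})$ with $b_{\mu,\nu}|0;\mu,\nu\rangle=0$. Products and sums of unbounded operators have their natural domains. On $L^2_{\rm even}(\mathbb{R})=\{f\in L^2(\mathbb{R}): f(-x)=f(x)\text{ a.e.}\}$ let $E_0=\frac i2(PQ+QP)$ (closed operator), $E_+=\frac i2Q^2$, $E_-=-\frac i2P^2$, and $$L_0=i(E_--E_+),\qquad L_\pm=\tfrac12\bigl(E_0\pm i(E_++E_-)\bigr),\qquad \lambda=\tfrac12,\qquad N=\tfrac12(L_0-\lambda).$$ Let $|0\rangle_N$ be a unit vector of $\ker L_-$, let the number state $|n\rangle_N$ be the normalization of $L_+^n|0\rangle_N$, let $a$ be the closure of $L_+^{-1}N$, and let $A$ be the closure of the operator $\tilde A=-i(a+1)(a-1)^{-1}$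 defined on the linear span of the $|n\rangle_N$. For $|\zeta|<1$ put $$|\zeta\rangle_a=\exp(\xi L_+-\xi^*L_+^*)|0\rangle_N,\qquad \xi=\tfrac12e^{i\arg\zeta}\ln\tfrac{1+|\zeta|}{1-|\zeta|},$$ and for $\operatorname{Im}\eta>0$ put $|\eta\rangle_A=\bigl|\tfrac{\eta-i}{\eta+i}\bigr\rangle_a$. (These vectors are determined up to a phase.) Let $\mathrm{SU}(1,1)$ be the group of the matrices $\begin{pmatrix}\mu^*&\nu\\ \nu^*&\mu\end{pmatrix}$ with $|\mu|^2-|\nu|^2=1$, and let $e_0=\begin{pmatrix}0&1\\1&0\end{pmatrix}$, $e_+=\frac i2\begin{pmatrix}1&-1\\1&-1\end{pmatrix}$, $e_-=\frac i2\begin{pmatrix}-1&-1\\1&1\end{pmatrix}$. Let $V$ be the unitary representation on $L^2_{\rm even}(\mathbb{R})$ of the double covering group $\widetilde{\mathrm{SU}}(1,1)$, with covering map $\pi$ onto $\mathrm{SU}(1,1)$, which is given by $V(\exp(re_0+se_++te_-))=\exp(rE_0+sE_++tE_-)$ for $r,s,t\in\mathbb{R}$. Concretely, this group consists of the pairs $(\pi(g),V(g))$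 and is generated by the pairs of these two exponentials. **Lemma.** Let $|\mu|^2-|\nu|^2=1$. Squeezed states $|0;\mu,\nu\rangle$, the coherent states below, and elements $g\in\widetilde{\mathrm{SU}}(1,1)$ with $\pi(g)=\begin{pmatrix}\mu^*&\nu\\ \nu^*&\mu\end{pmatrix}$ exist. Every squeezed state $|0;\mu,\nu\rangle$ is an even function, and for every such $g$, as operators on $L^2_{\rm even}(\mathbb{R})$, $$|0;\mu,\nu\rangle\langle0;\mu,\nu|=V(g)|0\rangle_a\,{}_a\langle0|V(g)^*=\Bigl|\frac\nu\mu\Bigr\rangle_a\,{}_a\Bigl\langle\frac\nu\mu\Bigr|=\Bigl|i\frac{\mu+\nu}{\mu-\nu}\Bigr\rangle_A\,{}_A\Bigl\langle i\frac{\mu+\nu}{\mu-\nu}\Bigr| .$$ Hence squeezed states are $\mathfrak{su}(1,1)$-coherent states, $|0;\mu,\nu\rangle=|\nu/\mu\rangle_a=|i\frac{\mu+\nu}{\mu-\nu}\rangle_A$ up to a phase, and they are eigenvectors of $a$ and of $-(a_b^*)^{-1}a_b$ with eigenvalue $\nu/\mu$, and of $A$ and of $Q^{-1}P$ with eigenvalue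 $i\frac{\mu+\nu}{\mu-\nu}$. Here $a$ and $-(a_b^*)^{-1}a_b$ coincide on the domain of $L_+^{-1}N$, and $A$ and $Q^{-1}P$ coincide on the domain of $\tilde A$. -/

import Mathlib

open MeasureTheory Complex
open scoped ComplexConjugate ContDiff InnerProductSpace LinearPMap

noncomputable section

namespace SqueezedSU11

/-! ### Products and parts of unbounded operators -/

section Operators

variable {E : Type*} [NormedAddCommGroup E] [NormedSpace ℂ E]

/-- The graph of the operator product `X Y` with its natural domain
`{φ ∈ D(Y) | Y φ ∈ D(X)}`. -/
def prodGraph (X Y : E →ₗ.[ℂ] E) : Submodule ℂ (E × E) where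
  carrier := {p | ∃ g, (p.1, g) ∈ Y.graph ∧ (g, p.2) ∈ X.graph}
  add_mem' := by
    rintro p q ⟨g, hg, hg'⟩ ⟨h, hh, hh'⟩
    exact ⟨g + h, Y.graph.add_mem hg hh, X.graph.add_mem hg' hh'⟩
  zero_mem' := ⟨0, Y.graph.zero_mem, X.graph.zero_mem⟩
  smul_mem' := by
    rintro c p ⟨g, hg, hg'⟩
    exact ⟨c • g, Y.graph.smul_mem c hg, X.graph.smul_mem c hg'⟩

/-- The operator product `X Y : φ ↦ X (Y φ)` on `{φ ∈ D(Y) | Y φ ∈ D(X)}`. -/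
def opMul (X Y : E →ₗ.[ℂ] E) : E →ₗ.[ℂ] E := (prodGraph X Y).toLinearPMap

theorem opMul_graph (X Y : E →ₗ.[ℂ] E) : (opMul X Y).graph = prodGraph X Y := by
  refine Submodule.toLinearPMap_graph_eq _ ?_
  rintro ⟨f, h⟩ ⟨g, hg, hg'⟩ hf
  exact X.graph_fst_eq_zero_snd hg' (Y.graph_fst_eq_zero_snd hg hf)

/-- The graph of the part of `T` in the subspace `K`. -/
def partGraph (K : Submodule ℂ E) (T : E →ₗ.[ℂ] E) : Submodule ℂ (K × K) where
  carrier := {p | ((p.1 : E), (p.2 : E)) ∈ T.graph}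
  add_mem' := fun hp hq => T.graph.add_mem hp hq
  zero_mem' := T.graph.zero_mem
  smul_mem' := fun c _ hp => T.graph.smul_mem c hp

/-- The part of `T` in the subspace `K`: the operator `f ↦ T f` on `{f ∈ K ∩ D(T) | T f ∈ K}`. -/
def part (K : Submodule ℂ E) (T : E →ₗ.[ℂ] E) : K →ₗ.[ℂ] K := (partGraph K T).toLinearPMap

theorem part_graph (K : Submodule ℂ E) (T : E →ₗ.[ℂ] E) : (part K T).graph = partGraph K T := by
  refine Submodule.toLinearPMap_graph_eq _ ?_
  rintro ⟨f, h⟩ hp hf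
  have hf' : (f : E) = 0 := by simpa using hf
  have := T.graph_fst_eq_zero_snd hp hf'
  simpa using this

/-- The identity operator, on its full domain. -/
def idOp : E →ₗ.[ℂ] E := LinearMap.id.toPMap ⊤

/-- `φ` is an eigenvector of the unbounded operator `T` with eigenvalue `c`. -/
def IsEigenvector (T : E →ₗ.[ℂ] E) (c : ℂ) (φ : E) : Prop :=
  φ ≠ 0 ∧ (φ, c • φ) ∈ T.graph

end Operators

/-! ### Position, momentum and the boson operators on `L²(ℝ)` -/

/-- The Hilbert space `L²(ℝ)` of complex valued functions. -/
abbrev L2 : Type := Lp ℂ 2 (volume : Measure ℝ)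

/-- The graph of the multiplication operator by `x`. -/
def positionGraph : Submodule ℂ (L2 × L2) where
  carrier := {p | ∀ᵐ x : ℝ, p.2 x = (x : ℂ) * p.1 x}
  add_mem' := by
    intro p q hp hq
    simp only [Set.mem_ofPred_eq] at hp hq ⊢
    filter_upwards [hp, hq, Lp.coeFn_add p.1 q.1, Lp.coeFn_add p.2 q.2] with x h1 h2 h3 h4
    simp only [Prod.fst_add, Prod.snd_add, h3, h4, Pi.add_apply, h1, h2]
    ring
  zero_mem' := by
    filter_upwards [Lp.coeFn_zero ℂ 2 (volume : Measure ℝ)] with x h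
    simp [h]
  smul_mem' := by
    intro c p hp
    simp only [Set.mem_ofPred_eq] at hp ⊢
    filter_upwards [hp, Lp.coeFn_smul c p.1, Lp.coeFn_smul c p.2] with x h1 h3 h4
    simp only [Prod.smul_fst, Prod.smul_snd, h3, h4, Pi.smul_apply, h1, smul_eq_mul]
    ring

/-- The position operator `Q`, `(Q f)(x) = x f(x)`, on its maximal domain. -/
def Q : L2 →ₗ.[ℂ] L2 := positionGraph.toLinearPMap

theorem Q_graph : Q.graph = positionGraph := by
  refine Submodule.toLinearPMap_graph_eq _ ?_
  rintro ⟨f, g⟩ hp hf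
  simp only at hf
  subst hf
  refine Lp.ext ?_
  have hp' : ∀ᵐ x : ℝ, g x = (x : ℂ) * (0 : L2) x := hp
  filter_upwards [hp', Lp.coeFn_zero ℂ 2 (volume : Measure ℝ)] with x h1 h2
  simp [h1, h2]

theorem integrable_smul_of_test (f : L2) {φ : ℝ → ℝ} (hφ : Continuous φ)
    (hc : HasCompactSupport φ) : Integrable (fun x => φ x • f x) :=
  ((Lp.memLp f).locallyIntegrable (by norm_num)).integrable_smul_left_of_hasCompactSupport hφ hc

/-- The graph of `-i d/dx`, the derivative being the weak one: `g = -i f'` means that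
`∫ φ' f = - ∫ φ (i g)` for all test functions `φ`. -/
def momentumGraph : Submodule ℂ (L2 × L2) where
  carrier := {p | ∀ φ : ℝ → ℝ, ContDiff ℝ ∞ φ → HasCompactSupport φ →
    ∫ x, deriv φ x • p.1 x = - ∫ x, φ x • (I * p.2 x)}
  add_mem' := by
    intro p q hp hq φ h1 h2
    have hd : Continuous (deriv φ) := h1.continuous_deriv (by simp)
    have e1 : ∫ x, deriv φ x • (p + q).1 x
        = (∫ x, deriv φ x • p.1 x) + ∫ x, deriv φ x • q.1 x := by
      rw [← integral_add (integrable_smul_of_test p.1 hd h2.deriv)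
        (integrable_smul_of_test q.1 hd h2.deriv)]
      refine integral_congr_ae ?_
      filter_upwards [Lp.coeFn_add p.1 q.1] with x h
      simp only [Prod.fst_add, h, Pi.add_apply, smul_add]
    have i1 := fun r : L2 => (integrable_smul_of_test r h1.continuous h2).const_mul I
    have e0 : ∀ r : L2, ∫ x, φ x • (I * r x) = ∫ x, I * (φ x • r x) := by
      intro r
      refine integral_congr_ae (Filter.Eventually.of_forall fun x => ?_)
      simp only [Complex.real_smul]
      ring
    have e2 : ∫ x, φ x • (I * (p + q).2 x)
        = (∫ x, φ x • (I * p.2 x)) + ∫ x, φ x • (I * q.2 x) := by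
      rw [e0, e0, e0, ← integral_add (i1 p.2) (i1 q.2)]
      refine integral_congr_ae ?_
      filter_upwards [Lp.coeFn_add p.2 q.2] with x h
      simp only [Prod.snd_add, h, Pi.add_apply, smul_add, mul_add]
    rw [e1, e2, hp φ h1 h2, hq φ h1 h2]
    ring
  zero_mem' := by
    intro φ _ _
    have e1 : ∫ x, deriv φ x • (0 : L2 × L2).1 x = 0 := by
      rw [← integral_zero ℝ ℂ (μ := volume)]
      refine integral_congr_ae ?_
      filter_upwards [Lp.coeFn_zero ℂ 2 (volume : Measure ℝ)] with x h
      simp [h]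
    have e2 : ∫ x, φ x • (I * (0 : L2 × L2).2 x) = 0 := by
      rw [← integral_zero ℝ ℂ (μ := volume)]
      refine integral_congr_ae ?_
      filter_upwards [Lp.coeFn_zero ℂ 2 (volume : Measure ℝ)] with x h
      simp [h]
    rw [e1, e2, neg_zero]
  smul_mem' := by
    intro c p hp φ h1 h2
    have e1 : ∫ x, deriv φ x • (c • p).1 x = c * ∫ x, deriv φ x • p.1 x := by
      rw [← integral_const_mul]
      refine integral_congr_ae ?_
      filter_upwards [Lp.coeFn_smul c p.1] with x h
      simp only [Prod.smul_fst, h, Pi.smul_apply, smul_eq_mul, Complex.real_smul]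
      ring
    have e2 : ∫ x, φ x • (I * (c • p).2 x) = c * ∫ x, φ x • (I * p.2 x) := by
      rw [← integral_const_mul]
      refine integral_congr_ae ?_
      filter_upwards [Lp.coeFn_smul c p.2] with x h
      simp only [Prod.smul_snd, h, Pi.smul_apply, smul_eq_mul, Complex.real_smul]
      ring
    rw [e1, e2, hp φ h1 h2]
    ring

/-- The momentum operator `P f = -i f'` on the Sobolev space `H¹(ℝ)`. -/
def P : L2 →ₗ.[ℂ] L2 := momentumGraph.toLinearPMap

theorem P_graph : P.graph = momentumGraph := by
  refine Submodule.toLinearPMap_graph_eq _ ?_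
  rintro ⟨f, g⟩ hp hf
  simp only at hf
  subst hf
  have key : ∀ᵐ x : ℝ, g x = 0 := by
    refine ae_eq_zero_of_integral_contDiff_smul_eq_zero
      ((Lp.memLp g).locallyIntegrable (by norm_num)) ?_
    intro φ h1 h2
    have h3 : ∫ x, deriv φ x • (0 : L2) x = - ∫ x, φ x • (I * g x) := hp φ h1 h2
    have e1 : ∫ x, deriv φ x • (0 : L2) x = 0 := by
      rw [← integral_zero ℝ ℂ (μ := volume)]
      refine integral_congr_ae ?_
      filter_upwards [Lp.coeFn_zero ℂ 2 (volume : Measure ℝ)] with x h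
      simp [h]
    have e2 : ∫ x, φ x • (I * g x) = I * ∫ x, φ x • g x := by
      rw [← integral_const_mul]
      refine integral_congr_ae (Filter.Eventually.of_forall fun x => ?_)
      simp only [Complex.real_smul]
      ring
    rw [e1, e2] at h3
    have h4 : I * ∫ x, φ x • g x = 0 := by
      rw [← neg_eq_zero, ← h3]
    exact (mul_eq_zero.mp h4).resolve_left I_ne_zero
  refine Lp.ext ?_
  filter_upwards [key, Lp.coeFn_zero ℂ 2 (volume : Measure ℝ)] with x h1 h2
  simp [h1, h2]

/-- The boson annihilation operator `a_b = √(1/2) (Q + i P)`. -/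
def bosonA : L2 →ₗ.[ℂ] L2 := ((Real.sqrt (1 / 2) : ℝ) : ℂ) • (Q + I • P)

/-- `b_{μ,ν} = μ a_b + ν a_b^*`. -/
def bogoliubov (μ ν : ℂ) : L2 →ₗ.[ℂ] L2 := μ • bosonA + ν • bosonA†

/-- `ψ` is a squeezed vacuum `|0; μ, ν⟩`: a unit vector with `b_{μ,ν} ψ = 0`. -/
def IsSqueezedVacuum (μ ν : ℂ) (ψ : L2) : Prop :=
  ‖ψ‖ = 1 ∧ IsEigenvector (bogoliubov μ ν) 0 ψ

/-! ### The even subspace and the representation of `su(1,1)` on it -/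

/-- The reflection `f ↦ f(-·)` of `L²(ℝ)`. -/
def reflection : L2 →ₗᵢ[ℂ] L2 :=
  Lp.compMeasurePreservingₗᵢ ℂ (fun x : ℝ => -x) (Measure.measurePreserving_neg volume)

/-- `L²_even(ℝ)`: the functions in `L²(ℝ)` with `f(-x) = f(x)` for almost all `x`. -/
def evenL2 : Submodule ℂ L2 := LinearMap.eqLocus reflection.toLinearMap LinearMap.id

/-- `L²_even(ℝ)` as a Hilbert space. -/
abbrev EvenL2 : Type := evenL2

instance : CompleteSpace EvenL2 := by
  have h : IsClosed (evenL2 : Set L2) :=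
    isClosed_eq reflection.continuous continuous_id
  exact h.completeSpace_coe

/-- `E_0 = (i/2)(PQ + QP)`, taken as a closed (skew-adjoint) operator, on even functions. -/
def E0 : EvenL2 →ₗ.[ℂ] EvenL2 :=
  part evenL2 ((I / 2) • (opMul P Q + opMul Q P)).closure

/-- `E_+ = (i/2) Q²` on even functions. -/
def Eplus : EvenL2 →ₗ.[ℂ] EvenL2 := part evenL2 ((I / 2) • opMul Q Q)

/-- `E_- = -(i/2) P²` on even functions. -/
def Eminus : EvenL2 →ₗ.[ℂ] EvenL2 := part evenL2 ((-(I / 2)) • opMul P P)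

/-- `L_0 = i (E_- - E_+)`. -/
def L0 : EvenL2 →ₗ.[ℂ] EvenL2 := I • (Eminus - Eplus)

/-- `L_+ = (1/2)(E_0 + i (E_+ + E_-))`. -/
def Lplus : EvenL2 →ₗ.[ℂ] EvenL2 := (1 / 2 : ℂ) • (E0 + I • (Eplus + Eminus))

/-- `L_- = (1/2)(E_0 - i (E_+ + E_-))`. -/
def Lminus : EvenL2 →ₗ.[ℂ] EvenL2 := (1 / 2 : ℂ) • (E0 - I • (Eplus + Eminus))

/-- The number operator `N = (1/2)(L_0 - λ)`, with the lowest weight `λ = 1/2`. -/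
def numberOp : EvenL2 →ₗ.[ℂ] EvenL2 := (1 / 2 : ℂ) • (L0 - (1 / 2 : ℂ) • idOp)

/-- `L_+⁻¹ N` with its natural domain. -/
def annihilationCore : EvenL2 →ₗ.[ℂ] EvenL2 := opMul Lplus.inverse numberOp

/-- The annihilation operator `a = L_+⁻¹ N`; the closure is its bounded extension to the whole
space. -/
def annihilation : EvenL2 →ₗ.[ℂ] EvenL2 := annihilationCore.closure

/-- The line spanned by the number state `|n⟩_N`: for `n = 0` the kernel of `L_-`, and then
successively its images under `L_+`. -/
def numberLine : ℕ → Submodule ℂ EvenL2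
  | 0 => (LinearMap.ker Lminus.toFun).map Lminus.domain.subtype
  | n + 1 => ((numberLine n).comap Lplus.domain.subtype).map Lplus.toFun

/-- `-i (a + 1)(a - 1)⁻¹` on the linear span of the number states `|n⟩_N`. -/
def cayleyCore : EvenL2 →ₗ.[ℂ] EvenL2 :=
  ((-I) • opMul (annihilation + idOp) (annihilation - idOp).inverse).domRestrict
    (⨆ n, numberLine n)

/-- The operator `A`: the closure of `-i (a + 1)(a - 1)⁻¹` on the span of the number states. -/
def cayleyA : EvenL2 →ₗ.[ℂ] EvenL2 := cayleyCore.closure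

/-- The operator `-(a_b^*)⁻¹ a_b` on even functions. -/
def bosonQuotient : EvenL2 →ₗ.[ℂ] EvenL2 := part evenL2 (-(opMul (bosonA†).inverse bosonA))

/-- The operator `Q⁻¹ P` on even functions. -/
def momentumQuotient : EvenL2 →ₗ.[ℂ] EvenL2 := part evenL2 (opMul Q.inverse P)

/-! ### Exponentials, coherent states -/

/-- The group of unitary operators of `L²_even(ℝ)`. -/
abbrev UnitaryGp : Type := unitary (EvenL2 →L[ℂ] EvenL2)

/-- `W = exp T` for an essentially skew-adjoint operator `T`: there is a strongly continuous
one-parameter group `U` of unitary operators with `U 1 = W` whose (skew-adjoint) generator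
extends `T`. -/
def IsExp (T : EvenL2 →ₗ.[ℂ] EvenL2) (W : UnitaryGp) : Prop :=
  ∃ U : ℝ → UnitaryGp,
    (∀ s t : ℝ, U (s + t) = U s * U t) ∧
    (∀ f : EvenL2, Continuous fun t : ℝ => (U t : EvenL2 →L[ℂ] EvenL2) f) ∧
    (∀ f : T.domain,
      HasDerivAt (fun t : ℝ => (U t : EvenL2 →L[ℂ] EvenL2) (f : EvenL2)) (T f) 0) ∧
    U 1 = W

/-- `v` is a lowest weight vector `|0⟩_N`: a unit vector in the kernel of `L_-`
(unique up to a phase). -/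
def IsLowestWeightVector (v : EvenL2) : Prop := ‖v‖ = 1 ∧ (v, (0 : EvenL2)) ∈ Lminus.graph

/-- The parameter `ξ = (1/2) e^{i arg ζ} log ((1 + |ζ|) / (1 - |ζ|))`. -/
def coherentParameter (ζ : ℂ) : ℂ :=
  (1 / 2 : ℂ) * Complex.exp (I * (Complex.arg ζ : ℂ)) *
    ((Real.log ((1 + ‖ζ‖) / (1 - ‖ζ‖)) : ℝ) : ℂ)

/-- `φ` is an `su(1,1)`-coherent state `|ζ⟩_a` (`|ζ| < 1`): `φ = exp (ξ L_+ - ξ^* L_+^*) |0⟩_N`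
with `ξ` the parameter of `ζ`. -/
def IsCoherentState (ζ : ℂ) (φ : EvenL2) : Prop :=
  ‖ζ‖ < 1 ∧ ∃ (v : EvenL2) (W : UnitaryGp), IsLowestWeightVector v ∧
    IsExp (coherentParameter ζ • Lplus - conj (coherentParameter ζ) • Lplus†) W ∧
    φ = (W : EvenL2 →L[ℂ] EvenL2) v

/-- `φ` is a state `|η⟩_A = |(η - i)/(η + i)⟩_a` with `η` in the upper half-plane. -/
def IsCoherentStateA (η : ℂ) (φ : EvenL2) : Prop :=
  0 < η.im ∧ IsCoherentState ((η - I) / (η + I)) φ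

/-- The rank one operator `|φ⟩⟨φ|`. -/
def proj (φ : EvenL2) : EvenL2 →L[ℂ] EvenL2 := InnerProductSpace.rankOne ℂ φ φ

/-! ### The group `SU(1,1)`, its double cover and the representation `V` -/

/-- `SU(1,1)`: the matrices `[[μ^*, ν], [ν^*, μ]]` of determinant one. -/
def SU11 : Subgroup (Matrix.SpecialLinearGroup (Fin 2) ℂ) where
  carrier := {g | g.1 0 0 = conj (g.1 1 1) ∧ g.1 1 0 = conj (g.1 0 1)}
  mul_mem' := by
    rintro a b ⟨ha, ha'⟩ ⟨hb, hb'⟩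
    simp only [Set.mem_ofPred_eq, Matrix.SpecialLinearGroup.coe_mul, Matrix.mul_apply,
      Fin.sum_univ_two, map_add, map_mul] at *
    rw [ha, ha', hb, hb']
    simp only [Complex.conj_conj]
    constructor <;> ring
  one_mem' := by simp
  inv_mem' := by
    rintro a ⟨ha, ha'⟩
    simp only [Set.mem_ofPred_eq, Matrix.SpecialLinearGroup.coe_inv, Matrix.adjugate_fin_two,
      Matrix.of_apply, Matrix.cons_val', Matrix.cons_val_zero, Matrix.cons_val_one,
      Matrix.cons_val_fin_one, map_neg] at *
    rw [ha, ha']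
    simp

/-- The entry `μ(g)` of `g ∈ SU(1,1)`. -/
def muOf (g : SU11) : ℂ := g.1.1 1 1

/-- The entry `ν(g)` of `g ∈ SU(1,1)`. -/
def nuOf (g : SU11) : ℂ := g.1.1 0 1

/-- The element `r e_0 + s e_+ + t e_-` of the Lie algebra `su(1,1)`, of which
`e_0, e_+, e_-` is a real basis. -/
def algebraElement (r s t : ℝ) : Matrix (Fin 2) (Fin 2) ℂ :=
  (r : ℂ) • !![0, 1; 1, 0] + ((s : ℂ) * (I / 2)) • !![1, -1; 1, -1]
    + ((t : ℂ) * (I / 2)) • !![-1, -1; 1, 1]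

/-- The operator `r E_0 + s E_+ + t E_-` representing `r e_0 + s e_+ + t e_-`. -/
def algebraAction (r s t : ℝ) : EvenL2 →ₗ.[ℂ] EvenL2 :=
  (r : ℂ) • E0 + (s : ℂ) • Eplus + (t : ℂ) • Eminus

/-- The double covering group of `SU(1,1)` on which the representation lives, realized as the
group of pairs `(π(g), V(g))`: it is generated by the pairs
`(exp (r e_0 + s e_+ + t e_-), exp (r E_0 + s E_+ + t E_-))`, and is the image under `(π, V)` of
the universal covering group of `SU(1,1)`. -/
def CoverSU11 : Subgroup (SU11 × UnitaryGp) :=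
  Subgroup.closure {p | ∃ r s t : ℝ,
    (p.1.1.1 : Matrix (Fin 2) (Fin 2) ℂ) = NormedSpace.exp (algebraElement r s t) ∧
    IsExp (algebraAction r s t) p.2}

/-- The covering map `π` onto `SU(1,1)`. -/
def coverProj (g : CoverSU11) : SU11 := g.1.1

/-- The unitary representation `V` of the covering group on `L²_even(ℝ)`, determined by
`V (exp X) = exp (f X)`, where `f` is the representation of the Lie algebra. -/
def V : CoverSU11 →* UnitaryGp := (MonoidHom.snd SU11 UnitaryGp).comp CoverSU11.subtype

end SqueezedSU11

end

/-!
The proof rests on the Gaussians `e^{-w x²/2}` with `Re w > 0`: the squeezed states, the coherent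
states and the vectors `V(g) |0⟩_a` are all identified with the normalized multiples of a single
Gaussian, with `w = (μ + ν)/(μ - ν)`, or, in terms of `ζ = ν/μ`, with `w = (1 + ζ)/(1 - ζ)`.

*The vectors `p(x) e^{-w x²/2}`.* On these vectors, denoted `J w p`, with a polynomial `p`, the
operators `Q`, `P`, `E_0`, `E_±`, `L_±`, `N`, `a_b`, `a_b^*` act by explicit maps of polynomials.
For `w = 1` they are total in `L²(ℝ)`, and they depend holomorphically on `w`. An operator that is
formally adjoint to one known on them is controlled on its whole domain by testing against them
(`AdjPair`). In this way the equations `b_{μ,ν} ψ = 0`, `L_- v = 0` and `a f = ζ f` all become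
recursions for the moments of the vector against polynomials times `e^{-x²/2}`. Such a recursion
(`WeakRel`) has at most one solution up to a factor (`exists_eq_smul_of_weakRel`), which gives the
uniqueness of the squeezed states (`isSqueezedVacuum_iff`), their evenness, and the uniqueness of
the lowest weight vector.

*Exponentials.* The flow of `r E_0 + s E_+ + t E_-` maps Gaussians to multiples of Gaussians, the
parameter `w` moving by the Möbius action of the matrix flow; the scalar factor is a continuous
branch of a power `-1/2` (`exists_gaussian_solution`). These explicit solutions stay in the span of
the Gaussians, which is dense in the even functions. Since formally skew-adjoint operators have
solutions of constant norm, the solutions assemble to a unitary group (`exists_unitaryGroup`), and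
any group whose generator extends the given operator agrees with them (`eq_of_unitaryGroup`). Thus
every exponential acts on Gaussians by the corresponding matrix (`IsExp.apply_gaussian`). Applied to
`exp (ξ L_+ - ξ^* L_+^*)` this identifies the coherent states (`isCoherentState_iff`); applied to
the generators of the double cover it identifies `V(g) |0⟩_a` (`exists_apply_gaussOf`).

*Eigenvalues.* Gaussians satisfy the eigenvalue equations of `L_+⁻¹ N`, of `-(a_b^*)⁻¹ a_b` and of
`Q⁻¹ P` by direct computation. For the closure `A` the Gaussian is approximated by the partial sums
of its expansion `∑ ζⁿ L_+ⁿ |0⟩ / n!`, which telescope under `(a + 1)(a - 1)⁻¹`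
(`mem_graph_cayleyA_of_tendsto`).
-/

noncomputable section

namespace SqueezedSU11

/-! ### Calculus of graphs of unbounded operators -/

section GraphCalculus

variable {E : Type*} [NormedAddCommGroup E] [NormedSpace ℂ E]

theorem mem_graph_add {A B : E →ₗ.[ℂ] E} {f h : E} :
    (f, h) ∈ (A + B).graph ↔ ∃ h₁ h₂, (f, h₁) ∈ A.graph ∧ (f, h₂) ∈ B.graph ∧ h = h₁ + h₂ := by
  constructor
  · intro hf
    obtain ⟨⟨y, hy⟩, rfl, rfl⟩ := (LinearPMap.mem_graph_iff _).1 hf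
    exact ⟨_, _, A.mem_graph ⟨y, hy.1⟩, B.mem_graph ⟨y, hy.2⟩, rfl⟩
  · rintro ⟨h₁, h₂, hA, hB, rfl⟩
    obtain ⟨⟨y, hy⟩, rfl, rfl⟩ := (LinearPMap.mem_graph_iff _).1 hA
    obtain ⟨⟨z, hz⟩, hzy, rfl⟩ := (LinearPMap.mem_graph_iff _).1 hB
    obtain rfl : z = y := hzy
    exact (A + B).mem_graph ⟨z, hy, hz⟩

theorem mem_graph_sub {A B : E →ₗ.[ℂ] E} {f h : E} :
    (f, h) ∈ (A - B).graph ↔ ∃ h₁ h₂, (f, h₁) ∈ A.graph ∧ (f, h₂) ∈ B.graph ∧ h = h₁ - h₂ := by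
  constructor
  · intro hf
    obtain ⟨⟨y, hy⟩, rfl, rfl⟩ := (LinearPMap.mem_graph_iff _).1 hf
    exact ⟨_, _, A.mem_graph ⟨y, hy.1⟩, B.mem_graph ⟨y, hy.2⟩, rfl⟩
  · rintro ⟨h₁, h₂, hA, hB, rfl⟩
    obtain ⟨⟨y, hy⟩, rfl, rfl⟩ := (LinearPMap.mem_graph_iff _).1 hA
    obtain ⟨⟨z, hz⟩, hzy, rfl⟩ := (LinearPMap.mem_graph_iff _).1 hB
    obtain rfl : z = y := hzy
    exact (A - B).mem_graph ⟨z, hy, hz⟩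

theorem mem_graph_smul {A : E →ₗ.[ℂ] E} {c : ℂ} {f h : E} :
    (f, h) ∈ (c • A).graph ↔ ∃ h₁, (f, h₁) ∈ A.graph ∧ h = c • h₁ := by
  constructor
  · intro hf
    obtain ⟨⟨y, hy⟩, rfl, rfl⟩ := (LinearPMap.mem_graph_iff _).1 hf
    exact ⟨_, A.mem_graph ⟨y, hy⟩, rfl⟩
  · rintro ⟨h₁, hA, rfl⟩
    obtain ⟨⟨y, hy⟩, rfl, rfl⟩ := (LinearPMap.mem_graph_iff _).1 hA
    exact (c • A).mem_graph ⟨y, hy⟩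

theorem mem_graph_neg {A : E →ₗ.[ℂ] E} {f h : E} :
    (f, h) ∈ (-A).graph ↔ (f, -h) ∈ A.graph := by
  constructor
  · intro hf
    obtain ⟨⟨y, hy⟩, rfl, rfl⟩ := (LinearPMap.mem_graph_iff _).1 hf
    have := A.mem_graph ⟨y, hy⟩
    simpa using this
  · intro hA
    obtain ⟨⟨y, hy⟩, rfl, h1⟩ := (LinearPMap.mem_graph_iff _).1 hA
    have := (-A).mem_graph ⟨y, hy⟩
    rwa [LinearPMap.neg_apply, h1, neg_neg] at this

theorem mem_graph_idOp {f h : E} : (f, h) ∈ (idOp : E →ₗ.[ℂ] E).graph ↔ h = f := by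
  constructor
  · intro hf
    obtain ⟨⟨y, hy⟩, rfl, rfl⟩ := (LinearPMap.mem_graph_iff _).1 hf
    rfl
  · rintro rfl
    exact (idOp : E →ₗ.[ℂ] E).mem_graph ⟨h, trivial⟩

theorem mem_graph_opMul {X Y : E →ₗ.[ℂ] E} {f h : E} :
    (f, h) ∈ (opMul X Y).graph ↔ ∃ g, (f, g) ∈ Y.graph ∧ (g, h) ∈ X.graph := by
  rw [opMul_graph]
  rfl

theorem mem_graph_part {K : Submodule ℂ E} {T : E →ₗ.[ℂ] E} {f h : K} :
    (f, h) ∈ (part K T).graph ↔ ((f : E), (h : E)) ∈ T.graph := by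
  rw [part_graph]
  rfl

theorem mem_graph_inverse {A : E →ₗ.[ℂ] E} (hA : ∀ f, (f, (0 : E)) ∈ A.graph → f = 0) {f h : E} :
    (f, h) ∈ A.inverse.graph ↔ (h, f) ∈ A.graph := by
  have hker : A.toFun.ker = ⊥ := by
    rw [LinearMap.ker_eq_bot']
    intro x hx
    have h1 := A.mem_graph x
    have h2 : A x = 0 := hx
    rw [h2] at h1
    exact Subtype.ext (hA _ h1)
  rw [LinearPMap.inverse_graph hker]
  constructor
  · rintro ⟨⟨a, b⟩, hab, he⟩
    obtain ⟨rfl, rfl⟩ := Prod.mk.inj he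
    exact hab
  · intro h1
    exact ⟨(h, f), h1, rfl⟩

/-- The value `LinearPMap.closure` takes on operators that are not closable is harmless for
inclusions of graphs: in either case the graph of the closure lies in the topological closure. -/
theorem graph_closure_le (A : E →ₗ.[ℂ] E) : A.closure.graph ≤ A.graph.topologicalClosure := by
  by_cases hA : A.IsClosable
  · rw [hA.graph_closure_eq_closure_graph]
  · rw [LinearPMap.closure_def' hA]
    exact Submodule.le_topologicalClosure _

theorem mem_graph_closure_of_mem {A : E →ₗ.[ℂ] E} {p : E × E} (h : p ∈ A.graph) :
    p ∈ A.closure.graph :=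
  LinearPMap.le_graph_of_le A.le_closure h

theorem mem_graph_closure_of_tendsto {A : E →ₗ.[ℂ] E} (hA : A.IsClosable) {u v : ℕ → E} {f h : E}
    (hu : Filter.Tendsto u Filter.atTop (nhds f)) (hv : Filter.Tendsto v Filter.atTop (nhds h))
    (huv : ∀ n, (u n, v n) ∈ A.graph) : (f, h) ∈ A.closure.graph := by
  rw [← hA.graph_closure_eq_closure_graph, ← SetLike.mem_coe,
    Submodule.topologicalClosure_coe]
  exact mem_closure_of_tendsto (hu.prodMk_nhds hv) (Filter.Eventually.of_forall huv)

theorem isClosable_of_forall {A : E →ₗ.[ℂ] E}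
    (hA : ∀ h, ((0 : E), h) ∈ A.graph.topologicalClosure → h = 0) : A.IsClosable := by
  refine ⟨A.graph.topologicalClosure.toLinearPMap, ?_⟩
  rw [Submodule.toLinearPMap_graph_eq]
  rintro ⟨x, y⟩ hx rfl
  exact hA y hx

/-- A closed condition that holds on a graph passes to the closure of the graph. -/
theorem closure_graph_subset {A : E →ₗ.[ℂ] E} {S : Set (E × E)} (hS : IsClosed S)
    (hA : ∀ p ∈ A.graph, p ∈ S) {p : E × E} (hp : p ∈ A.graph.topologicalClosure) : p ∈ S := by
  rw [← SetLike.mem_coe, Submodule.topologicalClosure_coe] at hp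
  exact closure_minimal hA hS hp

end GraphCalculus

section Adjoint

variable {E : Type*} [NormedAddCommGroup E] [InnerProductSpace ℂ E]

/-- `A` and `B` are formally adjoint to each other: `⟪A f, g⟫ = ⟪f, B g⟫` on the domains,
expressed through the graphs. -/
def AdjPair (A B : E →ₗ.[ℂ] E) : Prop :=
  ∀ f f' g g', (f, f') ∈ A.graph → (g, g') ∈ B.graph → ⟪f', g⟫_ℂ = ⟪f, g'⟫_ℂ

theorem AdjPair.symm {A B : E →ₗ.[ℂ] E} (h : AdjPair A B) : AdjPair B A := by
  intro f f' g g' hf hg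
  have := h g g' f f' hg hf
  rw [← inner_conj_symm, ← this, inner_conj_symm]

theorem AdjPair.add {A B A' B' : E →ₗ.[ℂ] E} (h : AdjPair A B) (h' : AdjPair A' B') :
    AdjPair (A + A') (B + B') := by
  intro f f' g g' hf hg
  obtain ⟨a, b, ha, hb, rfl⟩ := mem_graph_add.1 hf
  obtain ⟨c, d, hc, hd, rfl⟩ := mem_graph_add.1 hg
  rw [inner_add_left, inner_add_right, h _ _ _ _ ha hc, h' _ _ _ _ hb hd]

theorem AdjPair.smul {A B : E →ₗ.[ℂ] E} (h : AdjPair A B) {c d : ℂ} (hcd : conj c = d) :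
    AdjPair (c • A) (d • B) := by
  intro f f' g g' hf hg
  obtain ⟨a, ha, rfl⟩ := mem_graph_smul.1 hf
  obtain ⟨b, hb, rfl⟩ := mem_graph_smul.1 hg
  rw [inner_smul_left, inner_smul_right, h _ _ _ _ ha hb, hcd]

theorem AdjPair.opMul {A B A' B' : E →ₗ.[ℂ] E} (h : AdjPair A B) (h' : AdjPair A' B') :
    AdjPair (opMul A A') (opMul B' B) := by
  intro f f' g g' hf hg
  obtain ⟨a, ha, ha'⟩ := mem_graph_opMul.1 hf
  obtain ⟨b, hb, hb'⟩ := mem_graph_opMul.1 hg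
  rw [h _ _ _ _ ha' hb, h' _ _ _ _ ha hb']

theorem AdjPair.closure {A B : E →ₗ.[ℂ] E} (h : AdjPair A B) : AdjPair A.closure B := by
  intro f f' g g' hf hg
  have hS : IsClosed {p : E × E | ⟪p.2, g⟫_ℂ = ⟪p.1, g'⟫_ℂ} :=
    isClosed_eq (by fun_prop) (by fun_prop)
  exact closure_graph_subset hS (fun p hp => h p.1 p.2 g g' hp hg) (graph_closure_le A hf)

/-- Membership in the graph of the adjoint of a densely defined operator. -/
theorem mem_graph_adjoint [CompleteSpace E] {A : E →ₗ.[ℂ] E} (hA : Dense (A.domain : Set E))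
    {g g' : E} :
    (g, g') ∈ A†.graph ↔ ∀ f f', (f, f') ∈ A.graph → ⟪f', g⟫_ℂ = ⟪f, g'⟫_ℂ := by
  rw [LinearPMap.adjoint_graph_eq_graph_adjoint hA, Submodule.mem_adjoint_iff]
  simp only [sub_eq_zero]

theorem AdjPair.adjoint_right [CompleteSpace E] {A : E →ₗ.[ℂ] E}
    (hA : Dense (A.domain : Set E)) : AdjPair A A† :=
  fun f f' _ _ hf hg => (mem_graph_adjoint hA).1 hg f f' hf

end Adjoint

/-! ### Evolution equations with skew-symmetric generators -/

section Evolution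

variable {E : Type*} [NormedAddCommGroup E] [InnerProductSpace ℂ E]

/-- The set `S` is total: only the zero vector is orthogonal to it. -/
def IsTotal (S : Set E) : Prop := ∀ f : E, (∀ g ∈ S, ⟪g, f⟫_ℂ = 0) → f = 0

theorem IsTotal.dense_span [CompleteSpace E] {S : Set E} (hS : IsTotal S) :
    Dense (Submodule.span ℂ S : Set E) := by
  rw [Submodule.dense_iff_topologicalClosure_eq_top, Submodule.topologicalClosure_eq_top_iff,
    Submodule.eq_bot_iff]
  intro f hf
  exact hS f fun g hg => hf g (Submodule.subset_span hg)

theorem eq_of_hasDerivAt_zero {F : Type*} [NormedAddCommGroup F] [NormedSpace ℝ F] {u : ℝ → F}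
    (hu : ∀ t, HasDerivAt u 0 t) (t : ℝ) : u t = u 0 :=
  is_const_of_deriv_eq_zero (fun t => (hu t).differentiableAt) (fun t => (hu t).deriv) t 0

theorem norm_eq_of_re_inner_eq_zero {d d' : ℝ → E} (hd : ∀ t, HasDerivAt d (d' t) t)
    (h : ∀ t, (⟪d' t, d t⟫_ℂ).re = 0) (t : ℝ) : ‖d t‖ = ‖d 0‖ := by
  have h1 : ∀ t, HasDerivAt (fun t => RCLike.re ⟪d t, d t⟫_ℂ) 0 t := by
    intro t
    have h2 := (hd t).inner ℂ (hd t)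
    have h3 := RCLike.reCLM (K := ℂ) |>.hasFDerivAt.comp_hasDerivAt t h2
    convert! h3 using 1
    have h4 : (⟪d t, d' t⟫_ℂ).re = (⟪d' t, d t⟫_ℂ).re := by
      rw [← inner_conj_symm, Complex.conj_re]
    change 0 = (⟪d t, d' t⟫_ℂ + ⟪d' t, d t⟫_ℂ).re
    rw [Complex.add_re, h4, h t, add_zero]
  have h2 := eq_of_hasDerivAt_zero h1 t
  rw [← norm_sq_eq_re_inner, ← norm_sq_eq_re_inner] at h2
  exact (sq_eq_sq₀ (norm_nonneg _) (norm_nonneg _)).1 h2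

theorem re_inner_eq_zero_of_adjPair_neg {A : E →ₗ.[ℂ] E} (hA : AdjPair A (-A)) {f f' : E}
    (h : (f, f') ∈ A.graph) : (⟪f', f⟫_ℂ).re = 0 := by
  have h1 : ⟪f', f⟫_ℂ = ⟪f, -f'⟫_ℂ :=
    hA f f' f (-f') h (mem_graph_neg.2 (by rwa [neg_neg]))
  have h2 : (⟪f, f'⟫_ℂ).re = (⟪f', f⟫_ℂ).re := by
    rw [← inner_conj_symm, Complex.conj_re]
  have h3 := congrArg Complex.re h1
  rw [inner_neg_right, Complex.neg_re, h2] at h3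
  linarith

/-- A curve that is weakly differentiable against a total set, with a continuous candidate for
the derivative, is differentiable in norm: it agrees with the integral of its derivative. -/
theorem hasDerivAt_of_forall_inner [CompleteSpace E] {S : Set E} (hS : IsTotal S)
    {u u' : ℝ → E} (hu' : Continuous u')
    (h : ∀ g ∈ S, ∀ t, HasDerivAt (fun t => ⟪g, u t⟫_ℂ) ⟪g, u' t⟫_ℂ t) (t : ℝ) :
    HasDerivAt u (u' t) t := by
  have hv : ∀ t, HasDerivAt (fun t => u 0 + ∫ s in (0 : ℝ)..t, u' s) (u' t) t := fun t =>
    (intervalIntegral.integral_hasDerivAt_right (hu'.intervalIntegrable _ _)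
      hu'.stronglyMeasurable.stronglyMeasurableAtFilter hu'.continuousAt).const_add _
  have he : u = fun t => u 0 + ∫ s in (0 : ℝ)..t, u' s := by
    funext t
    rw [← sub_eq_zero]
    refine hS _ fun g hg => ?_
    have h1 : ∀ t, HasDerivAt (fun t => ⟪g, u t - (u 0 + ∫ s in (0 : ℝ)..t, u' s)⟫_ℂ) 0 t := by
      intro t
      have h2 := (hasDerivAt_const t g).inner ℂ (hv t)
      have h3 := (h g hg t).sub h2
      simp only [inner_zero_left, add_zero, sub_self] at h3
      simpa only [inner_sub_right] using! h3
    have h2 := eq_of_hasDerivAt_zero h1 t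
    simpa using h2
  rw [he]
  simpa using hv t

/-- `y` is a solution of `y' = A y`. -/
def IsSolution (A : E →ₗ.[ℂ] E) (y : ℝ → E) : Prop :=
  ∀ t, ∃ y', (y t, y') ∈ A.graph ∧ HasDerivAt y y' t

theorem IsSolution.add {A : E →ₗ.[ℂ] E} {y z : ℝ → E} (hy : IsSolution A y)
    (hz : IsSolution A z) : IsSolution A (y + z) := by
  intro t
  obtain ⟨y', h1, h2⟩ := hy t
  obtain ⟨z', h3, h4⟩ := hz t
  exact ⟨y' + z', A.graph.add_mem h1 h3, h2.add h4⟩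

theorem IsSolution.smul {A : E →ₗ.[ℂ] E} {y : ℝ → E} (hy : IsSolution A y) (c : ℂ) :
    IsSolution A (c • y) := by
  intro t
  obtain ⟨y', h1, h2⟩ := hy t
  exact ⟨c • y', A.graph.smul_mem c h1, h2.const_smul c⟩

theorem isSolution_zero (A : E →ₗ.[ℂ] E) : IsSolution A 0 :=
  fun t => ⟨0, A.graph.zero_mem, hasDerivAt_const t 0⟩

theorem IsSolution.comp_add {A : E →ₗ.[ℂ] E} {y : ℝ → E} (hy : IsSolution A y) (s : ℝ) :
    IsSolution A (fun t => y (t + s)) := by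
  intro t
  obtain ⟨y', h1, h2⟩ := hy (t + s)
  exact ⟨y', h1, h2.comp_add_const t s⟩

theorem IsSolution.norm_eq {A : E →ₗ.[ℂ] E} (hA : AdjPair A (-A)) {y : ℝ → E}
    (hy : IsSolution A y) (t : ℝ) : ‖y t‖ = ‖y 0‖ := by
  choose y' h1 h2 using hy
  exact norm_eq_of_re_inner_eq_zero h2 (fun t => re_inner_eq_zero_of_adjPair_neg hA (h1 t)) t

theorem IsSolution.eq {A : E →ₗ.[ℂ] E} (hA : AdjPair A (-A)) {y z : ℝ → E}
    (hy : IsSolution A y) (hz : IsSolution A z) (h0 : y 0 = z 0) : y = z := by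
  funext t
  have h1 := (hy.add (hz.smul (-1))).norm_eq hA t
  simp only [Pi.add_apply, Pi.neg_apply, h0, neg_smul, one_smul, add_neg_cancel, norm_zero,
    norm_eq_zero] at h1
  exact add_neg_eq_zero.1 h1

theorem exists_isSolution_of_mem_span {A : E →ₗ.[ℂ] E} {S : Set E}
    (h : ∀ v ∈ S, ∃ y, IsSolution A y ∧ y 0 = v ∧ ∀ t, y t ∈ Submodule.span ℂ S) {v : E}
    (hv : v ∈ Submodule.span ℂ S) :
    ∃ y, IsSolution A y ∧ y 0 = v ∧ ∀ t, y t ∈ Submodule.span ℂ S := by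
  induction hv using Submodule.span_induction with
  | mem v hv => exact h v hv
  | zero => exact ⟨0, isSolution_zero A, rfl, fun t => Submodule.zero_mem _⟩
  | add v w _ _ hv hw =>
    obtain ⟨y, h1, h2, h3⟩ := hv
    obtain ⟨z, h4, h5, h6⟩ := hw
    exact ⟨y + z, h1.add h4, by simp [h2, h5], fun t => Submodule.add_mem _ (h3 t) (h6 t)⟩
  | smul c v _ hv =>
    obtain ⟨y, h1, h2, h3⟩ := hv
    exact ⟨c • y, h1.smul c, by simp [h2], fun t => Submodule.smul_mem _ c (h3 t)⟩

/-- If the equation `y' = A y` with skew-symmetric `A` has global solutions within the span of a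
total set, starting at each vector of that set, then the solutions extend to a strongly
continuous one-parameter group of unitary operators. The generator of that group extends every
operator that is formally skew-adjoint to `A` on the span. -/
theorem exists_unitaryGroup [CompleteSpace E] {A : E →ₗ.[ℂ] E} (hA : AdjPair A (-A)) {S : Set E}
    (hS : IsTotal S)
    (h : ∀ v ∈ S, ∃ y, IsSolution A y ∧ y 0 = v ∧ ∀ t, y t ∈ Submodule.span ℂ S) :
    ∃ U : ℝ → unitary (E →L[ℂ] E), (∀ s t, U (s + t) = U s * U t) ∧
      (∀ f, Continuous fun t => (U t : E →L[ℂ] E) f) ∧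
      ∀ f f', (∀ g ∈ Submodule.span ℂ S, ∀ g', (g, g') ∈ A.graph → ⟪g, f'⟫_ℂ = -⟪g', f⟫_ℂ) →
        HasDerivAt (fun t => (U t : E →L[ℂ] E) f) f' 0 := by
  set M := Submodule.span ℂ S with hM
  have hMd : Dense (M : Set E) := hS.dense_span
  have hex : ∀ v : M, ∃ y, IsSolution A y ∧ y 0 = v ∧ ∀ t, y t ∈ M := fun v =>
    exists_isSolution_of_mem_span h v.2
  choose Y hY1 hY2 hY3 using hex
  have hYeq : ∀ (v : M) (y : ℝ → E), IsSolution A y → y 0 = v → Y v = y := fun v y hy h0 =>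
    (hY1 v).eq hA hy ((hY2 v).trans h0.symm)
  -- the evolution on the span, a linear isometry
  let L : ℝ → M →L[ℂ] E := fun t => LinearMap.mkContinuous
    { toFun := fun v => Y v t
      map_add' := fun v w => by
        rw [hYeq (v + w) (Y v + Y w) ((hY1 v).add (hY1 w)) (by simp [hY2])]; rfl
      map_smul' := fun c v => by
        rw [hYeq (c • v) (c • Y v) ((hY1 v).smul c) (by simp [hY2])]; rfl } 1
    (fun v => by
      have := (hY1 v).norm_eq hA t
      rw [hY2] at this
      simpa using this.le)
  have hL : ∀ t v, L t v = Y v t := fun t v => rfl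
  have hdr : DenseRange M.subtypeL := by
    rw [DenseRange]
    simpa using hMd
  have hui : IsUniformInducing M.subtypeL := isUniformInducing_iff_uniformSpace.2 rfl
  let W : ℝ → E →L[ℂ] E := fun t => (L t).extend M.subtypeL
  have hW : ∀ t (v : M), W t v = Y v t := fun t v => by
    have := ContinuousLinearMap.extend_eq (L t) hdr hui v
    rw [hL] at this
    exact this
  have hind : ∀ {B C : E → E}, Continuous B → Continuous C → (∀ v : M, B v = C v) → B = C := by
    intro B C hB hC hBC
    exact DenseRange.equalizer hdr hB hC (funext fun v => hBC v)
  have hnorm : ∀ t f, ‖W t f‖ = ‖f‖ := by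
    intro t f
    refine DenseRange.induction_on (p := fun f => ‖W t f‖ = ‖f‖) hdr f
      (isClosed_eq (by fun_prop) (by fun_prop)) fun v => ?_
    change ‖W t v‖ = ‖(v : E)‖
    rw [hW, (hY1 v).norm_eq hA t, hY2]
  have hadd : ∀ s t, W (s + t) = W s * W t := by
    intro s t
    have : (fun f => W (s + t) f) = fun f => W s (W t f) := by
      refine hind (by fun_prop) (by fun_prop) fun v => ?_
      rw [hW, hW, hW s ⟨Y v t, hY3 v t⟩,
        hYeq ⟨Y v t, hY3 v t⟩ (fun s => Y v (s + t)) ((hY1 v).comp_add t) (by simp)]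
    ext f
    exact congrFun this f
  have hzero : W 0 = 1 := by
    have : (fun f => W 0 f) = fun f => f := by
      refine hind (by fun_prop) (by fun_prop) fun v => ?_
      rw [hW, hY2]
    ext f
    exact congrFun this f
  have hstar : ∀ t, star (W t) * W t = 1 := fun t =>
    (ContinuousLinearMap.norm_map_iff_adjoint_comp_self (W t)).1 (hnorm t)
  have hinv : ∀ t, W t * W (-t) = 1 := fun t => by rw [← hadd, add_neg_cancel, hzero]
  have hstar' : ∀ t, star (W t) = W (-t) := fun t => by
    calc star (W t) = star (W t) * (W t * W (-t)) := by rw [hinv, mul_one]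
      _ = W (-t) := by rw [← mul_assoc, hstar, one_mul]
  have hcont : ∀ f, Continuous fun t => W t f := by
    intro f
    refine continuous_of_uniform_approx_of_continuous fun u hu => ?_
    obtain ⟨ε, hε, hεu⟩ := Metric.mem_uniformity_dist.1 hu
    obtain ⟨v, hv, hfv⟩ := hMd.exists_dist_lt f hε
    refine ⟨fun t => W t v, ?_, fun t => hεu ?_⟩
    · have : (fun t => W t v) = Y ⟨v, hv⟩ := funext fun t => hW t ⟨v, hv⟩
      rw [this]
      exact continuous_iff_continuousAt.2 fun t => (hY1 ⟨v, hv⟩ t).choose_spec.2.continuousAt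
    · rwa [dist_eq_norm, ← map_sub, hnorm, ← dist_eq_norm]
  refine ⟨fun t => ⟨W t, Unitary.mem_iff.2 ⟨hstar t, by rw [hstar', hinv]⟩⟩,
    fun s t => Subtype.ext (hadd s t), hcont, fun f f' hff' => ?_⟩
  have key := hasDerivAt_of_forall_inner hS (u := fun t => W t f) (u' := fun t => W t f')
    (hcont f') ?_ 0
  · simpa [hzero] using key
  intro g hg t
  -- the group is moved to the left factor, where it acts on a solution within the span
  have hmove : ∀ (k : E) (s : ℝ), ⟪g, W s k⟫_ℂ = ⟪Y ⟨g, Submodule.subset_span hg⟩ (-s), k⟫_ℂ := by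
    intro k s
    rw [← hW (-s) ⟨g, Submodule.subset_span hg⟩, ← hstar' s, ContinuousLinearMap.star_eq_adjoint,
      ContinuousLinearMap.adjoint_inner_left]
  simp only [hmove]
  obtain ⟨y', h1, h2⟩ := hY1 ⟨g, Submodule.subset_span hg⟩ (-t)
  have h3 : HasDerivAt (fun s : ℝ => Y ⟨g, Submodule.subset_span hg⟩ (-s)) (-y') t := by
    simpa using! h2.scomp t (hasDerivAt_neg t)
  have h4 := h3.inner ℂ (hasDerivAt_const t f)
  rw [hff' _ (hY3 _ _) y' h1]
  simpa using! h4

/-- The orbits of a one-parameter group are the solutions of its differential equation. -/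
theorem eq_of_unitaryGroup [CompleteSpace E] {U : ℝ → unitary (E →L[ℂ] E)}
    (hU : ∀ s t, U (s + t) = U s * U t) {y y' : ℝ → E} (hy : ∀ t, HasDerivAt y (y' t) t)
    (hy' : ∀ t, HasDerivAt (fun s => (U s : E →L[ℂ] E) (y t)) (y' t) 0) (t : ℝ) :
    (U t : E →L[ℂ] E) (y 0) = y t := by
  have hadd : ∀ s t f, (U (s + t) : E →L[ℂ] E) f = (U s : E →L[ℂ] E) ((U t : E →L[ℂ] E) f) := by
    intro s t f
    rw [hU]; rfl
  have hadd' : ∀ s t f, (U (s + t) : E →L[ℂ] E) f = (U t : E →L[ℂ] E) ((U s : E →L[ℂ] E) f) := by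
    intro s t f
    rw [add_comm, hadd]
  have hzero : U 0 = 1 := by
    have := hU 0 0
    rw [add_zero] at this
    exact left_eq_mul.1 this
  have hinner : ∀ t f, ⟪(U t : E →L[ℂ] E) f, (U t : E →L[ℂ] E) f⟫_ℂ = ⟪f, f⟫_ℂ := by
    intro t f
    rw [← ContinuousLinearMap.adjoint_inner_right, ← ContinuousLinearMap.star_eq_adjoint]
    have : star (U t : E →L[ℂ] E) * (U t : E →L[ℂ] E) = 1 := (Unitary.mem_iff.1 (U t).2).1
    have h2 := congrArg (fun B : E →L[ℂ] E => B f) this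
    simp only [mul_apply_eq_comp, one_apply_eq_self] at h2
    rw [h2]
  have hz : ∀ t, HasDerivAt (fun s => (U s : E →L[ℂ] E) (y 0)) ((U t : E →L[ℂ] E) (y' 0)) t := by
    intro t
    have h1 : HasDerivAt (fun s => (U s : E →L[ℂ] E) (y 0)) (y' 0) (t - t) := by
      simpa using hy' 0
    have h2 := ((U t : E →L[ℂ] E).restrictScalars ℝ).hasFDerivAt.comp_hasDerivAt t
      (h1.comp_sub_const t t)
    convert! h2 using 1
    funext s
    change _ = (U t : E →L[ℂ] E) ((U (s - t) : E →L[ℂ] E) (y 0))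
    rw [← hadd, add_sub_cancel]
  have hd : ∀ t, HasDerivAt (fun s => (U s : E →L[ℂ] E) (y 0) - y s)
      ((U t : E →L[ℂ] E) (y' 0) - y' t) t := fun t => (hz t).sub (hy t)
  have hskew : ∀ t, (⟪(U t : E →L[ℂ] E) (y' 0) - y' t,
      (U t : E →L[ℂ] E) (y 0) - y t⟫_ℂ).re = 0 := by
    intro t
    set f := (U t : E →L[ℂ] E) (y 0) - y t
    set f' := (U t : E →L[ℂ] E) (y' 0) - y' t
    have h1 : HasDerivAt (fun s => (U s : E →L[ℂ] E) f) f' 0 := by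
      have h2 := ((U t : E →L[ℂ] E).restrictScalars ℝ).hasFDerivAt.comp_hasDerivAt 0 (hy' 0)
      have h3 := h2.sub (hy' t)
      convert! h3 using 1
      funext s
      simp only [f, map_sub, Pi.sub_apply, Function.comp_apply,
        ContinuousLinearMap.coe_restrictScalars']
      rw [← hadd, ← hadd']
    have h2 := h1.inner ℂ h1
    have h3 := h2.unique (by simp only [hinner]; exact hasDerivAt_const 0 _)
    simp only [hzero, OneMemClass.coe_one, one_apply_eq_self] at h3
    have h4 : (⟪f, f'⟫_ℂ).re = (⟪f', f⟫_ℂ).re := by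
      rw [← inner_conj_symm, Complex.conj_re]
    have h5 := congrArg Complex.re h3
    rw [Complex.add_re, h4, Complex.zero_re] at h5
    linarith
  have h1 := norm_eq_of_re_inner_eq_zero hd hskew t
  simp only [hzero, OneMemClass.coe_one, one_apply_eq_self, sub_self, norm_zero,
    norm_eq_zero] at h1
  exact sub_eq_zero.1 h1

end Evolution

/-! ### Symmetry of position and momentum -/

theorem mem_graph_Q {f g : L2} : (f, g) ∈ Q.graph ↔ ∀ᵐ x : ℝ, g x = (x : ℂ) * f x := by
  rw [Q_graph]
  rfl

theorem mem_graph_P {f g : L2} : (f, g) ∈ P.graph ↔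
    ∀ φ : ℝ → ℝ, ContDiff ℝ ∞ φ → HasCompactSupport φ →
      ∫ x, deriv φ x • f x = - ∫ x, φ x • (I * g x) := by
  rw [P_graph]
  rfl

theorem adjPair_Q : AdjPair Q Q := by
  intro f f' g g' hf hg
  rw [L2.inner_def, L2.inner_def]
  refine integral_congr_ae ?_
  filter_upwards [mem_graph_Q.1 hf, mem_graph_Q.1 hg] with x h1 h2
  rw [h1, h2]
  simp only [RCLike.inner_apply, map_mul, Complex.conj_ofReal]
  ring

/-- The translation `f ↦ f(· + t)` of `L²(ℝ)`. -/
def translation (t : ℝ) : L2 →ₗᵢ[ℂ] L2 :=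
  Lp.compMeasurePreservingₗᵢ ℂ (fun x : ℝ => x + t) (measurePreserving_add_right volume t)

theorem coeFn_translation (t : ℝ) (f : L2) : translation t f =ᵐ[volume] fun x => f (x + t) :=
  Lp.coeFn_compMeasurePreserving f (measurePreserving_add_right volume t)

theorem translation_zero (f : L2) : translation 0 f = f := by
  refine Lp.ext ?_
  filter_upwards [coeFn_translation 0 f] with x h
  rw [h, add_zero]

theorem continuous_translation (f : L2) : Continuous fun t => translation t f := by
  have hg : Continuous fun t : ℝ => (⟨fun x => x + t, by fun_prop⟩ : C(ℝ, ℝ)) :=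
    ContinuousMap.continuous_of_continuous_uncurry _
      (continuous_snd.add continuous_fst : Continuous fun p : ℝ × ℝ => p.2 + p.1)
  exact (continuous_const (y := f)).compMeasurePreservingLp hg
    (fun t => measurePreserving_add_right volume t) (by norm_num)

/-- The classes of test functions. -/
def testClasses : Set L2 :=
  {g | ∃ φ : ℝ → ℝ, ContDiff ℝ ∞ φ ∧ HasCompactSupport φ ∧ g =ᵐ[volume] fun x => (φ x : ℂ)}

theorem inner_eq_of_test {φ : ℝ → ℝ} {g : L2} (hg : g =ᵐ[volume] fun x => (φ x : ℂ)) (f : L2) :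
    ⟪g, f⟫_ℂ = ∫ x, φ x • f x := by
  rw [L2.inner_def]
  refine integral_congr_ae ?_
  filter_upwards [hg] with x h
  rw [h, RCLike.inner_apply, Complex.conj_ofReal, Complex.real_smul, mul_comm]

theorem isTotal_testClasses : IsTotal testClasses := by
  intro f hf
  refine Lp.ext ?_
  have key : ∀ᵐ x : ℝ, f x = 0 := by
    refine ae_eq_zero_of_integral_contDiff_smul_eq_zero
      ((Lp.memLp f).locallyIntegrable (by norm_num)) ?_
    intro φ h1 h2
    have h3 : MemLp (fun x => (φ x : ℂ)) 2 (volume : Measure ℝ) :=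
      (Complex.continuous_ofReal.comp h1.continuous).memLp_of_hasCompactSupport
        (h2.comp_left (g := fun r : ℝ => (r : ℂ)) Complex.ofReal_zero)
    rw [← inner_eq_of_test h3.coeFn_toLp f]
    exact hf _ ⟨φ, h1, h2, h3.coeFn_toLp⟩
  filter_upwards [key, Lp.coeFn_zero ℂ 2 (volume : Measure ℝ)] with x h1 h2
  simp [h1]

theorem inner_translation {φ : ℝ → ℝ} {g : L2} (hg : g =ᵐ[volume] fun x => (φ x : ℂ)) (f : L2)
    (t : ℝ) : ⟪g, translation t f⟫_ℂ = ∫ x, φ x • f (x + t) := by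
  rw [inner_eq_of_test hg]
  refine integral_congr_ae ?_
  filter_upwards [coeFn_translation t f] with x h
  rw [h]

/-- On its domain, `iP` is the derivative of the group of translations. -/
theorem hasDerivAt_translation {f f' : L2} (hf : (f, f') ∈ P.graph) :
    HasDerivAt (fun t => translation t f) (I • f') 0 := by
  have key := hasDerivAt_of_forall_inner isTotal_testClasses (u := fun t => translation t f)
    (u' := fun t => translation t (I • f')) (continuous_translation _) ?_ 0
  · simpa only [translation_zero] using! key
  rintro g ⟨φ, h1, h2, hg⟩ t
  have hψ : ContDiff ℝ 1 fun s : ℝ => φ (-s) := (h1.of_le (by simp)).comp contDiff_neg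
  have hψc : HasCompactSupport fun s : ℝ => φ (-s) := h2.comp_homeomorph (Homeomorph.neg ℝ)
  have hloc : LocallyIntegrable f (volume : Measure ℝ) :=
    (Lp.memLp f).locallyIntegrable (by norm_num)
  have h3 := hψc.hasDerivAt_convolution_left (ContinuousLinearMap.lsmul ℝ ℝ) hψ hloc t
  have e1 : (fun t => ⟪g, translation t f⟫_ℂ) =
      convolution (fun s : ℝ => φ (-s)) f (ContinuousLinearMap.lsmul ℝ ℝ) volume := by
    funext t
    rw [inner_translation hg, convolution_def]
    rw [← integral_neg_eq_self]
    refine integral_congr_ae (Filter.Eventually.of_forall fun s => ?_)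
    simp [sub_eq_neg_add]
  rw [e1]
  convert! h3 using 1
  rw [inner_translation hg, convolution_def]
  have hd : deriv (fun s : ℝ => φ (-s)) = fun s => -deriv φ (-s) := by
    funext s
    rw [deriv_comp_neg]
  have h4 := mem_graph_P.1 hf (fun x => φ (x - t)) (h1.comp (contDiff_id.sub contDiff_const))
    (h2.comp_homeomorph (Homeomorph.subRight t))
  have hd' : deriv (fun x : ℝ => φ (x - t)) = fun x => deriv φ (x - t) := by
    funext x
    rw [deriv_comp_sub_const]
  rw [hd'] at h4
  have e2 : ∫ x, φ x • (I • f' : L2) (x + t) = ∫ x, φ (x - t) • (I * f' x) := by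
    have := integral_sub_right_eq_self (μ := (volume : Measure ℝ))
      (fun x => φ x • (I • f' : L2) (x + t)) t
    rw [← this]
    refine integral_congr_ae ?_
    filter_upwards [Lp.coeFn_smul I f'] with x hx
    rw [sub_add_cancel, hx, Pi.smul_apply, smul_eq_mul]
  rw [e2]
  have e3 : ∫ s, (ContinuousLinearMap.lsmul ℝ ℝ) (deriv (fun s : ℝ => φ (-s)) s) (f (t - s)) =
      -∫ x, deriv φ (x - t) • f x := by
    rw [hd, ← integral_sub_left_eq_self _ volume t, ← integral_neg]
    refine integral_congr_ae (Filter.Eventually.of_forall fun s => ?_)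
    simp
  rw [e3, h4, neg_neg]

theorem adjPair_P : AdjPair P P := by
  intro f f' g g' hf hg
  have h1 := (hasDerivAt_translation hf).inner ℂ (hasDerivAt_translation hg)
  have h2 := h1.unique (by
    simp only [LinearIsometry.inner_map_map]
    exact hasDerivAt_const 0 _)
  simp only [translation_zero, inner_smul_left, inner_smul_right, conj_I] at h2
  have h3 : I * (⟪f, g'⟫_ℂ - ⟪f', g⟫_ℂ) = 0 := by rw [← h2]; ring
  exact (sub_eq_zero.1 ((mul_eq_zero.1 h3).resolve_left I_ne_zero)).symm

/-! ### Gaussians multiplied by polynomials -/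

/-- The function `p(x) e^{-w x²/2}`. -/
def gaussFun (w : ℂ) (p : Polynomial ℂ) (x : ℝ) : ℂ :=
  p.eval (x : ℂ) * Complex.exp (-(w * (x : ℂ) ^ 2 / 2))

theorem continuous_gaussFun (w : ℂ) (p : Polynomial ℂ) : Continuous (gaussFun w p) := by
  unfold gaussFun
  have : Continuous fun x : ℝ => p.eval (x : ℂ) := p.continuous.comp Complex.continuous_ofReal
  fun_prop

theorem norm_exp_gauss (w : ℂ) (x : ℝ) :
    ‖Complex.exp (-(w * (x : ℂ) ^ 2 / 2))‖ = Real.exp (-(w.re * x ^ 2 / 2)) := by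
  rw [Complex.norm_exp]
  congr 1
  rw [← Complex.ofReal_pow, Complex.neg_re, Complex.div_ofNat_re, Complex.re_mul_ofReal]

theorem memLp_gaussFun {w : ℂ} (hw : 0 < w.re) (p : Polynomial ℂ) :
    MemLp (gaussFun w p) 2 (volume : Measure ℝ) := by
  induction p using Polynomial.induction_on' with
  | add p q hp hq =>
    have : gaussFun w (p + q) = gaussFun w p + gaussFun w q := by
      funext x
      simp [gaussFun, add_mul]
    rw [this]
    exact hp.add hq
  | monomial n c =>
    rw [memLp_two_iff_integrable_sq_norm (continuous_gaussFun w _).aestronglyMeasurable]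
    have h1 := (integrable_rpow_mul_exp_neg_mul_sq hw (s := (2 * n : ℕ))
      (by linarith [(Nat.cast_nonneg (2 * n) : (0 : ℝ) ≤ (2 * n : ℕ))])).const_mul (‖c‖ ^ 2)
    refine h1.congr (Filter.Eventually.of_forall fun x => ?_)
    simp only [gaussFun, Polynomial.eval_monomial, norm_mul, norm_exp_gauss, norm_pow,
      Complex.norm_real, Real.rpow_natCast, mul_pow]
    rw [← Real.exp_nat_mul, ← pow_mul, mul_comm n 2, pow_mul ‖x‖, Real.norm_eq_abs, sq_abs,
      ← pow_mul, mul_assoc]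
    congr 3
    push_cast
    ring

open scoped Classical in
/-- The vector `p(x) e^{-w x²/2}` of `L²(ℝ)`, linear in the polynomial `p`; it is only of
interest for `w` in the right half-plane, and set to zero otherwise. -/
def J (w : ℂ) : Polynomial ℂ →ₗ[ℂ] L2 :=
  if hw : 0 < w.re then
    { toFun := fun p => (memLp_gaussFun hw p).toLp _
      map_add' := fun p q => by
        rw [← MemLp.toLp_add]
        refine MemLp.toLp_congr _ _ (Filter.Eventually.of_forall fun x => ?_)
        simp [gaussFun, add_mul]
      map_smul' := fun c p => by
        rw [RingHom.id_apply, ← MemLp.toLp_const_smul]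
        refine MemLp.toLp_congr _ _ (Filter.Eventually.of_forall fun x => ?_)
        simp [gaussFun, mul_assoc] }
  else 0

theorem coeFn_J {w : ℂ} (hw : 0 < w.re) (p : Polynomial ℂ) :
    J w p =ᵐ[volume] gaussFun w p := by
  rw [J, dif_pos hw]
  exact (memLp_gaussFun hw p).coeFn_toLp

/-- The operator on polynomials which corresponds to `d/dx` on the multiples of `e^{-w x²/2}`. -/
def gaussD (w : ℂ) (p : Polynomial ℂ) : Polynomial ℂ :=
  p.derivative - Polynomial.C w * Polynomial.X * p

theorem J_mem_graph_Q {w : ℂ} (hw : 0 < w.re) (p : Polynomial ℂ) :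
    (J w p, J w (Polynomial.X * p)) ∈ Q.graph := by
  rw [mem_graph_Q]
  filter_upwards [coeFn_J hw p, coeFn_J hw (Polynomial.X * p)] with x h1 h2
  rw [h1, h2]
  simp [gaussFun, mul_assoc]

theorem hasDerivAt_gaussFun (w : ℂ) (p : Polynomial ℂ) (x : ℝ) :
    HasDerivAt (gaussFun w p) (gaussFun w (gaussD w p) x) x := by
  have h1 : HasDerivAt (fun z : ℂ => p.eval z) (p.derivative.eval (x : ℂ)) (x : ℂ) :=
    p.hasDerivAt (x : ℂ)
  have h2 : HasDerivAt (fun z : ℂ => Complex.exp (-(w * z ^ 2 / 2)))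
      (Complex.exp (-(w * (x : ℂ) ^ 2 / 2)) * (-(w * (2 * (x : ℂ)) / 2))) (x : ℂ) := by
    have h3 := (((hasDerivAt_pow 2 (x : ℂ)).const_mul w).div_const 2).neg.cexp
    simpa using! h3
  have h4 := (h1.mul h2).comp_ofReal
  convert! h4 using 1
  simp only [gaussFun, gaussD, Polynomial.eval_sub, Polynomial.eval_mul, Polynomial.eval_C,
    Polynomial.eval_X]
  ring

theorem J_mem_graph_P {w : ℂ} (hw : 0 < w.re) (p : Polynomial ℂ) :
    (J w p, J w ((-I) • gaussD w p)) ∈ P.graph := by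
  rw [mem_graph_P]
  intro φ h1 h2
  have hφ : Continuous φ := h1.continuous
  have hφ' : Continuous (deriv φ) := h1.continuous_deriv (by simp)
  have e1 : ∫ x, deriv φ x • J w p x = ∫ x, ((deriv φ x : ℝ) : ℂ) * gaussFun w p x := by
    refine integral_congr_ae ?_
    filter_upwards [coeFn_J hw p] with x h
    rw [h, Complex.real_smul]
  have e2 : ∫ x, φ x • (I * J w ((-I) • gaussD w p) x) =
      ∫ x, (φ x : ℂ) * gaussFun w (gaussD w p) x := by
    refine integral_congr_ae ?_
    filter_upwards [coeFn_J hw ((-I) • gaussD w p)] with x h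
    rw [h, Complex.real_smul]
    simp only [gaussFun, Polynomial.eval_smul, smul_eq_mul]
    linear_combination (-(φ x : ℂ) * (gaussD w p).eval (x : ℂ) *
      Complex.exp (-(w * (x : ℂ) ^ 2 / 2))) * I_mul_I
  rw [e1, e2]
  have hint : ∀ {ψ : ℝ → ℝ} (q : Polynomial ℂ), Continuous ψ → HasCompactSupport ψ →
      Integrable fun x => (ψ x : ℂ) * gaussFun w q x := by
    intro ψ q hψ hc
    refine Continuous.integrable_of_hasCompactSupport
      ((Complex.continuous_ofReal.comp hψ).mul (continuous_gaussFun w q)) ?_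
    exact (hc.comp_left (g := fun r : ℝ => (r : ℂ)) Complex.ofReal_zero).mul_right
  have := integral_mul_deriv_eq_deriv_mul_of_integrable (u := fun x => (φ x : ℂ))
    (u' := fun x => ((deriv φ x : ℝ) : ℂ)) (v := gaussFun w p) (v' := gaussFun w (gaussD w p))
    (fun x _ => (h1.differentiable (by simp) x).hasDerivAt.ofReal_comp)
    (fun x _ => hasDerivAt_gaussFun w p x) (hint _ hφ h2) (hint _ hφ' h2.deriv) (hint _ hφ h2)
  rw [this, neg_neg]

/-- The Gaussians depend holomorphically on `w`, as vectors of `L²(ℝ)`. -/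
theorem hasDerivAt_J {w : ℂ} (hw : 0 < w.re) (p : Polynomial ℂ) :
    HasDerivAt (fun z => J z p) (J w (Polynomial.C (-1 / 2) * Polynomial.X ^ 2 * p)) w := by
  rw [hasDerivAt_iff_isLittleO_nhds_zero]
  -- the remainder is dominated by a Gaussian with half the decay
  set a : ℂ := ((w.re / 2 : ℝ) : ℂ) with ha
  have ha' : 0 < a.re := by simpa [ha] using hw
  set C : ℝ := ‖J a (Polynomial.C (1 / 4) * Polynomial.X ^ 4 * p)‖
  have hO : (fun h : ℂ => J (w + h) p - J w p -
      h • J w (Polynomial.C (-1 / 2) * Polynomial.X ^ 2 * p)) =O[nhds 0] fun h => ‖h‖ ^ 2 := by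
    refine Asymptotics.IsBigO.of_bound C ?_
    have hball : ∀ᶠ h : ℂ in nhds 0, ‖h‖ < w.re / 2 := by
      have := Metric.ball_mem_nhds (0 : ℂ) (half_pos hw)
      filter_upwards [this] with h hh
      simpa using hh
    filter_upwards [hball] with h hh
    have hwh : 0 < (w + h).re := by
      have := (abs_le.1 (Complex.abs_re_le_norm h)).1
      rw [Complex.add_re]
      linarith
    rw [norm_pow, norm_norm, mul_comm C]
    refine Lp.norm_le_mul_norm_of_ae_le_mul ?_
    filter_upwards [coeFn_J hwh p, coeFn_J hw p,
      coeFn_J hw (Polynomial.C (-1 / 2) * Polynomial.X ^ 2 * p),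
      coeFn_J ha' (Polynomial.C (1 / 4) * Polynomial.X ^ 4 * p),
      Lp.coeFn_sub (J (w + h) p - J w p)
        (h • J w (Polynomial.C (-1 / 2) * Polynomial.X ^ 2 * p)),
      Lp.coeFn_sub (J (w + h) p) (J w p),
      Lp.coeFn_smul h (J w (Polynomial.C (-1 / 2) * Polynomial.X ^ 2 * p))]
      with x h1 h2 h3 h4 h5 h6 h7
    rw [h5, Pi.sub_apply, h6, Pi.sub_apply, h7, Pi.smul_apply, h1, h2, h3, h4]
    set z : ℂ := -(h * (x : ℂ) ^ 2 / 2) with hz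
    have e1 : gaussFun (w + h) p x - gaussFun w p x -
        h • gaussFun w (Polynomial.C (-1 / 2) * Polynomial.X ^ 2 * p) x =
        gaussFun w p x * (Complex.exp z - 1 - z) := by
      have : Complex.exp (-((w + h) * (x : ℂ) ^ 2 / 2)) =
          Complex.exp (-(w * (x : ℂ) ^ 2 / 2)) * Complex.exp z := by
        rw [← Complex.exp_add]
        congr 1
        rw [hz]
        ring
      simp only [gaussFun, this, Polynomial.eval_mul, Polynomial.eval_C, Polynomial.eval_pow,
        Polynomial.eval_X, smul_eq_mul]
      rw [hz]
      ring
    have e2 : ‖Complex.exp z - 1 - z‖ ≤ ‖z‖ ^ 2 * Real.exp ‖z‖ := by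
      have := Complex.norm_exp_sub_sum_le_norm_mul_exp z 2
      simpa [Finset.sum_range_succ, sub_sub] using this
    have e3 : ‖z‖ = ‖h‖ * x ^ 2 / 2 := by
      rw [hz, norm_neg, norm_div, norm_mul, norm_pow, Complex.norm_real, Real.norm_eq_abs, sq_abs]
      simp
    rw [e1, norm_mul]
    simp only [gaussFun, norm_mul, norm_exp_gauss, Polynomial.eval_mul, Polynomial.eval_C,
      Polynomial.eval_pow, Polynomial.eval_X, norm_pow, Complex.norm_real]
    have e4 : Real.exp (-(w.re * x ^ 2 / 2)) * Real.exp ‖z‖ ≤ Real.exp (-(a.re * x ^ 2 / 2)) := by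
      rw [← Real.exp_add, Real.exp_le_exp, e3, ha, Complex.ofReal_re]
      nlinarith [sq_nonneg x, mul_le_mul_of_nonneg_right hh.le (sq_nonneg x)]
    have e5 : ‖z‖ ^ 2 = ‖h‖ ^ 2 * (‖(1 / 4 : ℂ)‖ * ‖x‖ ^ 4) := by
      rw [e3, Real.norm_eq_abs, show |x| ^ 4 = x ^ 4 from by
        rw [show (4 : ℕ) = 2 * 2 from rfl, pow_mul, sq_abs, ← pow_mul]]
      norm_num
      ring
    calc ‖Polynomial.eval (x : ℂ) p‖ * Real.exp (-(w.re * x ^ 2 / 2)) * ‖Complex.exp z - 1 - z‖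
        ≤ ‖Polynomial.eval (x : ℂ) p‖ * Real.exp (-(w.re * x ^ 2 / 2)) *
          (‖z‖ ^ 2 * Real.exp ‖z‖) := by gcongr
      _ = ‖Polynomial.eval (x : ℂ) p‖ * ‖z‖ ^ 2 *
          (Real.exp (-(w.re * x ^ 2 / 2)) * Real.exp ‖z‖) := by ring
      _ ≤ ‖Polynomial.eval (x : ℂ) p‖ * ‖z‖ ^ 2 * Real.exp (-(a.re * x ^ 2 / 2)) := by gcongr
      _ = _ := by rw [e5]; ring
  refine hO.trans_isLittleO ?_
  have := (Asymptotics.isLittleO_norm_pow_id (E' := ℂ) (n := 2) (by norm_num))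
  exact this

/-! ### Completeness of the polynomials times the standard Gaussian -/

/-- A function with exponential decay all of whose moments vanish is zero: its Fourier transform
is the sum of a power series whose coefficients are the moments. -/
theorem ae_eq_zero_of_moments {F : ℝ → ℂ}
    (hF : ∀ τ : ℝ, Integrable fun x => (Real.exp (τ * |x|) : ℂ) * F x)
    (hm : ∀ n : ℕ, ∫ x : ℝ, (x : ℂ) ^ n * F x = 0) : ∀ᵐ x : ℝ, F x = 0 := by
  have hF0 : Integrable F := by simpa using hF 0
  have hfour : ∀ ξ : ℝ, FourierTransform.fourier F ξ = 0 := by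
    intro ξ
    rw [Real.fourier_real_eq_integral_exp_smul]
    set c : ℂ := ((-2 * Real.pi * ξ : ℝ) : ℂ) * I with hc
    have hsum := hasSum_integral_of_dominated_convergence (μ := (volume : Measure ℝ))
      (F := fun (n : ℕ) (x : ℝ) => (c * x) ^ n / (n.factorial : ℂ) * F x)
      (f := fun x : ℝ => Complex.exp (c * x) * F x)
      (fun n x => (‖c‖ * |x|) ^ n / (n.factorial : ℝ) * ‖F x‖)
      (fun n => by
        refine (Continuous.aestronglyMeasurable ?_).mul hF0.aestronglyMeasurable
        fun_prop)
      (fun n => Filter.Eventually.of_forall fun x => by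
        simp)
      (Filter.Eventually.of_forall fun x => (Real.summable_pow_div_factorial _).mul_right _)
      (by
        refine (hF ‖c‖).norm.congr (Filter.Eventually.of_forall fun x => ?_)
        simp only [norm_mul, Complex.norm_real, tsum_mul_right]
        rw [Real.norm_of_nonneg (Real.exp_nonneg _), Real.exp_eq_exp_ℝ,
          NormedSpace.exp_eq_tsum_div])
      (Filter.Eventually.of_forall fun x => by
        refine HasSum.mul_right _ ?_
        rw [Complex.exp_eq_exp_ℂ]
        exact NormedSpace.expSeries_div_hasSum_exp (c * x))
    have hz : ∀ n : ℕ, ∫ x : ℝ, (c * x) ^ n / (n.factorial : ℂ) * F x = 0 := by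
      intro n
      have : ∀ x : ℝ, (c * x) ^ n / (n.factorial : ℂ) * F x =
          (c ^ n / (n.factorial : ℂ)) * ((x : ℂ) ^ n * F x) := fun x => by
        rw [mul_pow]; ring
      simp only [this]
      rw [integral_const_mul, hm, mul_zero]
    simp only [hz] at hsum
    have h0 := hsum.unique hasSum_zero
    rw [← h0]
    refine integral_congr_ae (Filter.Eventually.of_forall fun x => ?_)
    simp only [smul_eq_mul, hc]
    congr 2
    push_cast
    ring
  refine ae_eq_zero_of_integral_contDiff_smul_eq_zero hF0.locallyIntegrable ?_
  intro φ h1 h2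
  have hc : HasCompactSupport fun x : ℝ => (φ x : ℂ) :=
    h2.comp_left (g := fun r : ℝ => (r : ℂ)) Complex.ofReal_zero
  have hs : ContDiff ℝ ∞ fun x : ℝ => (φ x : ℂ) := Complex.ofRealCLM.contDiff.comp h1
  let φs : SchwartzMap ℝ ℂ := hc.toSchwartzMap hs
  let ψ : SchwartzMap ℝ ℂ := FourierTransformInv.fourierInv φs
  have hψ : FourierTransform.fourier (ψ : ℝ → ℂ) = fun x : ℝ => (φ x : ℂ) := by
    rw [← SchwartzMap.fourier_coe, FourierTransform.fourier_fourierInv_eq]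
    rfl
  have h3 := VectorFourier.integral_fourierIntegral_smul_eq_flip (L := innerₗ ℝ)
    (μ := (volume : Measure ℝ)) (ν := (volume : Measure ℝ))
    Real.continuous_fourierChar continuous_inner (ψ.integrable (μ := volume)) hF0
  have h4 : ∀ ξ, VectorFourier.fourierIntegral Real.fourierChar volume (innerₗ ℝ) (ψ : ℝ → ℂ) ξ =
      (φ ξ : ℂ) := fun ξ => congrFun hψ ξ
  have h5 : ∀ ξ, VectorFourier.fourierIntegral Real.fourierChar volume (innerₗ ℝ).flip F ξ = 0 := by
    intro ξ
    rw [flip_innerₗ]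
    exact hfour ξ
  simp only [h4, h5, smul_zero, integral_zero] at h3
  rw [← h3]
  refine integral_congr_ae (Filter.Eventually.of_forall fun x => ?_)
  simp

theorem integrable_exp_mul_gauss (τ : ℝ) (f : L2) :
    Integrable fun x : ℝ => ((Real.exp (τ * |x|) * Real.exp (-(x ^ 2 / 2)) : ℝ) : ℂ) * f x := by
  have hc : Continuous fun x : ℝ => ((Real.exp (τ * |x|) * Real.exp (-(x ^ 2 / 2)) : ℝ) : ℂ) := by
    fun_prop
  have h1 : MemLp (fun x : ℝ => ((Real.exp (τ * |x|) * Real.exp (-(x ^ 2 / 2)) : ℝ) : ℂ)) 2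
      (volume : Measure ℝ) := by
    refine (((memLp_gaussFun (w := ((1 / 2 : ℝ) : ℂ)) (by norm_num) 1).const_mul
      ((Real.exp (τ ^ 2) : ℝ) : ℂ)).of_le hc.aestronglyMeasurable
      (Filter.Eventually.of_forall fun x => ?_))
    simp only [gaussFun, norm_mul, norm_exp_gauss, Polynomial.eval_one, one_mul,
      Complex.norm_real, Complex.ofReal_re, Real.norm_of_nonneg (Real.exp_nonneg _)]
    rw [← Real.exp_add, ← Real.exp_add, Real.exp_le_exp]
    nlinarith [sq_nonneg (|x| / 2 - τ), sq_abs x]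
  exact h1.integrable_mul (Lp.memLp f)

theorem inner_J_one (n : ℕ) (f : L2) :
    ⟪J 1 (Polynomial.X ^ n), f⟫_ℂ =
      ∫ x : ℝ, (x : ℂ) ^ n * ((Real.exp (-(x ^ 2 / 2)) : ℝ) * f x) := by
  rw [L2.inner_def]
  refine integral_congr_ae ?_
  filter_upwards [coeFn_J (w := 1) (by simp) (Polynomial.X ^ n)] with x h
  rw [h, RCLike.inner_apply, gaussFun]
  have : Complex.exp (-(1 * (x : ℂ) ^ 2 / 2)) = ((Real.exp (-(x ^ 2 / 2)) : ℝ) : ℂ) := by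
    rw [one_mul]
    push_cast
    rfl
  rw [this]
  simp only [Polynomial.eval_pow, Polynomial.eval_X, map_mul, map_pow, Complex.conj_ofReal]
  ring

/-- The polynomials times the standard Gaussian determine the graph of `Q`. -/
theorem mem_graph_Q_of_inner_J {h k : L2}
    (hhk : ∀ p, ⟪J 1 (Polynomial.X * p), h⟫_ℂ = ⟪J 1 p, k⟫_ℂ) : (h, k) ∈ Q.graph := by
  rw [mem_graph_Q]
  set F : ℝ → ℂ := fun x => (Real.exp (-(x ^ 2 / 2)) : ℝ) * ((x : ℂ) * h x - k x) with hFdef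
  have hint : ∀ τ : ℝ, Integrable fun x : ℝ =>
      (Real.exp (τ * |x|) : ℂ) * ((x : ℂ) * ((Real.exp (-(x ^ 2 / 2)) : ℝ) * h x)) := by
    intro τ
    refine (integrable_exp_mul_gauss (τ + 1) h).mono ?_ (Filter.Eventually.of_forall fun x => ?_)
    · refine (Continuous.aestronglyMeasurable (by fun_prop)).mul
        ((Continuous.aestronglyMeasurable (by fun_prop)).mul
        ((Continuous.aestronglyMeasurable (by fun_prop)).mul (Lp.aestronglyMeasurable h)))
    · simp only [norm_mul, Complex.norm_real, Real.norm_eq_abs, Real.abs_exp]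
      have h1 : |x| ≤ Real.exp |x| := by linarith [Real.add_one_le_exp |x|]
      calc Real.exp (τ * |x|) * (|x| * (Real.exp (-(x ^ 2 / 2)) * ‖h x‖))
          ≤ Real.exp (τ * |x|) * (Real.exp |x| * (Real.exp (-(x ^ 2 / 2)) * ‖h x‖)) := by gcongr
        _ = _ := by
          rw [add_mul, one_mul, Real.exp_add]
          ring
  have hint' : ∀ τ : ℝ, Integrable fun x : ℝ =>
      (Real.exp (τ * |x|) : ℂ) * ((Real.exp (-(x ^ 2 / 2)) : ℝ) * k x) := by
    intro τ
    refine (integrable_exp_mul_gauss τ k).congr (Filter.Eventually.of_forall fun x => ?_)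
    simp only [Complex.ofReal_mul]
    ring
  have key : ∀ᵐ x : ℝ, F x = 0 := by
    refine ae_eq_zero_of_moments (fun τ => ?_) fun n => ?_
    · refine ((hint τ).sub (hint' τ)).congr (Filter.Eventually.of_forall fun x => ?_)
      simp only [hFdef, Pi.sub_apply]
      ring
    · have hpow : ∀ G : ℝ → ℂ, AEStronglyMeasurable G (volume : Measure ℝ) →
          (∀ τ : ℝ, Integrable fun x : ℝ => (Real.exp (τ * |x|) : ℂ) * G x) →
          Integrable fun x : ℝ => (x : ℂ) ^ n * G x := by
        intro G hGm hG
        refine (hG n).mono ((Continuous.aestronglyMeasurable (by fun_prop)).mul hGm)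
          (Filter.Eventually.of_forall fun x => ?_)
        simp only [norm_mul, norm_pow, Complex.norm_real, Real.norm_eq_abs, Real.abs_exp]
        gcongr
        rw [Real.exp_nat_mul]
        gcongr
        linarith [Real.add_one_le_exp |x|]
      have h1 := hhk (Polynomial.X ^ n)
      rw [← pow_succ', inner_J_one, inner_J_one] at h1
      have h2 := integral_sub (hpow _ (by simpa using (hint 0).aestronglyMeasurable) hint)
        (hpow _ (by simpa using (hint' 0).aestronglyMeasurable) hint')
      rw [← h1, sub_eq_zero.2] at h2
      · rw [← h2]
        refine integral_congr_ae (Filter.Eventually.of_forall fun x => ?_)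
        simp only [hFdef]
        ring
      · refine integral_congr_ae (Filter.Eventually.of_forall fun x => ?_)
        simp only []
        ring
  filter_upwards [key] with x hx
  rw [hFdef] at hx
  rcases mul_eq_zero.1 hx with h1 | h1
  · exact absurd (Complex.ofReal_eq_zero.1 h1) (Real.exp_ne_zero _)
  · exact (sub_eq_zero.1 h1).symm

theorem eq_zero_of_inner_J {f : L2} (hf : ∀ p, ⟪J 1 p, f⟫_ℂ = 0) : f = 0 := by
  have h1 : ((0 : L2), f) ∈ Q.graph := mem_graph_Q_of_inner_J fun p => by rw [hf, inner_zero_right]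
  exact Q.graph_fst_eq_zero_snd h1 rfl

theorem Q_injective (f : L2) (hf : (f, (0 : L2)) ∈ Q.graph) : f = 0 := by
  refine Lp.ext ?_
  have hne : ∀ᵐ x : ℝ, x ≠ 0 := by
    simp [ae_iff]
  filter_upwards [mem_graph_Q.1 hf, Lp.coeFn_zero ℂ 2 (volume : Measure ℝ), hne] with x h1 h2 h3
  rw [h2, Pi.zero_apply, zero_eq_mul] at h1
  rw [h2, Pi.zero_apply]
  exact h1.resolve_left (by exact_mod_cast h3)

open Polynomial in
/-- The polynomials with `p(-x) = p(x)`. -/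
def IsEvenPoly (p : ℂ[X]) : Prop := p.comp (-X) = p

section EvenPolynomials

open Polynomial

theorem gaussD_comp_neg (w : ℂ) (p : ℂ[X]) :
    (gaussD w p).comp (-X) = -gaussD w (p.comp (-X)) := by
  simp only [gaussD, derivative_comp, sub_comp, mul_comp, C_comp, X_comp, derivative_neg,
    derivative_X]
  ring

theorem gaussD_neg (w : ℂ) (p : ℂ[X]) : gaussD w (-p) = -gaussD w p := by
  simp only [gaussD, derivative_neg]
  ring

theorem isEvenPoly_one : IsEvenPoly 1 := by simp [IsEvenPoly]

theorem IsEvenPoly.add {p q : ℂ[X]} (hp : IsEvenPoly p) (hq : IsEvenPoly q) :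
    IsEvenPoly (p + q) := by
  rw [IsEvenPoly] at *
  rw [add_comp, hp, hq]

theorem IsEvenPoly.smul {p : ℂ[X]} (hp : IsEvenPoly p) (c : ℂ) : IsEvenPoly (c • p) := by
  rw [IsEvenPoly] at *
  rw [smul_comp, hp]

theorem IsEvenPoly.X_mul_X_mul {p : ℂ[X]} (hp : IsEvenPoly p) : IsEvenPoly (X * (X * p)) := by
  rw [IsEvenPoly] at *
  rw [mul_comp, mul_comp, hp, X_comp]
  ring

theorem IsEvenPoly.gaussD_gaussD {p : ℂ[X]} (hp : IsEvenPoly p) (w : ℂ) :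
    IsEvenPoly (gaussD w (gaussD w p)) := by
  rw [IsEvenPoly] at *
  rw [gaussD_comp_neg, gaussD_comp_neg, hp, gaussD_neg, neg_neg]

theorem IsEvenPoly.gaussD_X_mul {p : ℂ[X]} (hp : IsEvenPoly p) (w : ℂ) :
    IsEvenPoly (gaussD w (X * p)) := by
  rw [IsEvenPoly] at *
  rw [gaussD_comp_neg, mul_comp, hp, X_comp, neg_mul, gaussD_neg, neg_neg]

theorem IsEvenPoly.X_mul_gaussD {p : ℂ[X]} (hp : IsEvenPoly p) (w : ℂ) :
    IsEvenPoly (X * gaussD w p) := by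
  rw [IsEvenPoly] at *
  rw [mul_comp, gaussD_comp_neg, hp, X_comp, neg_mul_neg]

end EvenPolynomials

/-! ### The boson operators and `su(1,1)` on Gaussians -/

theorem mem_evenL2 {f : L2} : f ∈ evenL2 ↔ reflection f = f := Iff.rfl

theorem coeFn_reflection (f : L2) : reflection f =ᵐ[volume] fun x => f (-x) :=
  Lp.coeFn_compMeasurePreserving f (Measure.measurePreserving_neg volume)

theorem reflection_J {w : ℂ} (hw : 0 < w.re) (p : Polynomial ℂ) :
    reflection (J w p) = J w (p.comp (-Polynomial.X)) := by
  refine Lp.ext ?_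
  filter_upwards [coeFn_reflection (J w p), coeFn_J hw (p.comp (-Polynomial.X)),
    (Measure.measurePreserving_neg (volume : Measure ℝ)).quasiMeasurePreserving.ae_eq_comp
      (coeFn_J hw p)] with x h1 h2 h3
  rw [h1, h2]
  have h4 : J w p (-x) = gaussFun w p (-x) := h3
  rw [h4]
  simp [gaussFun]

/-- Odd polynomials times a Gaussian are orthogonal to the even functions. -/
theorem inner_J_of_odd {w : ℂ} (hw : 0 < w.re) {p : Polynomial ℂ}
    (hp : p.comp (-Polynomial.X) = -p) {f : L2} (hf : f ∈ evenL2) : ⟪J w p, f⟫_ℂ = 0 := by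
  have h1 := reflection.inner_map_map (J w p) f
  rw [reflection_J hw, hp, mem_evenL2.1 hf, map_neg, inner_neg_left] at h1
  exact self_eq_neg.1 h1.symm

open scoped Classical in
/-- The vector `p(x) e^{-w x²/2}` of `L²_even(ℝ)`, for `w` in the right half-plane and an even
polynomial `p`. -/
def JE (w : ℂ) (p : Polynomial ℂ) : EvenL2 :=
  if h : J w p ∈ evenL2 then ⟨J w p, h⟩ else 0

theorem coe_JE {w : ℂ} (hw : 0 < w.re) {p : Polynomial ℂ} (hp : IsEvenPoly p) :
    (JE w p : L2) = J w p := by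
  have h : J w p ∈ evenL2 := by
    rw [mem_evenL2, reflection_J hw, hp]
  rw [JE, dif_pos h]

theorem JE_add {w : ℂ} (hw : 0 < w.re) {p q : Polynomial ℂ} (hp : IsEvenPoly p)
    (hq : IsEvenPoly q) : JE w (p + q) = JE w p + JE w q := by
  refine Subtype.ext ?_
  rw [Submodule.coe_add, coe_JE hw hp, coe_JE hw hq, coe_JE hw (hp.add hq), map_add]

theorem JE_smul {w : ℂ} (hw : 0 < w.re) {p : Polynomial ℂ} (hp : IsEvenPoly p) (c : ℂ) :
    JE w (c • p) = c • JE w p := by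
  refine Subtype.ext ?_
  rw [Submodule.coe_smul, coe_JE hw hp, coe_JE hw (hp.smul c), map_smul]

/-- The symmetric product `(i/2)(PQ + QP)` as a closed operator on `L²(ℝ)`. -/
def dilationOp : L2 →ₗ.[ℂ] L2 := ((I / 2) • (opMul P Q + opMul Q P)).closure

/-- `(i/2) Q²` on `L²(ℝ)`. -/
def positionSqOp : L2 →ₗ.[ℂ] L2 := (I / 2) • opMul Q Q

/-- `-(i/2) P²` on `L²(ℝ)`. -/
def momentumSqOp : L2 →ₗ.[ℂ] L2 := (-(I / 2)) • opMul P P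

section OnGaussians

open Polynomial

variable {w : ℂ}

theorem J_mem_graph_dilationOp (hw : 0 < w.re) (p : ℂ[X]) :
    (J w p, J w ((1 / 2 : ℂ) • (gaussD w (X * p) + X * gaussD w p))) ∈ dilationOp.graph := by
  refine mem_graph_closure_of_mem ?_
  refine mem_graph_smul.2 ⟨_, mem_graph_add.2 ⟨_, _,
    mem_graph_opMul.2 ⟨_, J_mem_graph_Q hw p, J_mem_graph_P hw _⟩,
    mem_graph_opMul.2 ⟨_, J_mem_graph_P hw p, J_mem_graph_Q hw _⟩, rfl⟩, ?_⟩
  rw [mul_smul_comm, ← map_add, ← map_smul, ← smul_add, smul_smul]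
  congr 2
  linear_combination (1 / 2 : ℂ) * I_mul_I

theorem J_mem_graph_positionSqOp (hw : 0 < w.re) (p : ℂ[X]) :
    (J w p, J w ((I / 2) • (X * (X * p)))) ∈ positionSqOp.graph :=
  mem_graph_smul.2 ⟨_, mem_graph_opMul.2 ⟨_, J_mem_graph_Q hw p, J_mem_graph_Q hw _⟩,
    map_smul _ _ _⟩

theorem gaussD_smul (c : ℂ) (p : ℂ[X]) : gaussD w (c • p) = c • gaussD w p := by
  simp only [gaussD, derivative_smul, mul_smul_comm, smul_sub]

theorem J_mem_graph_momentumSqOp (hw : 0 < w.re) (p : ℂ[X]) :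
    (J w p, J w ((I / 2) • gaussD w (gaussD w p))) ∈ momentumSqOp.graph := by
  refine mem_graph_smul.2 ⟨_, mem_graph_opMul.2 ⟨_, J_mem_graph_P hw p, J_mem_graph_P hw _⟩, ?_⟩
  rw [gaussD_smul, smul_smul, ← map_smul, smul_smul]
  congr 2
  linear_combination (1 / 2 : ℂ) * I * I_mul_I

theorem JE_mem_graph_E0 (hw : 0 < w.re) {p : ℂ[X]} (hp : IsEvenPoly p) :
    (JE w p, JE w ((1 / 2 : ℂ) • (gaussD w (X * p) + X * gaussD w p))) ∈ E0.graph := by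
  refine mem_graph_part.2 ?_
  rw [coe_JE hw hp, coe_JE hw (((hp.gaussD_X_mul w).add (hp.X_mul_gaussD w)).smul _)]
  exact J_mem_graph_dilationOp hw p

theorem JE_mem_graph_Eplus (hw : 0 < w.re) {p : ℂ[X]} (hp : IsEvenPoly p) :
    (JE w p, JE w ((I / 2) • (X * (X * p)))) ∈ Eplus.graph := by
  refine mem_graph_part.2 ?_
  rw [coe_JE hw hp, coe_JE hw (hp.X_mul_X_mul.smul _)]
  exact J_mem_graph_positionSqOp hw p

theorem JE_mem_graph_Eminus (hw : 0 < w.re) {p : ℂ[X]} (hp : IsEvenPoly p) :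
    (JE w p, JE w ((I / 2) • gaussD w (gaussD w p))) ∈ Eminus.graph := by
  refine mem_graph_part.2 ?_
  rw [coe_JE hw hp, coe_JE hw ((hp.gaussD_gaussD w).smul _)]
  exact J_mem_graph_momentumSqOp hw p

/-- The action of `L_+` on the multiples of `e^{-w x²/2}`. -/
def raisePoly (w : ℂ) (p : ℂ[X]) : ℂ[X] :=
  (1 / 2 : ℂ) • ((1 / 2 : ℂ) • (gaussD w (X * p) + X * gaussD w p)
    + (-1 / 2 : ℂ) • (X * (X * p) + gaussD w (gaussD w p)))

/-- The action of `L_-` on the multiples of `e^{-w x²/2}`. -/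
def lowerPoly (w : ℂ) (p : ℂ[X]) : ℂ[X] :=
  (1 / 2 : ℂ) • ((1 / 2 : ℂ) • (gaussD w (X * p) + X * gaussD w p)
    + (1 / 2 : ℂ) • (X * (X * p) + gaussD w (gaussD w p)))

/-- The action of `N` on the multiples of `e^{-w x²/2}`. -/
def numberPoly (w : ℂ) (p : ℂ[X]) : ℂ[X] :=
  (1 / 4 : ℂ) • (X * (X * p) + (-1 : ℂ) • gaussD w (gaussD w p) + (-1 : ℂ) • p)

theorem IsEvenPoly.raisePoly {p : ℂ[X]} (hp : IsEvenPoly p) : IsEvenPoly (raisePoly w p) :=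
  ((((hp.gaussD_X_mul w).add (hp.X_mul_gaussD w)).smul _).add
    ((hp.X_mul_X_mul.add (hp.gaussD_gaussD w)).smul _)).smul _

theorem JE_mem_graph_Lplus (hw : 0 < w.re) {p : ℂ[X]} (hp : IsEvenPoly p) :
    (JE w p, JE w (raisePoly w p)) ∈ Lplus.graph := by
  refine mem_graph_smul.2 ⟨_, mem_graph_add.2 ⟨_, _, JE_mem_graph_E0 hw hp, mem_graph_smul.2
    ⟨_, mem_graph_add.2 ⟨_, _, JE_mem_graph_Eplus hw hp, JE_mem_graph_Eminus hw hp, rfl⟩, rfl⟩,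
    rfl⟩, ?_⟩
  have h1 := ((hp.gaussD_X_mul w).add (hp.X_mul_gaussD w)).smul (1 / 2)
  have h2 := hp.X_mul_X_mul
  have h3 := hp.gaussD_gaussD w
  rw [raisePoly, JE_smul hw (h1.add ((h2.add h3).smul _)), JE_add hw h1 ((h2.add h3).smul _),
    JE_smul hw h2, JE_smul hw h3, JE_smul hw (h2.add h3), JE_add hw h2 h3, ← smul_add, smul_smul]
  congr 3
  linear_combination (-1 / 2 : ℂ) * I_mul_I

theorem JE_mem_graph_Lminus (hw : 0 < w.re) {p : ℂ[X]} (hp : IsEvenPoly p) :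
    (JE w p, JE w (lowerPoly w p)) ∈ Lminus.graph := by
  refine mem_graph_smul.2 ⟨_, mem_graph_sub.2 ⟨_, _, JE_mem_graph_E0 hw hp, mem_graph_smul.2
    ⟨_, mem_graph_add.2 ⟨_, _, JE_mem_graph_Eplus hw hp, JE_mem_graph_Eminus hw hp, rfl⟩, rfl⟩,
    rfl⟩, ?_⟩
  have h1 := ((hp.gaussD_X_mul w).add (hp.X_mul_gaussD w)).smul (1 / 2)
  have h2 := hp.X_mul_X_mul
  have h3 := hp.gaussD_gaussD w
  rw [lowerPoly, JE_smul hw (h1.add ((h2.add h3).smul _)), JE_add hw h1 ((h2.add h3).smul _),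
    JE_smul hw h2, JE_smul hw h3, JE_smul hw (h2.add h3), JE_add hw h2 h3, ← smul_add, smul_smul,
    sub_eq_add_neg, ← neg_smul]
  congr 3
  linear_combination (1 / 2 : ℂ) * I_mul_I

theorem JE_mem_graph_numberOp (hw : 0 < w.re) {p : ℂ[X]} (hp : IsEvenPoly p) :
    (JE w p, JE w (numberPoly w p)) ∈ numberOp.graph := by
  refine mem_graph_smul.2 ⟨_, mem_graph_sub.2 ⟨_, _, mem_graph_smul.2 ⟨_, mem_graph_sub.2
    ⟨_, _, JE_mem_graph_Eminus hw hp, JE_mem_graph_Eplus hw hp, rfl⟩, rfl⟩,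
    mem_graph_smul.2 ⟨_, mem_graph_idOp.2 rfl, rfl⟩, rfl⟩, ?_⟩
  have h2 := hp.X_mul_X_mul
  have h3 := hp.gaussD_gaussD w
  rw [numberPoly, JE_smul hw ((h2.add (h3.smul _)).add (hp.smul _)),
    JE_add hw (h2.add (h3.smul _)) (hp.smul _), JE_add hw h2 (h3.smul _), JE_smul hw h3,
    JE_smul hw hp, JE_smul hw h2, JE_smul hw h3]
  match_scalars
  · linear_combination (1 / 4 : ℂ) * I_mul_I
  · linear_combination (-1 / 4 : ℂ) * I_mul_I
  · norm_num

theorem lowerPoly_one_eq (p : ℂ[X]) : lowerPoly 1 p = (1 / 4 : ℂ) • derivative (derivative p) := by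
  refine Polynomial.funext fun z => ?_
  simp [lowerPoly, gaussD, derivative_mul]
  ring

theorem raisePoly_one_eq (p : ℂ[X]) : raisePoly 1 p = (-1 / 4 : ℂ) •
    (2 * X * (2 * X * p - derivative p) - derivative (2 * X * p - derivative p)) := by
  refine Polynomial.funext fun z => ?_
  simp [raisePoly, gaussD, derivative_mul]
  ring

theorem numberPoly_one_eq (p : ℂ[X]) : numberPoly 1 p = (1 / 4 : ℂ) •
    (2 * X * derivative p - derivative (derivative p)) := by
  refine Polynomial.funext fun z => ?_
  simp [numberPoly, gaussD, derivative_mul]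
  ring

end OnGaussians

/-! ### Formal adjoints -/

section FormalAdjoints

theorem AdjPair.closure_neg {E : Type*} [NormedAddCommGroup E] [InnerProductSpace ℂ E]
    {A : E →ₗ.[ℂ] E} (hA : AdjPair A (-A)) : AdjPair A.closure (-A.closure) := by
  intro f f' g g' hf hg
  have h1 := hA.closure
  have hS : IsClosed {p : E × E | ⟪f', p.1⟫_ℂ = -⟪f, p.2⟫_ℂ} :=
    isClosed_eq (by fun_prop) (by fun_prop)
  have h2 := closure_graph_subset hS (fun p hp => by
    have := h1 f f' p.1 (-p.2) hf (mem_graph_neg.2 (by rwa [neg_neg]))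
    rwa [inner_neg_right] at this) (graph_closure_le A (mem_graph_neg.1 hg))
  have h3 : ⟪f', g⟫_ℂ = -⟪f, -g'⟫_ℂ := h2
  rwa [inner_neg_right, neg_neg] at h3

theorem adjPair_neg_of_smul {E : Type*} [NormedAddCommGroup E] [InnerProductSpace ℂ E]
    {A : E →ₗ.[ℂ] E} (hA : AdjPair A A) {c : ℂ} (hc : conj c = -c) :
    AdjPair (c • A) (-(c • A)) := by
  intro f f' g g' hf hg
  refine hA.smul hc f f' g g' hf ?_
  obtain ⟨h, hh, he⟩ := mem_graph_smul.1 (mem_graph_neg.1 hg)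
  exact mem_graph_smul.2 ⟨h, hh, by rw [neg_smul, ← he, neg_neg]⟩

theorem conj_I_div_two : conj (I / 2) = -(I / 2) := by
  rw [map_div₀, conj_I, map_ofNat, neg_div]

theorem adjPair_dilationOp : AdjPair dilationOp (-dilationOp) := by
  refine AdjPair.closure_neg (adjPair_neg_of_smul ?_ conj_I_div_two)
  have := (adjPair_P.opMul adjPair_Q).add (adjPair_Q.opMul adjPair_P)
  rwa [add_comm (opMul Q P)] at this

theorem adjPair_positionSqOp : AdjPair positionSqOp (-positionSqOp) :=
  adjPair_neg_of_smul (adjPair_Q.opMul adjPair_Q) conj_I_div_two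

theorem adjPair_momentumSqOp : AdjPair momentumSqOp (-momentumSqOp) :=
  adjPair_neg_of_smul (adjPair_P.opMul adjPair_P) (by rw [map_neg, conj_I_div_two])

theorem AdjPair.inner_eq_neg {E : Type*} [NormedAddCommGroup E] [InnerProductSpace ℂ E]
    {A : E →ₗ.[ℂ] E} (hA : AdjPair A (-A)) {f f' g g' : E} (hf : (f, f') ∈ A.graph)
    (hg : (g, g') ∈ A.graph) : ⟪f', g⟫_ℂ = -⟪f, g'⟫_ℂ := by
  have := hA f f' g (-g') hf (mem_graph_neg.2 (by rwa [neg_neg]))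
  rwa [inner_neg_right] at this

theorem AdjPair.part_neg {E : Type*} [NormedAddCommGroup E] [InnerProductSpace ℂ E]
    {A : E →ₗ.[ℂ] E} (hA : AdjPair A (-A)) (K : Submodule ℂ E) :
    AdjPair (SqueezedSU11.part K A) (-SqueezedSU11.part K A) := by
  intro f f' g g' hf hg
  have h1 := hA.inner_eq_neg (mem_graph_part.1 hf) (mem_graph_part.1 (mem_graph_neg.1 hg))
  rw [Submodule.coe_neg, inner_neg_right, neg_neg] at h1
  exact h1

theorem adjPair_E0 : AdjPair E0 (-E0) := adjPair_dilationOp.part_neg evenL2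

theorem adjPair_Eplus : AdjPair Eplus (-Eplus) := adjPair_positionSqOp.part_neg evenL2

theorem adjPair_Eminus : AdjPair Eminus (-Eminus) := adjPair_momentumSqOp.part_neg evenL2

theorem adjPair_Lplus : AdjPair Lplus (-Lminus) := by
  intro f f' g g' hf hg
  obtain ⟨f1, hf1, rfl⟩ := mem_graph_smul.1 hf
  obtain ⟨a0, f2, ha0, hf2, rfl⟩ := mem_graph_add.1 hf1
  obtain ⟨f3, hf3, rfl⟩ := mem_graph_smul.1 hf2
  obtain ⟨a1, a2, ha1, ha2, rfl⟩ := mem_graph_add.1 hf3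
  obtain ⟨g1, hg1, hg'⟩ := mem_graph_smul.1 (mem_graph_neg.1 hg)
  obtain ⟨b0, g2, hb0, hg2, rfl⟩ := mem_graph_sub.1 hg1
  obtain ⟨g3, hg3, rfl⟩ := mem_graph_smul.1 hg2
  obtain ⟨b1, b2, hb1, hb2, rfl⟩ := mem_graph_add.1 hg3
  obtain rfl := neg_eq_iff_eq_neg.1 hg'
  simp only [inner_smul_left, inner_add_left, inner_neg_right, inner_smul_right, inner_sub_right,
    inner_add_right, adjPair_E0.inner_eq_neg ha0 hb0, adjPair_Eplus.inner_eq_neg ha1 hb1,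
    adjPair_Eminus.inner_eq_neg ha2 hb2, conj_I, map_div₀, map_one, map_ofNat]
  ring

/-- The adjoint relation for `L_+`, tested on all polynomials times the standard Gaussian. These
include odd functions, outside of `L²_even(ℝ)`, so that the symmetry of the operators on `L²(ℝ)`
is needed; `inner_J_of_mem_graph_Lminus` and `inner_J_of_mem_graph_numberOp` are alike. -/
theorem inner_J_of_mem_graph_Lplus {f f' : EvenL2} (h : (f, f') ∈ Lplus.graph)
    (p : Polynomial ℂ) : ⟪J 1 (lowerPoly 1 p), (f : L2)⟫_ℂ = -⟪J 1 p, (f' : L2)⟫_ℂ := by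
  have h1 : (0 : ℝ) < (1 : ℂ).re := by simp
  obtain ⟨f1, hf1, rfl⟩ := mem_graph_smul.1 h
  obtain ⟨a0, f2, ha0, hf2, rfl⟩ := mem_graph_add.1 hf1
  obtain ⟨f3, hf3, rfl⟩ := mem_graph_smul.1 hf2
  obtain ⟨a1, a2, ha1, ha2, rfl⟩ := mem_graph_add.1 hf3
  have e0 := adjPair_dilationOp.inner_eq_neg (J_mem_graph_dilationOp h1 p) (mem_graph_part.1 ha0)
  have e1 := adjPair_positionSqOp.inner_eq_neg (J_mem_graph_positionSqOp h1 p)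
    (mem_graph_part.1 ha1)
  have e2 := adjPair_momentumSqOp.inner_eq_neg (J_mem_graph_momentumSqOp h1 p)
    (mem_graph_part.1 ha2)
  simp only [lowerPoly, map_smul, map_add, inner_smul_left, inner_add_left, Submodule.coe_smul,
    Submodule.coe_add, inner_smul_right, inner_add_right, conj_I, map_div₀, map_one,
    map_ofNat] at e0 e1 e2 ⊢
  linear_combination (1 / 2 : ℂ) * e0 + (1 / 2 : ℂ) * I * (e1 + e2) + (1 / 4 : ℂ) *
    (⟪J 1 (Polynomial.X * (Polynomial.X * p)), (f : L2)⟫_ℂ +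
      ⟪J 1 (gaussD 1 (gaussD 1 p)), (f : L2)⟫_ℂ) * I_mul_I

theorem inner_J_of_mem_graph_Lminus {f f' : EvenL2} (h : (f, f') ∈ Lminus.graph)
    (p : Polynomial ℂ) : ⟪J 1 (raisePoly 1 p), (f : L2)⟫_ℂ = -⟪J 1 p, (f' : L2)⟫_ℂ := by
  have h1 : (0 : ℝ) < (1 : ℂ).re := by simp
  obtain ⟨f1, hf1, rfl⟩ := mem_graph_smul.1 h
  obtain ⟨a0, f2, ha0, hf2, rfl⟩ := mem_graph_sub.1 hf1
  obtain ⟨f3, hf3, rfl⟩ := mem_graph_smul.1 hf2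
  obtain ⟨a1, a2, ha1, ha2, rfl⟩ := mem_graph_add.1 hf3
  have e0 := adjPair_dilationOp.inner_eq_neg (J_mem_graph_dilationOp h1 p) (mem_graph_part.1 ha0)
  have e1 := adjPair_positionSqOp.inner_eq_neg (J_mem_graph_positionSqOp h1 p)
    (mem_graph_part.1 ha1)
  have e2 := adjPair_momentumSqOp.inner_eq_neg (J_mem_graph_momentumSqOp h1 p)
    (mem_graph_part.1 ha2)
  simp only [raisePoly, map_smul, map_add, inner_smul_left, inner_add_left, Submodule.coe_smul,
    Submodule.coe_add, Submodule.coe_sub, inner_smul_right, inner_add_right, inner_sub_right,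
    conj_I, map_div₀, map_one, map_neg, map_ofNat] at e0 e1 e2 ⊢
  linear_combination (1 / 2 : ℂ) * e0 - (1 / 2 : ℂ) * I * (e1 + e2) - (1 / 4 : ℂ) *
    (⟪J 1 (Polynomial.X * (Polynomial.X * p)), (f : L2)⟫_ℂ +
      ⟪J 1 (gaussD 1 (gaussD 1 p)), (f : L2)⟫_ℂ) * I_mul_I

theorem inner_J_of_mem_graph_numberOp {f f' : EvenL2} (h : (f, f') ∈ numberOp.graph)
    (p : Polynomial ℂ) : ⟪J 1 (numberPoly 1 p), (f : L2)⟫_ℂ = ⟪J 1 p, (f' : L2)⟫_ℂ := by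
  have h1 : (0 : ℝ) < (1 : ℂ).re := by simp
  obtain ⟨f1, hf1, rfl⟩ := mem_graph_smul.1 h
  obtain ⟨a0, f2, ha0, hf2, rfl⟩ := mem_graph_sub.1 hf1
  obtain ⟨f3, hf3, rfl⟩ := mem_graph_smul.1 ha0
  obtain ⟨a2, a1, ha2, ha1, rfl⟩ := mem_graph_sub.1 hf3
  obtain ⟨f4, hf4, rfl⟩ := mem_graph_smul.1 hf2
  obtain rfl := mem_graph_idOp.1 hf4
  have e1 := adjPair_positionSqOp.inner_eq_neg (J_mem_graph_positionSqOp h1 p)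
    (mem_graph_part.1 ha1)
  have e2 := adjPair_momentumSqOp.inner_eq_neg (J_mem_graph_momentumSqOp h1 p)
    (mem_graph_part.1 ha2)
  simp only [numberPoly, map_smul, map_add, inner_smul_left, inner_add_left, Submodule.coe_smul,
    Submodule.coe_sub, inner_smul_right, inner_sub_right, conj_I, map_div₀, map_one,
    map_neg, map_ofNat] at e1 e2 ⊢
  linear_combination (1 / 2 : ℂ) * I * (e1 - e2) + (1 / 4 : ℂ) *
    (⟪J 1 (Polynomial.X * (Polynomial.X * p)), (f4 : L2)⟫_ℂ -
      ⟪J 1 (gaussD 1 (gaussD 1 p)), (f4 : L2)⟫_ℂ) * I_mul_I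

end FormalAdjoints

/-! ### The annihilation operator and its Cayley transform -/

theorem one_re_pos : (0 : ℝ) < (1 : ℂ).re := by simp

theorem exists_derivative_eq (p : Polynomial ℂ) : ∃ q, Polynomial.derivative q = p := by
  induction p using Polynomial.induction_on' with
  | add p q hp hq =>
    obtain ⟨a, ha⟩ := hp
    obtain ⟨b, hb⟩ := hq
    exact ⟨a + b, by rw [Polynomial.derivative_add, ha, hb]⟩
  | monomial n c =>
    refine ⟨Polynomial.monomial (n + 1) (c / (n + 1)), ?_⟩
    rw [Polynomial.derivative_monomial]
    have : (n : ℂ) + 1 ≠ 0 := Nat.cast_add_one_ne_zero n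
    congr 1
    push_cast
    field_simp

theorem Lplus_injective (f : EvenL2) (hf : (f, (0 : EvenL2)) ∈ Lplus.graph) : f = 0 := by
  refine Subtype.ext (eq_zero_of_inner_J fun p => ?_)
  obtain ⟨q, hq⟩ := exists_derivative_eq p
  obtain ⟨r, hr⟩ := exists_derivative_eq q
  have h1 := inner_J_of_mem_graph_Lplus hf r
  rw [lowerPoly_one_eq, hr, hq, map_smul, inner_smul_left, Submodule.coe_zero, inner_zero_right,
    neg_zero] at h1
  exact (mul_eq_zero.1 h1).resolve_left (by simp)

theorem mem_graph_annihilationCore {f h : EvenL2} :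
    (f, h) ∈ annihilationCore.graph ↔
      ∃ k, (f, k) ∈ numberOp.graph ∧ (h, k) ∈ Lplus.graph := by
  rw [annihilationCore, mem_graph_opMul]
  simp only [mem_graph_inverse Lplus_injective]

/-- The weak form of the relation `a_b^* G = -a_b g`, tested against the polynomials times the
standard Gaussian. -/
def WeakRel (g G : L2) : Prop :=
  ∀ q : Polynomial ℂ, ⟪J 1 (2 * Polynomial.X * q - Polynomial.derivative q), g⟫_ℂ =
    -⟪J 1 (Polynomial.derivative q), G⟫_ℂ

theorem isClosed_weakRel : IsClosed {p : EvenL2 × EvenL2 | WeakRel p.1 p.2} := by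
  have : {p : EvenL2 × EvenL2 | WeakRel p.1 p.2} = ⋂ q : Polynomial ℂ, {p : EvenL2 × EvenL2 |
      ⟪J 1 (2 * Polynomial.X * q - Polynomial.derivative q), (p.1 : L2)⟫_ℂ =
        -⟪J 1 (Polynomial.derivative q), (p.2 : L2)⟫_ℂ} := by
    ext p
    simp [WeakRel]
  rw [this]
  exact isClosed_iInter fun q => isClosed_eq (by fun_prop) (by fun_prop)

theorem weakRel_of_mem_annihilationCore {f h : EvenL2} (hfh : (f, h) ∈ annihilationCore.graph) :
    WeakRel f h := by
  intro q
  obtain ⟨k, hk, hk'⟩ := mem_graph_annihilationCore.1 hfh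
  -- test with an antiderivative `p` of `q`: `N p` and `L_- p` only involve `p' = q`
  obtain ⟨p, rfl⟩ := exists_derivative_eq q
  have h1 := inner_J_of_mem_graph_numberOp hk p
  have h2 := inner_J_of_mem_graph_Lplus hk' p
  rw [numberPoly_one_eq, map_smul, inner_smul_left] at h1
  rw [lowerPoly_one_eq, map_smul, inner_smul_left] at h2
  have h3 : (conj (1 / 4 : ℂ)) ≠ 0 := by simp
  refine mul_left_cancel₀ h3 ?_
  rw [h1, mul_neg, h2, neg_neg]

theorem weakRel_of_mem_closure {p : EvenL2 × EvenL2}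
    (hp : p ∈ annihilationCore.graph.topologicalClosure) : WeakRel p.1 p.2 :=
  closure_graph_subset isClosed_weakRel (fun _ h => weakRel_of_mem_annihilationCore h) hp

theorem weakRel_of_mem_annihilation {f h : EvenL2} (hfh : (f, h) ∈ annihilation.graph) :
    WeakRel f h :=
  weakRel_of_mem_closure (graph_closure_le _ hfh)

theorem exists_mem_graph_Q_of_Eplus {f f' : EvenL2} (h : (f, f') ∈ Eplus.graph) :
    ∃ g, ((f : L2), g) ∈ Q.graph := by
  obtain ⟨_, h1, _⟩ := mem_graph_smul.1 (mem_graph_part.1 h)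
  obtain ⟨g, hg, _⟩ := mem_graph_opMul.1 h1
  exact ⟨g, hg⟩

theorem exists_mem_graph_P_of_Eminus {f f' : EvenL2} (h : (f, f') ∈ Eminus.graph) :
    ∃ g, ((f : L2), g) ∈ P.graph := by
  obtain ⟨_, h1, _⟩ := mem_graph_smul.1 (mem_graph_part.1 h)
  obtain ⟨g, hg, _⟩ := mem_graph_opMul.1 h1
  exact ⟨g, hg⟩

theorem exists_mem_graph_of_numberOp {f f' : EvenL2} (h : (f, f') ∈ numberOp.graph) :
    (∃ g, ((f : L2), g) ∈ Q.graph) ∧ ∃ g, ((f : L2), g) ∈ P.graph := by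
  obtain ⟨_, h1, _⟩ := mem_graph_smul.1 h
  obtain ⟨_, _, h2, _, _⟩ := mem_graph_sub.1 h1
  obtain ⟨_, h3, _⟩ := mem_graph_smul.1 h2
  obtain ⟨_, _, h4, h5, _⟩ := mem_graph_sub.1 h3
  exact ⟨exists_mem_graph_Q_of_Eplus h5, exists_mem_graph_P_of_Eminus h4⟩

theorem exists_mem_graph_of_Lplus {f f' : EvenL2} (h : (f, f') ∈ Lplus.graph) :
    (∃ g, ((f : L2), g) ∈ Q.graph) ∧ ∃ g, ((f : L2), g) ∈ P.graph := by
  obtain ⟨_, h1, _⟩ := mem_graph_smul.1 h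
  obtain ⟨_, _, _, h2, _⟩ := mem_graph_add.1 h1
  obtain ⟨_, h3, _⟩ := mem_graph_smul.1 h2
  obtain ⟨_, _, h4, h5, _⟩ := mem_graph_add.1 h3
  exact ⟨exists_mem_graph_Q_of_Eplus h4, exists_mem_graph_P_of_Eminus h5⟩

theorem J_mem_graph_bosonA {w : ℂ} (hw : 0 < w.re) (p : Polynomial ℂ) :
    (J w p, ((Real.sqrt (1 / 2) : ℝ) : ℂ) • J w (Polynomial.X * p + gaussD w p)) ∈
      bosonA.graph := by
  refine mem_graph_smul.2 ⟨_, mem_graph_add.2 ⟨_, _, J_mem_graph_Q hw p,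
    mem_graph_smul.2 ⟨_, J_mem_graph_P hw p, rfl⟩, rfl⟩, ?_⟩
  rw [map_add, map_smul, smul_smul, mul_neg, I_mul_I, neg_neg, one_smul]

theorem isTotal_J : IsTotal (Set.range (J 1)) :=
  fun _ hf => eq_zero_of_inner_J fun p => hf _ ⟨p, rfl⟩

theorem dense_bosonA_domain : Dense (bosonA.domain : Set L2) := by
  refine isTotal_J.dense_span.mono (Submodule.span_le.2 ?_)
  rintro _ ⟨p, rfl⟩
  exact LinearPMap.mem_domain_of_mem_graph (J_mem_graph_bosonA one_re_pos p)

/-- On `D(Q) ∩ D(P)` the adjoint `a_b^*` is given by `√(1/2) (Q - iP)`. -/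
theorem mem_graph_bosonA_adjoint {f q p : L2} (hq : (f, q) ∈ Q.graph) (hp : (f, p) ∈ P.graph) :
    (f, ((Real.sqrt (1 / 2) : ℝ) : ℂ) • (q - I • p)) ∈ bosonA†.graph := by
  rw [mem_graph_adjoint dense_bosonA_domain]
  intro g g' hg
  have h1 : AdjPair bosonA (((Real.sqrt (1 / 2) : ℝ) : ℂ) • (Q + (-I) • P)) :=
    (adjPair_Q.add (adjPair_P.smul conj_I)).smul (Complex.conj_ofReal _)
  refine h1 g g' _ _ hg (mem_graph_smul.2 ⟨_, mem_graph_add.2 ⟨_, _, hq,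
    mem_graph_smul.2 ⟨_, hp, rfl⟩, rfl⟩, ?_⟩)
  rw [neg_smul, sub_eq_add_neg]

theorem J_mem_graph_bosonA_adjoint {w : ℂ} (hw : 0 < w.re) (p : Polynomial ℂ) :
    (J w p, ((Real.sqrt (1 / 2) : ℝ) : ℂ) • J w (Polynomial.X * p - gaussD w p)) ∈
      bosonA†.graph := by
  have := mem_graph_bosonA_adjoint (J_mem_graph_Q hw p) (J_mem_graph_P hw p)
  rwa [map_smul, smul_smul, mul_neg, I_mul_I, neg_neg, one_smul, ← map_sub] at this

theorem sqrt_half_ne_zero : ((Real.sqrt (1 / 2) : ℝ) : ℂ) ≠ 0 :=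
  Complex.ofReal_ne_zero.2 (Real.sqrt_pos.2 (by norm_num)).ne'

theorem X_mul_add_gaussD_one (p : Polynomial ℂ) :
    Polynomial.X * p + gaussD 1 p = Polynomial.derivative p := by
  simp [gaussD]

theorem X_mul_sub_gaussD_one (p : Polynomial ℂ) :
    Polynomial.X * p - gaussD 1 p = 2 * Polynomial.X * p - Polynomial.derivative p := by
  simp only [gaussD, Polynomial.C_1]
  ring

theorem inner_J_of_mem_graph_bosonA_adjoint {g g' : L2} (hg : (g, g') ∈ bosonA†.graph)
    (p : Polynomial ℂ) : ((Real.sqrt (1 / 2) : ℝ) : ℂ) * ⟪J 1 (Polynomial.derivative p), g⟫_ℂ =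
      ⟪J 1 p, g'⟫_ℂ := by
  have := (mem_graph_adjoint dense_bosonA_domain).1 hg _ _ (J_mem_graph_bosonA one_re_pos p)
  rwa [inner_smul_left, Complex.conj_ofReal, X_mul_add_gaussD_one] at this

theorem inner_J_of_mem_graph_bosonA {g g' : L2} (hg : (g, g') ∈ bosonA.graph)
    (p : Polynomial ℂ) : ((Real.sqrt (1 / 2) : ℝ) : ℂ) *
      ⟪J 1 (2 * Polynomial.X * p - Polynomial.derivative p), g⟫_ℂ = ⟪J 1 p, g'⟫_ℂ := by
  have h1 := (AdjPair.adjoint_right dense_bosonA_domain).symm _ _ _ _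
    (J_mem_graph_bosonA_adjoint one_re_pos p) hg
  rwa [inner_smul_left, Complex.conj_ofReal, X_mul_sub_gaussD_one] at h1

theorem bosonA_adjoint_injective (f : L2) (hf : (f, (0 : L2)) ∈ bosonA†.graph) : f = 0 := by
  refine eq_zero_of_inner_J fun p => ?_
  obtain ⟨q, rfl⟩ := exists_derivative_eq p
  have h1 := inner_J_of_mem_graph_bosonA_adjoint hf q
  rw [inner_zero_right] at h1
  exact (mul_eq_zero.1 h1).resolve_left sqrt_half_ne_zero

theorem mem_graph_bosonQuotient {f h : EvenL2} : (f, h) ∈ bosonQuotient.graph ↔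
    ∃ k, ((f : L2), k) ∈ bosonA.graph ∧ (-(h : L2), k) ∈ bosonA†.graph := by
  rw [bosonQuotient, mem_graph_part, mem_graph_neg, mem_graph_opMul]
  simp only [mem_graph_inverse bosonA_adjoint_injective]

/-- The operators `a` and `-(a_b^*)⁻¹ a_b` agree on the domain of `L_+⁻¹ N`. -/
theorem annihilationCore_le_bosonQuotient : annihilationCore ≤ bosonQuotient := by
  refine LinearPMap.le_of_le_graph ?_
  rintro ⟨f, h⟩ hfh
  obtain ⟨k, hk, hk'⟩ := mem_graph_annihilationCore.1 hfh
  obtain ⟨⟨fq, hfq⟩, ⟨fp, hfp⟩⟩ := exists_mem_graph_of_numberOp hk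
  obtain ⟨⟨gq, hgq⟩, ⟨gp, hgp⟩⟩ := exists_mem_graph_of_Lplus hk'
  have hA : ((f : L2), ((Real.sqrt (1 / 2) : ℝ) : ℂ) • (fq + I • fp)) ∈ bosonA.graph :=
    mem_graph_smul.2 ⟨_, mem_graph_add.2 ⟨_, _, hfq, mem_graph_smul.2 ⟨_, hfp, rfl⟩, rfl⟩, rfl⟩
  have hB := mem_graph_bosonA_adjoint hgq hgp
  refine mem_graph_bosonQuotient.2 ⟨_, hA, ?_⟩
  have hsum : ((Real.sqrt (1 / 2) : ℝ) : ℂ) • (fq + I • fp) +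
      ((Real.sqrt (1 / 2) : ℝ) : ℂ) • (gq - I • gp) = 0 := by
    refine eq_zero_of_inner_J fun p => ?_
    rw [inner_add_right, ← inner_J_of_mem_graph_bosonA hA, ← inner_J_of_mem_graph_bosonA_adjoint hB,
      weakRel_of_mem_annihilationCore hfh p]
    ring
  rw [eq_neg_of_add_eq_zero_left hsum]
  exact (bosonA†).graph.neg_mem hB

theorem annihilation_sub_one_injective (g : EvenL2)
    (hg : (g, (0 : EvenL2)) ∈ (annihilation - idOp).graph) : g = 0 := by
  obtain ⟨G, g', hG, hg', h0⟩ := mem_graph_sub.1 hg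
  obtain rfl := mem_graph_idOp.1 hg'
  obtain rfl := sub_eq_zero.1 h0.symm
  refine Subtype.ext (Q_injective _ (mem_graph_Q_of_inner_J fun p => ?_))
  have h1 := weakRel_of_mem_annihilation hG p
  rw [map_sub, inner_sub_left, sub_eq_neg_self, mul_assoc, ← Polynomial.C_ofNat,
    ← Polynomial.smul_eq_C_mul, map_smul, inner_smul_left] at h1
  rw [inner_zero_right]
  exact (mul_eq_zero.1 h1).resolve_left (by simp)

theorem mem_graph_domRestrict {E : Type*} [NormedAddCommGroup E] [NormedSpace ℂ E]
    {T : E →ₗ.[ℂ] E} {S : Submodule ℂ E} {f h : E} :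
    (f, h) ∈ (T.domRestrict S).graph ↔ f ∈ S ∧ (f, h) ∈ T.graph := by
  constructor
  · intro hf
    have h1 := LinearPMap.mem_domain_of_mem_graph hf
    exact ⟨h1.1, LinearPMap.le_graph_of_le LinearPMap.domRestrict_le hf⟩
  · rintro ⟨hS, hT⟩
    obtain ⟨⟨y, hy⟩, rfl, rfl⟩ := (LinearPMap.mem_graph_iff _).1 hT
    exact (T.domRestrict S).mem_graph ⟨y, hS, hy⟩

theorem mem_graph_cayleyCore {f h : EvenL2} : (f, h) ∈ cayleyCore.graph ↔
    f ∈ (⨆ n, numberLine n) ∧ ∃ g G, (g, G) ∈ annihilation.graph ∧ f = G - g ∧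
      h = (-I) • (G + g) := by
  rw [cayleyCore, mem_graph_domRestrict]
  refine and_congr_right fun _ => ?_
  constructor
  · intro hf
    obtain ⟨h1, hh, rfl⟩ := mem_graph_smul.1 hf
    obtain ⟨g, hg, hg'⟩ := mem_graph_opMul.1 hh
    rw [mem_graph_inverse annihilation_sub_one_injective] at hg
    obtain ⟨G, g1, hG, hg1, rfl⟩ := mem_graph_sub.1 hg
    obtain rfl := mem_graph_idOp.1 hg1
    obtain ⟨G', g2, hG', hg2, rfl⟩ := mem_graph_add.1 hg'
    obtain rfl := mem_graph_idOp.1 hg2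
    obtain rfl := annihilation.mem_graph_snd_inj hG hG' rfl
    exact ⟨_, _, hG, rfl, rfl⟩
  · rintro ⟨g, G, hG, rfl, rfl⟩
    refine mem_graph_smul.2 ⟨_, mem_graph_opMul.2 ⟨g, ?_, mem_graph_add.2 ⟨_, _, hG,
      mem_graph_idOp.2 rfl, rfl⟩⟩, rfl⟩
    rw [mem_graph_inverse annihilation_sub_one_injective]
    exact mem_graph_sub.2 ⟨_, _, hG, mem_graph_idOp.2 rfl, rfl⟩

/-- The weak form of the relation `Q h = P f`. -/
def WeakMomentumRel (f h : L2) : Prop :=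
  ∀ p : Polynomial ℂ, ⟪J 1 ((-I) • gaussD 1 p), f⟫_ℂ = ⟪J 1 (Polynomial.X * p), h⟫_ℂ

theorem weakMomentumRel_of_mem_cayleyCore {f h : EvenL2} (hfh : (f, h) ∈ cayleyCore.graph) :
    WeakMomentumRel f h := by
  obtain ⟨_, g, G, hG, rfl, rfl⟩ := mem_graph_cayleyCore.1 hfh
  intro p
  have h1 := weakRel_of_mem_annihilation hG p
  have h2 : gaussD 1 p = Polynomial.derivative p - Polynomial.X * p := by
    simp [gaussD]
  rw [map_sub, inner_sub_left, mul_assoc, ← Polynomial.C_ofNat,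
    ← Polynomial.smul_eq_C_mul, map_smul, inner_smul_left, map_ofNat] at h1
  simp only [h2, map_smul, map_sub, inner_smul_left, inner_sub_left, map_neg, conj_I,
    Submodule.coe_smul, Submodule.coe_add, Submodule.coe_sub, inner_smul_right, inner_add_right,
    inner_sub_right]
  linear_combination I * h1

/-- The polynomials are spanned by the constants and the image of `a_b^*`. -/
theorem exists_eq_two_X_mul_sub (q : Polynomial ℂ) :
    ∃ (p : Polynomial ℂ) (c : ℂ), q =
      (2 * Polynomial.X * p - Polynomial.derivative p) + c • (1 : Polynomial ℂ) := by
  induction q using Polynomial.induction_on' with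
  | add p q hp hq =>
    obtain ⟨a, c, rfl⟩ := hp
    obtain ⟨b, d, rfl⟩ := hq
    refine ⟨a + b, c + d, ?_⟩
    rw [Polynomial.derivative_add, add_smul]
    ring
  | monomial n c =>
    suffices h : ∀ n : ℕ, ∃ (p : Polynomial ℂ) (d : ℂ), (Polynomial.X ^ n : Polynomial ℂ) =
        (2 * Polynomial.X * p - Polynomial.derivative p) + d • (1 : Polynomial ℂ) by
      obtain ⟨p, d, h⟩ := h n
      refine ⟨c • p, c * d, ?_⟩
      rw [← Polynomial.C_mul_X_pow_eq_monomial, ← Polynomial.smul_eq_C_mul, h, smul_add,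
        smul_sub, Polynomial.derivative_smul, smul_smul, mul_smul_comm]
    intro n
    induction n using Nat.strong_induction_on with
    | _ n ih =>
      match n with
      | 0 => exact ⟨0, 1, by simp⟩
      | 1 => exact ⟨(1 / 2 : ℂ) • 1, 0, by
          refine Polynomial.funext fun z => ?_
          simp⟩
      | n + 2 =>
        obtain ⟨p, d, h⟩ := ih n (by omega)
        refine ⟨(1 / 2 : ℂ) • Polynomial.X ^ (n + 1) + ((n + 1 : ℂ) / 2) • p,
          ((n + 1 : ℂ) / 2) * d, ?_⟩
        refine Polynomial.funext fun z => ?_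
        have hz := congrArg (Polynomial.eval z) h
        simp only [Polynomial.eval_pow, Polynomial.eval_X, Polynomial.eval_add,
          Polynomial.eval_sub, Polynomial.eval_mul, Polynomial.eval_ofNat, Polynomial.eval_smul,
          Polynomial.eval_one, smul_eq_mul, mul_one, Polynomial.derivative_add,
          Polynomial.derivative_smul, Polynomial.derivative_X_pow, Polynomial.eval_C] at hz ⊢
        push_cast
        linear_combination ((n + 1 : ℂ) / 2) * hz

/-- A weak eigenvector of the annihilation operator is determined by its component along the
standard Gaussian: the eigenvalue equation is a recursion for the moments. -/
theorem eq_zero_of_weakRel {ψ : L2} {ζ : ℂ} (h : WeakRel ψ (ζ • ψ)) (h0 : ⟪J 1 1, ψ⟫_ℂ = 0) :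
    ψ = 0 := by
  have key : ∀ n : ℕ, ⟪J 1 (Polynomial.X ^ n), ψ⟫_ℂ = 0 := by
    intro n
    induction n using Nat.strong_induction_on with
    | _ n ih =>
      match n with
      | 0 => simpa using h0
      | 1 =>
        have h1 := h 1
        simp only [mul_one, Polynomial.derivative_one, sub_zero, map_zero, inner_zero_left,
          neg_zero] at h1
        rw [← Polynomial.C_ofNat, ← Polynomial.smul_eq_C_mul, map_smul, inner_smul_left] at h1
        rw [pow_one]
        exact (mul_eq_zero.1 h1).resolve_left (by simp)
      | n + 2 =>
        have h1 := h (Polynomial.X ^ (n + 1))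
        have h2 := ih n (by omega)
        rw [Polynomial.derivative_X_pow, ← Polynomial.smul_eq_C_mul, mul_assoc, ← pow_succ',
          ← Polynomial.C_ofNat, ← Polynomial.smul_eq_C_mul, map_sub, map_smul, map_smul,
          inner_sub_left, inner_smul_left, inner_smul_left, inner_smul_left, inner_smul_right,
          Nat.add_sub_cancel, h2] at h1
        simp only [mul_zero, sub_zero, neg_zero] at h1
        exact (mul_eq_zero.1 h1).resolve_left (by simp)
  refine eq_zero_of_inner_J fun p => ?_
  induction p using Polynomial.induction_on' with
  | add p q hp hq => rw [map_add, inner_add_left, hp, hq, add_zero]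
  | monomial n c =>
    rw [← Polynomial.C_mul_X_pow_eq_monomial, ← Polynomial.smul_eq_C_mul, map_smul,
      inner_smul_left, key, mul_zero]

theorem exists_eq_smul_of_weakRel {ψ φ : L2} {ζ : ℂ} (hψ : WeakRel ψ (ζ • ψ))
    (hφ : WeakRel φ (ζ • φ)) (hφ0 : φ ≠ 0) : ∃ c : ℂ, ψ = c • φ := by
  have h1 : ⟪J 1 1, φ⟫_ℂ ≠ 0 := fun h => hφ0 (eq_zero_of_weakRel hφ h)
  refine ⟨⟪J 1 1, ψ⟫_ℂ / ⟪J 1 1, φ⟫_ℂ, sub_eq_zero.1 (eq_zero_of_weakRel (ζ := ζ) ?_ ?_)⟩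
  · intro q
    have h2 := hψ q
    have h3 := hφ q
    simp only [inner_sub_right, inner_smul_right, smul_sub] at h2 h3 ⊢
    rw [h2, h3]
    ring
  · rw [inner_sub_right, inner_smul_right, div_mul_cancel₀ _ h1, sub_self]

/-! ### Number states and their generating series -/

section NumberStates

open Polynomial

theorem lowerPoly_raisePoly (p : ℂ[X]) : lowerPoly 1 (raisePoly 1 p) =
    raisePoly 1 (lowerPoly 1 p) - (2 : ℂ) • numberPoly 1 p - (1 / 2 : ℂ) • p := by
  refine Polynomial.funext fun z => ?_
  simp [raisePoly_one_eq, lowerPoly_one_eq, numberPoly_one_eq, derivative_mul]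
  ring

theorem numberPoly_raisePoly (p : ℂ[X]) : numberPoly 1 (raisePoly 1 p) =
    raisePoly 1 (numberPoly 1 p) + raisePoly 1 p := by
  refine Polynomial.funext fun z => ?_
  simp [raisePoly_one_eq, numberPoly_one_eq, derivative_mul]
  ring

theorem raisePoly_smul (c : ℂ) (p : ℂ[X]) : raisePoly 1 (c • p) = c • raisePoly 1 p := by
  refine Polynomial.funext fun z => ?_
  simp [raisePoly_one_eq, derivative_mul]
  ring

theorem lowerPoly_smul (c : ℂ) (p : ℂ[X]) : lowerPoly 1 (c • p) = c • lowerPoly 1 p := by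
  refine Polynomial.funext fun z => ?_
  simp [lowerPoly_one_eq]
  ring

theorem numberPoly_smul (c : ℂ) (p : ℂ[X]) : numberPoly 1 (c • p) = c • numberPoly 1 p := by
  refine Polynomial.funext fun z => ?_
  simp [numberPoly_one_eq]
  ring

/-- The polynomial `L_+ⁿ 1 / n!`, a multiple of the Hermite polynomial of degree `2n`. -/
def statePoly : ℕ → ℂ[X]
  | 0 => 1
  | n + 1 => ((n : ℂ) + 1)⁻¹ • raisePoly 1 (statePoly n)

theorem raisePoly_statePoly (n : ℕ) :
    raisePoly 1 (statePoly n) = ((n : ℂ) + 1) • statePoly (n + 1) := by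
  rw [statePoly, smul_inv_smul₀ (Nat.cast_add_one_ne_zero n)]

theorem isEvenPoly_statePoly (n : ℕ) : IsEvenPoly (statePoly n) := by
  induction n with
  | zero => exact isEvenPoly_one
  | succ n ih => exact ih.raisePoly.smul _

theorem numberPoly_statePoly (n : ℕ) : numberPoly 1 (statePoly n) = (n : ℂ) • statePoly n := by
  induction n with
  | zero => simp [statePoly, numberPoly_one_eq]
  | succ n ih =>
    rw [statePoly, numberPoly_smul, numberPoly_raisePoly, ih, raisePoly_smul, smul_comm]
    congr 1
    push_cast
    rw [add_smul, one_smul]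

theorem lowerPoly_statePoly (n : ℕ) :
    lowerPoly 1 (statePoly (n + 1)) = (-((n : ℂ) + 1 / 2)) • statePoly n := by
  have hcomm : ∀ m : ℕ, lowerPoly 1 (statePoly (m + 1)) = ((m : ℂ) + 1)⁻¹ •
      (raisePoly 1 (lowerPoly 1 (statePoly m)) - ((2 * m + 1 / 2 : ℂ)) • statePoly m) := by
    intro m
    rw [statePoly, lowerPoly_smul, lowerPoly_raisePoly, numberPoly_statePoly, smul_smul, sub_sub,
      ← add_smul]
  induction n with
  | zero =>
    rw [hcomm, lowerPoly_one_eq]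
    refine Polynomial.funext fun z => ?_
    simp [statePoly, raisePoly_one_eq]
  | succ n ih =>
    rw [hcomm, ih, raisePoly_smul, raisePoly_statePoly, smul_smul, ← sub_smul, smul_smul]
    congr 1
    have : (n : ℂ) + 1 + 1 ≠ 0 := by exact_mod_cast Nat.succ_ne_zero (n + 1)
    push_cast
    field_simp
    ring

/-- The vector `L_+ⁿ e^{-x²/2} / n!`, a multiple of the number state `|n⟩_N`. -/
def numState (n : ℕ) : EvenL2 := JE 1 (statePoly n)

theorem coe_numState (n : ℕ) : (numState n : L2) = J 1 (statePoly n) :=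
  coe_JE one_re_pos (isEvenPoly_statePoly n)

theorem numState_mem_graph_Lplus (n : ℕ) :
    (numState n, ((n : ℂ) + 1) • numState (n + 1)) ∈ Lplus.graph := by
  have := JE_mem_graph_Lplus one_re_pos (isEvenPoly_statePoly n)
  rwa [raisePoly_statePoly, JE_smul one_re_pos (isEvenPoly_statePoly _)] at this

theorem numState_mem_graph_Lminus (n : ℕ) :
    (numState (n + 1), (-((n : ℂ) + 1 / 2)) • numState n) ∈ Lminus.graph := by
  have := JE_mem_graph_Lminus one_re_pos (isEvenPoly_statePoly (n + 1))
  rwa [lowerPoly_statePoly, JE_smul one_re_pos (isEvenPoly_statePoly _)] at this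

theorem numState_zero_mem_graph_Lminus : (numState 0, (0 : EvenL2)) ∈ Lminus.graph := by
  have := JE_mem_graph_Lminus one_re_pos (isEvenPoly_statePoly 0)
  have h0 : lowerPoly 1 (statePoly 0) = (0 : ℂ) • statePoly 0 := by
    simp [statePoly, lowerPoly_one_eq]
  rwa [h0, JE_smul one_re_pos (isEvenPoly_statePoly _), zero_smul] at this

theorem numState_mem_graph_numberOp (n : ℕ) :
    (numState n, (n : ℂ) • numState n) ∈ numberOp.graph := by
  have := JE_mem_graph_numberOp one_re_pos (isEvenPoly_statePoly n)
  rwa [numberPoly_statePoly, JE_smul one_re_pos (isEvenPoly_statePoly _)] at this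

/-- On number states, the annihilation operator is a (backward) shift. -/
theorem numState_mem_annihilationCore (n : ℕ) :
    (numState (n + 1), numState n) ∈ annihilationCore.graph := by
  refine mem_graph_annihilationCore.2 ⟨_, numState_mem_graph_numberOp (n + 1), ?_⟩
  have := numState_mem_graph_Lplus n
  push_cast
  exact this

theorem numState_zero_mem_annihilationCore :
    (numState 0, (0 : EvenL2)) ∈ annihilationCore.graph := by
  refine mem_graph_annihilationCore.2 ⟨_, numState_mem_graph_numberOp 0, ?_⟩
  rw [Nat.cast_zero, zero_smul]
  exact Lplus.graph.zero_mem

/-- Rules for the inner product of `EvenL2`, restated at this type because the general ones do not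
match, as rewriting rules, the structure it inherits as a submodule. -/
theorem EvenL2.inner_smul_left (f g : EvenL2) (c : ℂ) : ⟪c • f, g⟫_ℂ = conj c * ⟪f, g⟫_ℂ :=
  _root_.inner_smul_left f g c

theorem EvenL2.inner_smul_right (f g : EvenL2) (c : ℂ) : ⟪f, c • g⟫_ℂ = c * ⟪f, g⟫_ℂ :=
  _root_.inner_smul_right f g c

theorem EvenL2.inner_self (f : EvenL2) : ⟪f, f⟫_ℂ = ((‖f‖ : ℝ) : ℂ) ^ 2 :=
  inner_self_eq_norm_sq_to_K f

theorem EvenL2.inner_conj_symm (f g : EvenL2) : conj ⟪g, f⟫_ℂ = ⟪f, g⟫_ℂ :=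
  _root_.inner_conj_symm f g

theorem norm_numState_succ_le (n : ℕ) : ‖numState (n + 1)‖ ≤ ‖numState n‖ := by
  have h1 := adjPair_Lplus _ _ _ _ (numState_mem_graph_Lplus n)
    (mem_graph_neg.2 (by rw [neg_neg]; exact numState_mem_graph_Lminus n) :
      (numState (n + 1), -((-((n : ℂ) + 1 / 2)) • numState n)) ∈ (-Lminus).graph)
  rw [EvenL2.inner_smul_left, inner_neg_right, EvenL2.inner_smul_right, EvenL2.inner_self,
    EvenL2.inner_self, map_add, map_one, Complex.conj_natCast] at h1
  have h2 : ((n : ℝ) + 1) * ‖numState (n + 1)‖ ^ 2 = (n + 1 / 2) * ‖numState n‖ ^ 2 := by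
    have h3 : (((n : ℝ) + 1) * ‖numState (n + 1)‖ ^ 2 : ℂ) =
        (((n + 1 / 2) * ‖numState n‖ ^ 2 : ℝ) : ℂ) := by
      push_cast
      rw [neg_mul, neg_neg] at h1
      exact h1
    exact_mod_cast h3
  have hn : (0 : ℝ) ≤ n := Nat.cast_nonneg n
  refine (sq_le_sq₀ (norm_nonneg _) (norm_nonneg _)).1 ?_
  nlinarith [sq_nonneg ‖numState n‖]

theorem norm_numState_le (n : ℕ) : ‖numState n‖ ≤ ‖numState 0‖ := by
  induction n with
  | zero => exact le_rfl
  | succ n ih => exact (norm_numState_succ_le n).trans ih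

theorem J_ne_zero {w : ℂ} (hw : 0 < w.re) : J w 1 ≠ 0 := by
  intro h
  have h1 := coeFn_J hw 1
  rw [h] at h1
  have h2 : ∀ᵐ x : ℝ, False := by
    filter_upwards [h1, Lp.coeFn_zero ℂ 2 (volume : Measure ℝ)] with x h3 h4
    rw [h4] at h3
    simp only [gaussFun, Polynomial.eval_one, one_mul, Pi.zero_apply] at h3
    exact Complex.exp_ne_zero _ h3.symm
  have h3 := ae_iff.1 h2
  simp at h3

theorem numState_zero_ne_zero : numState 0 ≠ 0 := by
  intro h
  have h1 := coe_numState 0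
  rw [h] at h1
  exact J_ne_zero one_re_pos h1.symm

theorem weakRel_zero_of_mem_graph_Lminus {v : EvenL2} (hv : (v, (0 : EvenL2)) ∈ Lminus.graph) :
    WeakRel v 0 := by
  intro q
  obtain ⟨p, c, rfl⟩ := exists_eq_two_X_mul_sub q
  have h1 := inner_J_of_mem_graph_Lminus hv p
  rw [raisePoly_one_eq, map_smul, inner_smul_left, Submodule.coe_zero, inner_zero_right,
    neg_zero] at h1
  have h2 := (mul_eq_zero.1 h1).resolve_left (by simp)
  -- the contribution of the constants is odd, hence orthogonal to `v`
  have h3 : ⟪J 1 X, (v : L2)⟫_ℂ = 0 := inner_J_of_odd one_re_pos (by simp) v.2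
  have h4 : 2 * X * (2 * X * p - derivative p + c • (1 : ℂ[X])) -
      derivative (2 * X * p - derivative p + c • 1) =
      (2 * X * (2 * X * p - derivative p) - derivative (2 * X * p - derivative p)) +
        (2 * c) • X := by
    rw [derivative_add, derivative_smul, derivative_one, smul_zero, add_zero, mul_smul,
      smul_eq_C_mul (2 : ℂ), C_ofNat, smul_eq_C_mul c, smul_eq_C_mul c]
    ring
  rw [h4, map_add, inner_add_left, h2, map_smul, inner_smul_left, h3, inner_zero_right]
  simp

/-- The kernel of `L_-` is spanned by the standard Gaussian. -/
theorem exists_eq_smul_numState_zero {v : EvenL2} (hv : (v, (0 : EvenL2)) ∈ Lminus.graph) :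
    ∃ c : ℂ, v = c • numState 0 := by
  have h1 : ∀ {v : EvenL2}, (v, (0 : EvenL2)) ∈ Lminus.graph →
      WeakRel v ((0 : ℂ) • (v : L2)) := fun h => by
    rw [zero_smul]
    exact weakRel_zero_of_mem_graph_Lminus h
  obtain ⟨c, hc⟩ := exists_eq_smul_of_weakRel (h1 hv) (h1 numState_zero_mem_graph_Lminus)
    (fun h => numState_zero_ne_zero (Subtype.ext h))
  exact ⟨c, Subtype.ext hc⟩

theorem mem_numberLine_zero {v : EvenL2} : v ∈ numberLine 0 ↔ (v, (0 : EvenL2)) ∈ Lminus.graph := by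
  constructor
  · rintro ⟨x, hx, rfl⟩
    have := Lminus.mem_graph x
    rwa [show Lminus x = 0 from hx] at this
  · intro hv
    obtain ⟨x, rfl, hx⟩ := (LinearPMap.mem_graph_iff _).1 hv
    exact ⟨x, hx, rfl⟩

theorem mem_numberLine_succ {n : ℕ} {v : EvenL2} :
    v ∈ numberLine (n + 1) ↔ ∃ x ∈ numberLine n, (x, v) ∈ Lplus.graph := by
  constructor
  · rintro ⟨x, hx, rfl⟩
    exact ⟨x, hx, Lplus.mem_graph x⟩
  · rintro ⟨x, hx, hv⟩
    obtain ⟨y, rfl, rfl⟩ := (LinearPMap.mem_graph_iff _).1 hv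
    exact ⟨y, hx, rfl⟩

theorem numState_mem_numberLine (n : ℕ) : numState n ∈ numberLine n := by
  induction n with
  | zero => exact mem_numberLine_zero.2 numState_zero_mem_graph_Lminus
  | succ n ih =>
    have h1 : ((n : ℂ) + 1) • numState (n + 1) ∈ numberLine (n + 1) :=
      mem_numberLine_succ.2 ⟨_, ih, numState_mem_graph_Lplus n⟩
    have h2 := (numberLine (n + 1)).smul_mem ((n : ℂ) + 1)⁻¹ h1
    rwa [inv_smul_smul₀ (Nat.cast_add_one_ne_zero n)] at h2

theorem exists_eq_smul_of_mem_numberLine {n : ℕ} {v : EvenL2} (hv : v ∈ numberLine n) :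
    ∃ c : ℂ, v = c • numState n := by
  induction n generalizing v with
  | zero => exact exists_eq_smul_numState_zero (mem_numberLine_zero.1 hv)
  | succ n ih =>
    obtain ⟨x, hx, hxv⟩ := mem_numberLine_succ.1 hv
    obtain ⟨c, rfl⟩ := ih hx
    refine ⟨c * ((n : ℂ) + 1), ?_⟩
    rw [mul_smul]
    exact Lplus.mem_graph_snd_inj hxv (Lplus.graph.smul_mem c (numState_mem_graph_Lplus n)) rfl

theorem exists_mem_graph_P_of_mem_numberLine {f : EvenL2} (hf : f ∈ ⨆ n, numberLine n) :
    ∃ k, ((f : L2), k) ∈ P.graph := by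
  have h1 : (⨆ n, numberLine n) ≤ P.domain.comap evenL2.subtype := by
    refine iSup_le fun n v hv => ?_
    obtain ⟨c, rfl⟩ := exists_eq_smul_of_mem_numberLine hv
    rw [Submodule.mem_comap, map_smul]
    refine Submodule.smul_mem _ c ?_
    rw [Submodule.subtype_apply, coe_numState]
    exact LinearPMap.mem_domain_of_mem_graph (J_mem_graph_P one_re_pos _)
  exact LinearPMap.mem_domain_iff.1 (h1 hf)

theorem mem_graph_momentumQuotient {f h : EvenL2} : (f, h) ∈ momentumQuotient.graph ↔
    ∃ k, ((f : L2), k) ∈ P.graph ∧ ((h : L2), k) ∈ Q.graph := by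
  rw [momentumQuotient, mem_graph_part, mem_graph_opMul]
  simp only [mem_graph_inverse Q_injective]

/-- The operators `A` and `Q⁻¹ P` agree on the domain of the core of `A`. -/
theorem cayleyCore_le_momentumQuotient : cayleyCore ≤ momentumQuotient := by
  refine LinearPMap.le_of_le_graph ?_
  rintro ⟨f, h⟩ hfh
  obtain ⟨k, hk⟩ := exists_mem_graph_P_of_mem_numberLine (mem_graph_cayleyCore.1 hfh).1
  refine mem_graph_momentumQuotient.2 ⟨k, hk, mem_graph_Q_of_inner_J fun p => ?_⟩
  rw [← weakMomentumRel_of_mem_cayleyCore hfh p]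
  exact adjPair_P _ _ _ _ (J_mem_graph_P one_re_pos p) hk

theorem isClosable_cayleyCore : cayleyCore.IsClosable := by
  refine isClosable_of_forall fun h hh => ?_
  have hS : IsClosed {p : EvenL2 × EvenL2 | WeakMomentumRel p.1 p.2} := by
    have : {p : EvenL2 × EvenL2 | WeakMomentumRel p.1 p.2} = ⋂ q : ℂ[X],
        {p : EvenL2 × EvenL2 | ⟪J 1 ((-I) • gaussD 1 q), (p.1 : L2)⟫_ℂ =
          ⟪J 1 (X * q), (p.2 : L2)⟫_ℂ} := by
      ext p
      simp [WeakMomentumRel]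
    rw [this]
    exact isClosed_iInter fun q => isClosed_eq (by fun_prop) (by fun_prop)
  have h1 : WeakMomentumRel (0 : EvenL2) h :=
    closure_graph_subset hS (fun _ hp => weakMomentumRel_of_mem_cayleyCore hp) hh
  refine Subtype.ext (Q_injective _ (mem_graph_Q_of_inner_J fun p => ?_))
  rw [← h1 p, Submodule.coe_zero, inner_zero_right, inner_zero_right]

theorem isClosable_annihilationCore : annihilationCore.IsClosable := by
  refine isClosable_of_forall fun h hh => ?_
  have h1 := weakRel_of_mem_closure hh
  refine Subtype.ext (eq_zero_of_inner_J fun p => ?_)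
  obtain ⟨q, rfl⟩ := exists_derivative_eq p
  have h2 := h1 q
  rw [Submodule.coe_zero, inner_zero_right, zero_eq_neg] at h2
  exact h2

/-- The partial sums of `∑ ζⁿ L_+ⁿ/n! e^{-x²/2}`. -/
def partialState (ζ : ℂ) (K : ℕ) : EvenL2 := ∑ n ∈ Finset.range K, ζ ^ n • numState n

theorem partialState_mem_annihilationCore (ζ : ℂ) (K : ℕ) :
    (partialState ζ (K + 1), ζ • partialState ζ K) ∈ annihilationCore.graph := by
  have h1 : ((partialState ζ (K + 1), ζ • partialState ζ K) : EvenL2 × EvenL2) =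
      (∑ n ∈ Finset.range K, ζ ^ (n + 1) • ((numState (n + 1), numState n) : EvenL2 × EvenL2)) +
        (numState 0, 0) := by
    refine Prod.ext ?_ ?_
    · rw [partialState, Finset.sum_range_succ']
      simp [Prod.fst_sum]
    · simp [Prod.snd_sum, partialState, Finset.smul_sum, smul_smul, pow_succ']
  rw [h1]
  exact Submodule.add_mem _ (Submodule.sum_mem _ fun n _ => Submodule.smul_mem _ _
    (numState_mem_annihilationCore n)) numState_zero_mem_annihilationCore

theorem partialState_mem_numberLine (ζ : ℂ) (K : ℕ) :
    partialState ζ K ∈ ⨆ n, numberLine n :=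
  Submodule.sum_mem _ fun n _ => Submodule.smul_mem _ _
    (Submodule.mem_iSup_of_mem n (numState_mem_numberLine n))

/-- The limit of the partial sums is a nonzero weak eigenvector of the annihilation operator. -/
theorem exists_tendsto_partialState {ζ : ℂ} (hζ : ‖ζ‖ < 1) :
    ∃ G : EvenL2, Filter.Tendsto (partialState ζ) Filter.atTop (nhds G) ∧ G ≠ 0 ∧
      WeakRel G (ζ • (G : L2)) := by
  have hs : Summable fun n => ζ ^ n • numState n := by
    refine Summable.of_norm_bounded (g := fun n => ‖ζ‖ ^ n * ‖numState 0‖)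
      ((summable_geometric_of_lt_one (norm_nonneg _) hζ).mul_right _) fun n => ?_
    rw [norm_smul, norm_pow]
    gcongr
    exact norm_numState_le n
  have ht := hs.hasSum.tendsto_sum_nat
  set G := ∑' n, ζ ^ n • numState n
  refine ⟨G, ht, ?_, ?_⟩
  · intro hG
    have h1 : Filter.Tendsto (fun K => ⟪numState 0, partialState ζ (K + 1)⟫_ℂ) Filter.atTop
        (nhds ⟪numState 0, G⟫_ℂ) :=
      ((continuous_const.inner continuous_id).tendsto G).comp
        (ht.comp (Filter.tendsto_add_atTop_nat 1))
    have h2 : ∀ K, ⟪numState 0, partialState ζ (K + 1)⟫_ℂ = ⟪numState 0, numState 0⟫_ℂ := by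
      intro K
      rw [partialState, Finset.sum_range_succ', inner_add_right, inner_sum, pow_zero, one_smul]
      rw [Finset.sum_eq_zero, zero_add]
      intro n _
      have h3 := adjPair_Lplus _ _ _ _ (numState_mem_graph_Lplus n)
        (mem_graph_neg.2 (by rw [neg_zero]; exact numState_zero_mem_graph_Lminus) :
          (numState 0, (0 : EvenL2)) ∈ (-Lminus).graph)
      rw [inner_zero_right, EvenL2.inner_smul_left] at h3
      have h4 := (mul_eq_zero.1 h3).resolve_left (by
        rw [map_add, map_one, Complex.conj_natCast]; exact Nat.cast_add_one_ne_zero n)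
      rw [EvenL2.inner_smul_right, ← EvenL2.inner_conj_symm, h4, map_zero, mul_zero]
    simp only [h2] at h1
    have h5 := tendsto_nhds_unique h1 tendsto_const_nhds
    rw [hG, inner_zero_right] at h5
    exact numState_zero_ne_zero (inner_self_eq_zero.1 h5.symm)
  · have h1 : (G, ζ • G) ∈ annihilationCore.closure.graph :=
      mem_graph_closure_of_tendsto isClosable_annihilationCore
        (ht.comp (Filter.tendsto_add_atTop_nat 1)) (ht.const_smul ζ)
        (fun K => partialState_mem_annihilationCore ζ K)
    exact weakRel_of_mem_annihilation h1

/-- The sum of the series is an eigenvector of the Cayley transform: its image under `a - 1` is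
approximated by the images of the partial sums, on which `a` shifts the index. -/
theorem mem_graph_cayleyA_of_tendsto {ζ : ℂ} (hζ : ζ ≠ 1) {G : EvenL2}
    (hG : Filter.Tendsto (partialState ζ) Filter.atTop (nhds G)) :
    (G, (I * ((1 + ζ) / (1 - ζ))) • G) ∈ cayleyA.graph := by
  have hζ' : ζ - 1 ≠ 0 := sub_ne_zero.2 hζ
  have hζ'' : 1 - ζ ≠ 0 := sub_ne_zero.2 hζ.symm
  have hG' := hG.comp (Filter.tendsto_add_atTop_nat 1)
  have hu := ((hG.const_smul ζ).sub hG').const_smul (ζ - 1)⁻¹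
  have hv := (((hG.const_smul ζ).add hG').const_smul (ζ - 1)⁻¹).const_smul (-I)
  have e1 : (ζ - 1)⁻¹ • (ζ • G - G) = G := by
    rw [show ζ • G - G = (ζ - 1) • G by rw [sub_smul, one_smul], inv_smul_smul₀ hζ']
  have e2 : (-I) • (ζ - 1)⁻¹ • (ζ • G + G) = (I * ((1 + ζ) / (1 - ζ))) • G := by
    rw [show ζ • G + G = (ζ + 1) • G by rw [add_smul, one_smul], smul_smul, smul_smul]
    congr 1
    rw [← neg_sub 1 ζ, inv_neg]
    field_simp
    ring
  rw [e1] at hu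
  rw [e2] at hv
  refine mem_graph_closure_of_tendsto isClosable_cayleyCore hu hv fun K => ?_
  refine mem_graph_cayleyCore.2 ⟨?_, (ζ - 1)⁻¹ • partialState ζ (K + 1),
    (ζ - 1)⁻¹ • ζ • partialState ζ K, ?_, ?_, ?_⟩
  · exact Submodule.smul_mem _ _ (Submodule.sub_mem _ (Submodule.smul_mem _ _
      (partialState_mem_numberLine ζ K)) (partialState_mem_numberLine ζ (K + 1)))
  · exact annihilation.graph.smul_mem (ζ - 1)⁻¹
      (mem_graph_closure_of_mem (partialState_mem_annihilationCore ζ K))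
  · rw [smul_sub]; rfl
  · rw [smul_add]; rfl

end NumberStates

/-! ### The flow of `su(1,1)` on Gaussians -/

section GaussianFlow

open Polynomial

/-- The even Gaussians. -/
def gaussians : Set EvenL2 := {g | ∃ w : ℂ, 0 < w.re ∧ g = JE w 1}

theorem inner_J_eq_zero_of_gaussians {f : L2} {p : ℂ[X]}
    (hf : ∀ w : ℂ, 0 < w.re → ⟪f, J w p⟫_ℂ = 0) {w : ℂ} (hw : 0 < w.re) :
    ⟪f, J w (X ^ 2 * p)⟫_ℂ = 0 := by
  have h1 : HasDerivAt (fun z => ⟪f, J z p⟫_ℂ) ⟪f, J w (C (-1 / 2) * X ^ 2 * p)⟫_ℂ w :=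
    (innerSL ℂ f).hasFDerivAt.comp_hasDerivAt w (hasDerivAt_J hw p)
  have h2 : HasDerivAt (fun z => ⟪f, J z p⟫_ℂ) 0 w := by
    refine (hasDerivAt_const w (0 : ℂ)).congr_of_eventuallyEq ?_
    filter_upwards [(isOpen_lt continuous_const Complex.continuous_re).mem_nhds hw] with z hz
    exact hf z hz
  have h3 := h1.unique h2
  rw [mul_assoc, ← smul_eq_C_mul, map_smul, inner_smul_right] at h3
  exact (mul_eq_zero.1 h3).resolve_left (by norm_num)

/-- The Gaussians are total among the even functions: derivatives in `w` produce all even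
moments, and the odd ones vanish. -/
theorem isTotal_gaussians : IsTotal gaussians := by
  intro f hf
  have h1 : ∀ n : ℕ, ∀ w : ℂ, 0 < w.re → ⟪(f : L2), J w ((X ^ 2) ^ n)⟫_ℂ = 0 := by
    intro n
    induction n with
    | zero =>
      intro w hw
      have h2 : ⟪(JE w 1 : L2), (f : L2)⟫_ℂ = 0 := hf _ ⟨w, hw, rfl⟩
      rw [coe_JE hw isEvenPoly_one] at h2
      rw [pow_zero, ← inner_conj_symm, h2, map_zero]
    | succ n ih =>
      intro w hw
      rw [pow_succ']
      exact inner_J_eq_zero_of_gaussians ih hw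
  refine Subtype.ext (eq_zero_of_inner_J fun p => ?_)
  induction p using Polynomial.induction_on' with
  | add p q hp hq => rw [map_add, inner_add_left, hp, hq, add_zero]
  | monomial n c =>
    rw [← C_mul_X_pow_eq_monomial, ← smul_eq_C_mul, map_smul, inner_smul_left]
    rcases Nat.even_or_odd' n with ⟨k, rfl | rfl⟩
    · rw [pow_mul, ← inner_conj_symm, h1 k 1 one_re_pos, map_zero, mul_zero]
    · rw [inner_J_of_odd one_re_pos _ f.2, mul_zero]
      rw [X_pow_comp, Odd.neg_pow ⟨k, rfl⟩]

theorem hasDerivAt_of_coe {E : Type*} [NormedAddCommGroup E] [NormedSpace ℂ E]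
    {K : Submodule ℂ E} {y : ℝ → K} {y' : K} {t : ℝ}
    (h : HasDerivAt (fun t => (y t : E)) (y' : E) t) : HasDerivAt y y' t := by
  rw [hasDerivAt_iff_tendsto_slope] at h ⊢
  rw [Topology.IsEmbedding.subtypeVal.tendsto_nhds_iff]
  exact h

/-- The action of `r E_0 + s E_+ + t E_-` on `e^{-w x²/2}`. -/
def actPoly (r s t : ℝ) (w : ℂ) : ℂ[X] :=
  (r / 2 - I * t * w / 2 : ℂ) • 1 +
    (-(r * w) + I * s / 2 + I * t * w ^ 2 / 2 : ℂ) • (X * (X * 1))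

theorem isEvenPoly_actPoly (r s t : ℝ) (w : ℂ) : IsEvenPoly (actPoly r s t w) :=
  (isEvenPoly_one.smul _).add (isEvenPoly_one.X_mul_X_mul.smul _)

theorem JE_mem_graph_algebraAction (r s t : ℝ) {w : ℂ} (hw : 0 < w.re) :
    (JE w 1, JE w (actPoly r s t w)) ∈ (algebraAction r s t).graph := by
  refine mem_graph_add.2 ⟨_, _, mem_graph_add.2 ⟨_, _,
    mem_graph_smul.2 ⟨_, JE_mem_graph_E0 hw isEvenPoly_one, rfl⟩,
    mem_graph_smul.2 ⟨_, JE_mem_graph_Eplus hw isEvenPoly_one, rfl⟩, rfl⟩,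
    mem_graph_smul.2 ⟨_, JE_mem_graph_Eminus hw isEvenPoly_one, rfl⟩, ?_⟩
  have h1 := ((isEvenPoly_one.gaussD_X_mul w).add (isEvenPoly_one.X_mul_gaussD w)).smul (1 / 2)
  have h2 := isEvenPoly_one.X_mul_X_mul.smul (I / 2)
  have h3 := (isEvenPoly_one.gaussD_gaussD w).smul (I / 2)
  rw [← JE_smul hw h1, ← JE_smul hw h2, ← JE_smul hw h3, ← JE_add hw (h1.smul _) (h2.smul _),
    ← JE_add hw ((h1.smul _).add (h2.smul _)) (h3.smul _)]
  congr 1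
  refine Polynomial.funext fun z => ?_
  simp [actPoly, gaussD]
  ring

theorem adjPair_algebraAction (r s t : ℝ) :
    AdjPair (algebraAction r s t) (-algebraAction r s t) := by
  intro f f' g g' hf hg
  obtain ⟨f1, f2, hf1, hf2, rfl⟩ := mem_graph_add.1 hf
  obtain ⟨f3, f4, hf3, hf4, rfl⟩ := mem_graph_add.1 hf1
  obtain ⟨a0, ha0, rfl⟩ := mem_graph_smul.1 hf3
  obtain ⟨a1, ha1, rfl⟩ := mem_graph_smul.1 hf4
  obtain ⟨a2, ha2, rfl⟩ := mem_graph_smul.1 hf2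
  obtain ⟨g1, g2, hg1, hg2, hg'⟩ := mem_graph_add.1 (mem_graph_neg.1 hg)
  obtain ⟨g3, g4, hg3, hg4, rfl⟩ := mem_graph_add.1 hg1
  obtain ⟨b0, hb0, rfl⟩ := mem_graph_smul.1 hg3
  obtain ⟨b1, hb1, rfl⟩ := mem_graph_smul.1 hg4
  obtain ⟨b2, hb2, rfl⟩ := mem_graph_smul.1 hg2
  obtain rfl := neg_eq_iff_eq_neg.1 hg'
  simp only [inner_smul_left, inner_add_left, inner_neg_right, inner_smul_right,
    inner_add_right, adjPair_E0.inner_eq_neg ha0 hb0, adjPair_Eplus.inner_eq_neg ha1 hb1,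
    adjPair_Eminus.inner_eq_neg ha2 hb2, Complex.conj_ofReal]
  ring

/-- The Möbius action on `w = p / m` of the linear flow on `(p, m)` preserves the right
half-plane, since `Re (p m^*)` is conserved. -/
theorem re_mul_conj_eq {r s t : ℝ} {p m : ℝ → ℂ}
    (hp : ∀ τ, HasDerivAt p (r * p τ - I * s * m τ) τ)
    (hm : ∀ τ, HasDerivAt m (-(r * m τ) + I * t * p τ) τ) (τ : ℝ) :
    (p τ * conj (m τ)).re = (p 0 * conj (m 0)).re := by
  have h1 : ∀ τ, HasDerivAt (fun τ => (p τ * conj (m τ)).re) 0 τ := by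
    intro τ
    have h2 : HasDerivAt (fun τ => conj (m τ)) (conj (-(r * m τ) + I * t * p τ)) τ :=
      Complex.conjCLE.toContinuousLinearMap.hasFDerivAt.comp_hasDerivAt τ (hm τ)
    have h3 := Complex.reCLM.hasFDerivAt.comp_hasDerivAt τ ((hp τ).mul h2)
    convert! h3 using 1
    simp only [reCLM_apply, add_re, sub_re, mul_re, sub_im, mul_im, ofReal_re, ofReal_im, I_re,
      I_im, conj_re, conj_im, neg_re, neg_im, add_im]
    ring
  exact eq_of_hasDerivAt_zero h1 τ

theorem div_re_pos_iff {p m : ℂ} : 0 < (p / m).re ↔ 0 < (p * conj m).re := by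
  by_cases hm : m = 0
  · simp [hm]
  have h1 : 0 < normSq m := normSq_pos.2 hm
  have h2 : (p / m).re = (p * conj m).re / normSq m := by
    rw [div_eq_mul_inv, Complex.inv_def, ← mul_assoc, Complex.re_mul_ofReal, div_eq_mul_inv]
  rw [h2]
  exact ⟨fun h => by have := mul_pos h h1; rwa [div_mul_cancel₀ _ h1.ne'] at this,
    fun h => div_pos h h1⟩

/-- The linear flow on `(p, m)` solves the evolution equation of `r E_0 + s E_+ + t E_-` on
Gaussians with `w = p / m`, up to a scalar factor (a continuous branch of `m^{-1/2}`). -/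
theorem exists_gaussian_solution {r s t : ℝ} {p m : ℝ → ℂ}
    (hp : ∀ τ, HasDerivAt p (r * p τ - I * s * m τ) τ)
    (hm : ∀ τ, HasDerivAt m (-(r * m τ) + I * t * p τ) τ) (h0 : 0 < (p 0 / m 0).re) :
    (∀ τ, 0 < (p τ / m τ).re) ∧ ∃ c : ℝ → ℂ, c 0 = 1 ∧ (∀ τ, c τ ≠ 0) ∧
      ∀ τ, HasDerivAt (fun τ => c τ • JE (p τ / m τ) 1)
        (c τ • JE (p τ / m τ) (actPoly r s t (p τ / m τ))) τ := by
  have hpos : ∀ τ, 0 < (p τ / m τ).re := fun τ => by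
    rw [div_re_pos_iff] at h0 ⊢
    rwa [re_mul_conj_eq hp hm τ]
  have hm0 : ∀ τ, m τ ≠ 0 := fun τ h => by
    have := hpos τ
    simp [h] at this
  have hw : ∀ τ, HasDerivAt (fun τ => p τ / m τ)
      (2 * r * (p τ / m τ) - I * s - I * t * (p τ / m τ) ^ 2) τ := by
    intro τ
    have := (hp τ).div (hm τ) (hm0 τ)
    convert! this using 1
    field_simp [hm0 τ]
    ring
  have hwc : Continuous fun τ => p τ / m τ :=
    continuous_iff_continuousAt.2 fun τ => (hw τ).continuousAt
  set κ : ℝ → ℂ := fun τ => r / 2 - I * t * (p τ / m τ) / 2 with hκ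
  have hκc : Continuous κ := by
    rw [hκ]
    fun_prop
  refine ⟨hpos, fun τ => Complex.exp (∫ σ in (0 : ℝ)..τ, κ σ), by simp,
    fun τ => Complex.exp_ne_zero _, fun τ => hasDerivAt_of_coe ?_⟩
  have h1 : HasDerivAt (fun τ => Complex.exp (∫ σ in (0 : ℝ)..τ, κ σ))
      (Complex.exp (∫ σ in (0 : ℝ)..τ, κ σ) * κ τ) τ :=
    (intervalIntegral.integral_hasDerivAt_right (hκc.intervalIntegrable _ _)
      hκc.stronglyMeasurable.stronglyMeasurableAtFilter hκc.continuousAt).cexp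
  have h2 := (hasDerivAt_J (hpos τ) 1).scomp τ (hw τ)
  have h3 := h1.smul h2
  have e1 : (fun τ => ((Complex.exp (∫ σ in (0 : ℝ)..τ, κ σ) • JE (p τ / m τ) 1 : EvenL2) : L2)) =
      fun τ => Complex.exp (∫ σ in (0 : ℝ)..τ, κ σ) • J (p τ / m τ) 1 := by
    funext τ
    rw [Submodule.coe_smul, coe_JE (hpos τ) isEvenPoly_one]
  rw [e1]
  convert! h3 using 1
  rw [Submodule.coe_smul, coe_JE (hpos τ) (isEvenPoly_actPoly _ _ _ _), Function.comp_apply,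
    mul_smul, ← smul_add]
  refine congrArg _ ?_
  rw [← map_smul (J _) (κ τ), ← map_smul (J _) (_ - _), ← map_add]
  congr 1
  refine Polynomial.funext fun z => ?_
  simp only [actPoly, hκ, eval_add, eval_smul, eval_mul, eval_C, eval_pow, eval_X, eval_one,
    smul_eq_mul]
  ring

end GaussianFlow

/-! ### Exponentials of `su(1,1)` -/

section Exponentials

open scoped Matrix

attribute [local instance] Matrix.linftyOpNormedRing Matrix.linftyOpNormedAlgebra

/-- The orbit of a vector under the one-parameter group of a matrix, in the coordinates
`p = μ + ν`, `m = μ - ν` of the vector `(ν, μ)`. -/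
theorem hasDerivAt_exp_mulVec (r s t : ℝ) (v : Fin 2 → ℂ) (τ : ℝ) :
    HasDerivAt (fun τ : ℝ => (NormedSpace.exp (τ • algebraElement r s t) *ᵥ v) 1 +
        (NormedSpace.exp (τ • algebraElement r s t) *ᵥ v) 0)
      (r * ((NormedSpace.exp (τ • algebraElement r s t) *ᵥ v) 1 +
        (NormedSpace.exp (τ • algebraElement r s t) *ᵥ v) 0) -
        I * s * ((NormedSpace.exp (τ • algebraElement r s t) *ᵥ v) 1 -
        (NormedSpace.exp (τ • algebraElement r s t) *ᵥ v) 0)) τ ∧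
    HasDerivAt (fun τ : ℝ => (NormedSpace.exp (τ • algebraElement r s t) *ᵥ v) 1 -
        (NormedSpace.exp (τ • algebraElement r s t) *ᵥ v) 0)
      (-(r * ((NormedSpace.exp (τ • algebraElement r s t) *ᵥ v) 1 -
        (NormedSpace.exp (τ • algebraElement r s t) *ᵥ v) 0)) +
        I * t * ((NormedSpace.exp (τ • algebraElement r s t) *ᵥ v) 1 +
        (NormedSpace.exp (τ • algebraElement r s t) *ᵥ v) 0)) τ := by
  have h1 := hasDerivAt_exp_smul_const' (𝕂 := ℝ) (algebraElement r s t) τ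
  have h2 : ∀ i, HasDerivAt
      (fun τ : ℝ => (NormedSpace.exp (τ • algebraElement r s t) *ᵥ v) i)
      ((algebraElement r s t *ᵥ (NormedSpace.exp (τ • algebraElement r s t) *ᵥ v)) i) τ := by
    intro i
    let ℓ : Matrix (Fin 2) (Fin 2) ℂ →ₗ[ℝ] ℂ :=
      { toFun := fun M => (M *ᵥ v) i
        map_add' := fun M N => by rw [Matrix.add_mulVec]; rfl
        map_smul' := fun c M => by rw [Matrix.smul_mulVec]; rfl }
    have h3 := (LinearMap.toContinuousLinearMap ℓ).hasFDerivAt.comp_hasDerivAt τ h1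
    rw [Matrix.mulVec_mulVec]
    exact h3
  set u := NormedSpace.exp (τ • algebraElement r s t) *ᵥ v
  have e0 : (algebraElement r s t *ᵥ u) 0 =
      r * u 1 + s * (I / 2) * (u 0 - u 1) + t * (I / 2) * (-u 0 - u 1) := by
    simp [algebraElement, Matrix.mulVec, dotProduct, Fin.sum_univ_two]
    ring
  have e1 : (algebraElement r s t *ᵥ u) 1 =
      r * u 0 + s * (I / 2) * (u 0 - u 1) + t * (I / 2) * (u 0 + u 1) := by
    simp [algebraElement, Matrix.mulVec, dotProduct, Fin.sum_univ_two]
    ring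
  constructor
  · convert! (h2 1).add (h2 0) using 1
    rw [e0, e1]
    ring
  · convert! (h2 1).sub (h2 0) using 1
    rw [e0, e1]
    ring

/-- The parameter `w = (μ + ν)/(μ - ν)` of the Gaussian annihilated by `μ a_b + ν a_b^*`. -/
def gaussParam (μ ν : ℂ) : ℂ := (μ + ν) / (μ - ν)

theorem gaussParam_re_pos {μ ν : ℂ} (h : ‖μ‖ ^ 2 - ‖ν‖ ^ 2 = 1) : 0 < (gaussParam μ ν).re := by
  rw [gaussParam, div_re_pos_iff]
  have : ((μ + ν) * conj (μ - ν)).re = ‖μ‖ ^ 2 - ‖ν‖ ^ 2 := by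
    rw [← Complex.normSq_eq_norm_sq, ← Complex.normSq_eq_norm_sq, normSq_apply, normSq_apply]
    simp only [mul_re, add_re, add_im, conj_re, conj_im, sub_re, sub_im]
    ring
  rw [this, h]
  exact one_pos

/-- Exponentials of the algebra act on the rays of Gaussians as the matrix exponentials do on the
vectors `(ν, μ)`. -/
theorem IsExp.apply_gaussian {r s t : ℝ} {W : UnitaryGp} (hW : IsExp (algebraAction r s t) W)
    {v : Fin 2 → ℂ} (hv : 0 < (gaussParam (v 1) (v 0)).re) :
    ∃ c : ℂ, c ≠ 0 ∧ (W : EvenL2 →L[ℂ] EvenL2) (JE (gaussParam (v 1) (v 0)) 1) =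
      c • JE (gaussParam ((NormedSpace.exp (algebraElement r s t) *ᵥ v) 1)
        ((NormedSpace.exp (algebraElement r s t) *ᵥ v) 0)) 1 := by
  obtain ⟨U, hU, -, hd, rfl⟩ := hW
  obtain ⟨hpos, c, hc0, hc, hy⟩ := exists_gaussian_solution
    (fun τ => (hasDerivAt_exp_mulVec r s t v τ).1) (fun τ => (hasDerivAt_exp_mulVec r s t v τ).2)
    (by simpa [gaussParam] using hv)
  have h1 := eq_of_unitaryGroup hU hy (fun τ => by
    obtain ⟨f, hf, he⟩ := (LinearPMap.mem_graph_iff _).1 ((algebraAction r s t).graph.smul_mem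
      (c τ) (JE_mem_graph_algebraAction r s t (hpos τ)))
    have := hd f
    rw [hf, he] at this
    exact this) 1
  simp only [zero_smul, NormedSpace.exp_zero, Matrix.one_mulVec, hc0, one_smul] at h1
  exact ⟨c 1, hc 1, h1⟩

theorem exists_isSolution_gaussian (r s t : ℝ) {g : EvenL2} (hg : g ∈ gaussians) :
    ∃ y, IsSolution (algebraAction r s t) y ∧ y 0 = g ∧
      ∀ τ, y τ ∈ Submodule.span ℂ gaussians := by
  obtain ⟨w, hw, rfl⟩ := hg
  -- the vector `(ν, μ)` with `μ + ν = w` and `μ - ν = 1`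
  set v : Fin 2 → ℂ := ![(w - 1) / 2, (w + 1) / 2] with hv
  have e1 : v 1 + v 0 = w := by
    simp only [hv, Matrix.cons_val_one, Matrix.cons_val_zero]
    ring
  have e2 : v 1 - v 0 = 1 := by
    simp only [hv, Matrix.cons_val_one, Matrix.cons_val_zero]
    ring
  obtain ⟨hpos, c, hc0, hc, hy⟩ := exists_gaussian_solution
    (fun τ => (hasDerivAt_exp_mulVec r s t v τ).1) (fun τ => (hasDerivAt_exp_mulVec r s t v τ).2)
    (by simpa [e1, e2] using hw)
  refine ⟨_, fun τ => ⟨_, (algebraAction r s t).graph.smul_mem (c τ)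
    (JE_mem_graph_algebraAction r s t (hpos τ)), hy τ⟩, ?_, fun τ => Submodule.smul_mem _ _
    (Submodule.subset_span ⟨_, hpos τ, rfl⟩)⟩
  simp only [zero_smul, NormedSpace.exp_zero, Matrix.one_mulVec, hc0, one_smul, e1, e2, div_one]

/-- Every operator that is formally skew-adjoint to `r E_0 + s E_+ + t E_-` has an exponential. -/
theorem exists_isExp {r s t : ℝ} {T : EvenL2 →ₗ.[ℂ] EvenL2}
    (hT : ∀ f f', (f, f') ∈ T.graph → ∀ g g', (g, g') ∈ (algebraAction r s t).graph →
      ⟪g, f'⟫_ℂ = -⟪g', f⟫_ℂ) : ∃ W, IsExp T W := by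
  obtain ⟨U, h1, h2, h3⟩ := exists_unitaryGroup (adjPair_algebraAction r s t) isTotal_gaussians
    (fun v hv => exists_isSolution_gaussian r s t hv)
  exact ⟨U 1, U, h1, h2, fun f => h3 _ _ fun g _ g' hg => hT _ _ (T.mem_graph f) g g' hg, rfl⟩

theorem exists_isExp_algebraAction (r s t : ℝ) : ∃ W, IsExp (algebraAction r s t) W := by
  refine exists_isExp (r := r) (s := s) (t := t) fun f f' hf g g' hg => ?_
  rw [(adjPair_algebraAction r s t).inner_eq_neg hg hf, neg_neg]

theorem IsExp.of_graph_le {T T' : EvenL2 →ₗ.[ℂ] EvenL2} {W : UnitaryGp} (hW : IsExp T W)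
    (h : T'.graph ≤ T.graph) : IsExp T' W := by
  obtain ⟨U, h1, h2, h3, h4⟩ := hW
  refine ⟨U, h1, h2, fun f => ?_, h4⟩
  obtain ⟨g, hg, hg'⟩ := (LinearPMap.mem_graph_iff _).1 (h (T'.mem_graph f))
  have := h3 g
  rw [hg, hg'] at this
  exact this

theorem exists_mem_graph_of_algebraAction (ξ : ℂ) {g g' : EvenL2}
    (hg : (g, g') ∈ (algebraAction ξ.re (-ξ.im) (-ξ.im)).graph) :
    ∃ l m, (g, l) ∈ Lplus.graph ∧ (g, m) ∈ Lminus.graph ∧ g' = ξ • l + conj ξ • m := by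
  obtain ⟨f1, f2, hf1, hf2, rfl⟩ := mem_graph_add.1 hg
  obtain ⟨f3, f4, hf3, hf4, rfl⟩ := mem_graph_add.1 hf1
  obtain ⟨a0, ha0, rfl⟩ := mem_graph_smul.1 hf3
  obtain ⟨a1, ha1, rfl⟩ := mem_graph_smul.1 hf4
  obtain ⟨a2, ha2, rfl⟩ := mem_graph_smul.1 hf2
  have hI : (g, I • (a1 + a2)) ∈ (I • (Eplus + Eminus)).graph :=
    mem_graph_smul.2 ⟨_, mem_graph_add.2 ⟨_, _, ha1, ha2, rfl⟩, rfl⟩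
  refine ⟨_, _, mem_graph_smul.2 ⟨_, mem_graph_add.2 ⟨_, _, ha0, hI, rfl⟩, rfl⟩,
    mem_graph_smul.2 ⟨_, mem_graph_sub.2 ⟨_, _, ha0, hI, rfl⟩, rfl⟩, ?_⟩
  have h1 : conj ξ = ξ.re - ξ.im * I := by
    apply Complex.ext <;> simp
  rw [h1]
  nth_rw 4 [← Complex.re_add_im ξ]
  match_scalars
  · ring
  · linear_combination (-(ξ.im : ℂ)) * I_mul_I
  · linear_combination (-(ξ.im : ℂ)) * I_mul_I

theorem dense_Lplus_domain : Dense (Lplus.domain : Set EvenL2) := by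
  refine isTotal_gaussians.dense_span.mono (Submodule.span_le.2 ?_)
  rintro _ ⟨w, hw, rfl⟩
  exact LinearPMap.mem_domain_of_mem_graph (JE_mem_graph_Lplus hw isEvenPoly_one)

theorem mem_graph_Lplus_adjoint {g m : EvenL2} (hg : (g, m) ∈ Lminus.graph) :
    (g, -m) ∈ Lplus†.graph :=
  (mem_graph_adjoint dense_Lplus_domain).2 fun _ _ hf =>
    adjPair_Lplus _ _ _ _ hf (mem_graph_neg.2 (by rwa [neg_neg]))

/-- The operator `ξ L_+ - ξ^* L_+^*` extends the element `Re ξ e_0 - Im ξ (e_+ + e_-)` of the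
algebra. -/
theorem algebraAction_graph_le (ξ : ℂ) : (algebraAction ξ.re (-ξ.im) (-ξ.im)).graph ≤
    (ξ • Lplus - conj ξ • Lplus†).graph := by
  rintro ⟨g, g'⟩ hg
  obtain ⟨l, m, hl, hm, rfl⟩ := exists_mem_graph_of_algebraAction ξ hg
  refine mem_graph_sub.2 ⟨_, _, mem_graph_smul.2 ⟨_, hl, rfl⟩,
    mem_graph_smul.2 ⟨_, mem_graph_Lplus_adjoint hm, rfl⟩, ?_⟩
  rw [smul_neg, sub_neg_eq_add]

theorem exists_isExp_Lplus (ξ : ℂ) : ∃ W, IsExp (ξ • Lplus - conj ξ • Lplus†) W := by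
  refine exists_isExp (r := ξ.re) (s := -ξ.im) (t := -ξ.im) fun f f' hf g g' hg => ?_
  obtain ⟨l, m, hl, hm, rfl⟩ := exists_mem_graph_of_algebraAction ξ hg
  obtain ⟨f1, f2, hf1, hf2, rfl⟩ := mem_graph_sub.1 hf
  obtain ⟨a, ha, rfl⟩ := mem_graph_smul.1 hf1
  obtain ⟨b, hb, rfl⟩ := mem_graph_smul.1 hf2
  have h1 := adjPair_Lplus.symm g (-m) f a (mem_graph_neg.2 (by rwa [neg_neg])) ha
  have h2 := (mem_graph_adjoint dense_Lplus_domain).1 hb g l hl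
  rw [inner_sub_right, inner_add_left, EvenL2.inner_smul_right, EvenL2.inner_smul_right,
    EvenL2.inner_smul_left, EvenL2.inner_smul_left, ← h1, ← h2, inner_neg_left,
    Complex.conj_conj]
  ring

end Exponentials

/-! ### Coherent states as Gaussians -/

theorem gaussParam_mul_left {k : ℂ} (hk : k ≠ 0) (μ ν : ℂ) :
    gaussParam (k * μ) (k * ν) = gaussParam μ ν := by
  rw [gaussParam, gaussParam, ← mul_add, ← mul_sub, mul_div_mul_left _ _ hk]

theorem ne_zero_of_norm_sq_sub {μ ν : ℂ} (h : ‖μ‖ ^ 2 - ‖ν‖ ^ 2 = 1) : μ ≠ 0 := by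
  rintro rfl
  rw [norm_zero] at h
  nlinarith [sq_nonneg ‖ν‖]

theorem sub_ne_zero_of_norm_sq_sub {μ ν : ℂ} (h : ‖μ‖ ^ 2 - ‖ν‖ ^ 2 = 1) : μ - ν ≠ 0 := by
  intro h0
  rw [sub_eq_zero.1 h0, sub_self] at h
  exact zero_ne_one h

theorem norm_div_lt_one {μ ν : ℂ} (h : ‖μ‖ ^ 2 - ‖ν‖ ^ 2 = 1) : ‖ν / μ‖ < 1 := by
  rw [norm_div, div_lt_one (norm_pos_iff.2 (ne_zero_of_norm_sq_sub h))]
  exact lt_of_pow_lt_pow_left₀ 2 (norm_nonneg _) (by linarith)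

theorem gaussParam_one_div {μ ν : ℂ} (h : ‖μ‖ ^ 2 - ‖ν‖ ^ 2 = 1) :
    gaussParam 1 (ν / μ) = gaussParam μ ν := by
  have hμ := ne_zero_of_norm_sq_sub h
  rw [← gaussParam_mul_left hμ, mul_one, mul_div_cancel₀ _ hμ]

theorem matrix_fin_two_congr {a b c d a' b' c' d' : ℂ} (ha : a = a') (hb : b = b') (hc : c = c')
    (hd : d = d') : !![a, b; c, d] = !![a', b'; c', d'] := by
  rw [ha, hb, hc, hd]

theorem diagonal_fin_two (x y : ℂ) : Matrix.diagonal ![x, y] = !![x, 0; 0, y] := by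
  ext i j
  fin_cases i <;> fin_cases j <;> rfl

theorem exp_diagonal_fin_two (x y : ℂ) : NormedSpace.exp (Matrix.diagonal ![x, y]) =
    Matrix.diagonal ![Complex.exp x, Complex.exp y] := by
  rw [Matrix.exp_diagonal]
  congr 1
  ext i
  rw [Pi.coe_exp, Complex.exp_eq_exp_ℂ]
  fin_cases i <;> rfl

theorem algebraElement_eq (ξ : ℂ) :
    algebraElement ξ.re (-ξ.im) (-ξ.im) = !![0, ξ; conj ξ, 0] := by
  ext i j
  fin_cases i <;> fin_cases j <;> apply Complex.ext <;> simp [algebraElement] <;> ring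

/-- With `ζ = e^{iα} tanh ρ` the coherent parameter is `ξ = ρ e^{iα}`, and the exponential of the
matrix with off-diagonal entries `ξ, ξ^*` is the boost `cosh ρ (1, ζ; ζ^*, 1)`. -/
theorem exp_coherentParameter {ζ : ℂ} (hζ : ‖ζ‖ < 1) : ∃ κ : ℝ, 0 < κ ∧
    κ ^ 2 * (1 - ‖ζ‖ ^ 2) = 1 ∧
    NormedSpace.exp (algebraElement (coherentParameter ζ).re (-(coherentParameter ζ).im)
      (-(coherentParameter ζ).im)) = (κ : ℂ) • !![1, ζ; conj ζ, 1] := by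
  set r := ‖ζ‖ with hr
  have hr0 : 0 ≤ r := norm_nonneg ζ
  have h1 : 0 < 1 - r := by linarith
  have h2 : 0 < 1 + r := by linarith
  set ρ : ℝ := 1 / 2 * Real.log ((1 + r) / (1 - r)) with hρ
  set u : ℂ := Complex.exp (I * (Complex.arg ζ : ℂ)) with hu
  have hζu : ζ = r * u := by
    rw [hu, mul_comm I, hr, Complex.norm_mul_exp_arg_mul_I]
  have huu : u * conj u = 1 := by
    rw [Complex.mul_conj, Complex.normSq_eq_norm_sq, hu, mul_comm I, Complex.norm_exp_ofReal_mul_I]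
    simp
  have hξ : coherentParameter ζ = ρ * u := by
    rw [coherentParameter, hρ]
    push_cast
    ring
  have hexp : Real.exp ρ ^ 2 * (1 - r) = 1 + r := by
    rw [← Real.exp_nat_mul, hρ, Nat.cast_two, ← mul_assoc, mul_one_div_cancel two_ne_zero,
      one_mul, Real.exp_log (div_pos h2 h1), div_mul_cancel₀ _ h1.ne']
  have hinv : Real.exp ρ * Real.exp (-ρ) = 1 := by
    rw [← Real.exp_add, add_neg_cancel, Real.exp_zero]
  have hpos := Real.exp_pos ρ
  have hneg : Real.exp (-ρ) = Real.exp ρ * (1 - r) / (1 + r) := by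
    field_simp
    refine mul_left_cancel₀ hpos.ne' ?_
    linear_combination (1 + r) * hinv - hexp
  set κ : ℝ := Real.exp ρ / (1 + r) with hκ
  have e1 : Real.exp ρ + Real.exp (-ρ) = 2 * κ := by
    rw [hneg, hκ]
    field_simp
    ring
  have e2 : Real.exp ρ - Real.exp (-ρ) = 2 * κ * r := by
    rw [hneg, hκ]
    field_simp
    ring
  refine ⟨κ, div_pos hpos h2, ?_, ?_⟩
  · rw [hκ, div_pow]
    field_simp
    linear_combination (1 + r) * hexp
  -- diagonalization with eigenvalues `ρ` and `-ρ`
  let S : (Matrix (Fin 2) (Fin 2) ℂ)ˣ :=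
    { val := !![u, -u; 1, 1]
      inv := !![conj u / 2, 1 / 2; -(conj u / 2), 1 / 2]
      val_inv := by
        rw [Matrix.mul_fin_two, Matrix.one_fin_two]
        exact matrix_fin_two_congr (by linear_combination huu) (by ring) (by ring) (by ring)
      inv_val := by
        rw [Matrix.mul_fin_two, Matrix.one_fin_two]
        exact matrix_fin_two_congr (by linear_combination huu / 2) (by linear_combination -huu / 2)
          (by linear_combination -huu / 2) (by linear_combination huu / 2) }
  have hS : ∀ x y : ℂ, (S : Matrix (Fin 2) (Fin 2) ℂ) * Matrix.diagonal ![x, y] *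
      ((S⁻¹ : (Matrix (Fin 2) (Fin 2) ℂ)ˣ) : Matrix (Fin 2) (Fin 2) ℂ) =
        !![(x + y) / 2, u * ((x - y) / 2); conj u * ((x - y) / 2), (x + y) / 2] := by
    intro x y
    change !![u, -u; 1, 1] * Matrix.diagonal ![x, y] *
      !![conj u / 2, 1 / 2; -(conj u / 2), 1 / 2] = _
    rw [diagonal_fin_two, Matrix.mul_fin_two, Matrix.mul_fin_two]
    exact matrix_fin_two_congr (by linear_combination (x + y) / 2 * huu) (by ring) (by ring)
      (by ring)
  have h3 : algebraElement (coherentParameter ζ).re (-(coherentParameter ζ).im)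
      (-(coherentParameter ζ).im) =
      (S : Matrix (Fin 2) (Fin 2) ℂ) * Matrix.diagonal ![(ρ : ℂ), -ρ] *
        ((S⁻¹ : (Matrix (Fin 2) (Fin 2) ℂ)ˣ) : Matrix (Fin 2) (Fin 2) ℂ) := by
    rw [hS, algebraElement_eq, hξ, map_mul, Complex.conj_ofReal]
    exact matrix_fin_two_congr (by ring) (by ring) (by ring) (by ring)
  have e1' : Complex.exp ρ + Complex.exp (-ρ) = 2 * κ := by exact_mod_cast congrArg ofReal e1
  have e2' : Complex.exp ρ - Complex.exp (-ρ) = 2 * κ * r := by exact_mod_cast congrArg ofReal e2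
  rw [h3, Matrix.exp_units_conj, exp_diagonal_fin_two, hS, e1', e2', hζu, map_mul,
    Complex.conj_ofReal, Matrix.smul_of]
  simp only [Matrix.smul_cons, Matrix.smul_empty, smul_eq_mul]
  exact matrix_fin_two_congr (by ring) (by ring) (by ring) (by ring)

theorem IsLowestWeightVector.eq_smul {v : EvenL2} (hv : IsLowestWeightVector v) :
    ∃ c : ℂ, v = c • JE 1 1 :=
  exists_eq_smul_numState_zero hv.2

theorem exists_isLowestWeightVector : ∃ v, IsLowestWeightVector v := by
  refine ⟨((‖numState 0‖ : ℂ)⁻¹) • numState 0, ?_, ?_⟩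
  · rw [norm_smul, norm_inv, Complex.norm_real, norm_norm,
      inv_mul_cancel₀ (norm_ne_zero_iff.2 numState_zero_ne_zero)]
  · have := Lminus.graph.smul_mem ((‖numState 0‖ : ℂ)⁻¹) numState_zero_mem_graph_Lminus
    rwa [Prod.smul_mk, smul_zero] at this

theorem norm_unitary_apply (W : UnitaryGp) (f : EvenL2) :
    ‖(W : EvenL2 →L[ℂ] EvenL2) f‖ = ‖f‖ :=
  (ContinuousLinearMap.norm_map_iff_adjoint_comp_self (W : EvenL2 →L[ℂ] EvenL2)).2
    (Unitary.coe_star_mul_self W) f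

theorem exists_isCoherentState {ζ : ℂ} (hζ : ‖ζ‖ < 1) : ∃ φ, IsCoherentState ζ φ := by
  obtain ⟨v, hv⟩ := exists_isLowestWeightVector
  obtain ⟨W, hW⟩ := exists_isExp_Lplus (coherentParameter ζ)
  exact ⟨_, hζ, v, W, hv, hW, rfl⟩

theorem IsCoherentState.norm_eq {ζ : ℂ} {φ : EvenL2} (h : IsCoherentState ζ φ) : ‖φ‖ = 1 := by
  obtain ⟨-, v, W, hv, -, rfl⟩ := h
  rw [norm_unitary_apply, hv.1]

theorem IsCoherentState.smul {ζ c : ℂ} {φ : EvenL2} (h : IsCoherentState ζ φ) (hc : ‖c‖ = 1) :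
    IsCoherentState ζ (c • φ) := by
  obtain ⟨hζ, v, W, hv, hW, rfl⟩ := h
  refine ⟨hζ, c • v, W, ⟨by rw [norm_smul, hc, hv.1, one_mul], ?_⟩, hW, (map_smul _ _ _).symm⟩
  have := Lminus.graph.smul_mem c hv.2
  rwa [Prod.smul_mk, smul_zero] at this

theorem IsCoherentState.eq_smul {ζ : ℂ} {φ : EvenL2} (h : IsCoherentState ζ φ) :
    ∃ c : ℂ, φ = c • JE (gaussParam 1 ζ) 1 := by
  obtain ⟨hζ, v, W, hv, hW, rfl⟩ := h
  obtain ⟨c, rfl⟩ := hv.eq_smul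
  obtain ⟨κ, hκ, -, he⟩ := exp_coherentParameter hζ
  have h1 := hW.of_graph_le (algebraAction_graph_le _)
  obtain ⟨d, -, hd⟩ := h1.apply_gaussian (v := ![0, 1]) (by simp [gaussParam])
  have e1 : gaussParam ((![0, 1] : Fin 2 → ℂ) 1) ((![0, 1] : Fin 2 → ℂ) 0) = 1 := by
    simp [gaussParam]
  have e2 : gaussParam (((κ : ℂ) • !![1, ζ; conj ζ, 1]).mulVec ![0, 1] 1)
      (((κ : ℂ) • !![1, ζ; conj ζ, 1]).mulVec ![0, 1] 0) = gaussParam 1 ζ := by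
    rw [← gaussParam_mul_left (Complex.ofReal_ne_zero.2 hκ.ne') 1 ζ]
    simp [Matrix.mulVec, dotProduct, Fin.sum_univ_two]
  rw [e1, he, e2] at hd
  exact ⟨c * d, by rw [map_smul, hd, smul_smul]⟩

/-- The coherent states `|ζ⟩_a` are the normalized Gaussians with `w = (1 + ζ)/(1 - ζ)`. -/
theorem isCoherentState_iff {ζ : ℂ} (hζ : ‖ζ‖ < 1) {φ : EvenL2} :
    IsCoherentState ζ φ ↔ ‖φ‖ = 1 ∧ ∃ c : ℂ, φ = c • JE (gaussParam 1 ζ) 1 := by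
  refine ⟨fun h => ⟨h.norm_eq, h.eq_smul⟩, ?_⟩
  rintro ⟨h1, c, rfl⟩
  obtain ⟨φ, hφ⟩ := exists_isCoherentState hζ
  have h2 := hφ.norm_eq
  obtain ⟨d, rfl⟩ := hφ.eq_smul
  have hd : d ≠ 0 := by
    rintro rfl
    simp at h2
  have h3 := hφ.smul (c := c / d) (by
    rw [norm_smul] at h1 h2
    have hd' := norm_ne_zero_iff.2 hd
    have hg : ‖JE (gaussParam 1 ζ) 1‖ ≠ 0 := fun h => by
      rw [h, mul_zero] at h2
      exact zero_ne_one h2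
    rw [norm_div, div_eq_one_iff_eq hd']
    exact mul_right_cancel₀ hg (h1.trans h2.symm))
  rwa [smul_smul, div_mul_cancel₀ _ hd] at h3

theorem isCoherentStateA_iff {μ ν : ℂ} (h : ‖μ‖ ^ 2 - ‖ν‖ ^ 2 = 1) {φ : EvenL2} :
    IsCoherentStateA (I * ((μ + ν) / (μ - ν))) φ ↔ IsCoherentState (ν / μ) φ := by
  have hw : 0 < ((μ + ν) / (μ - ν)).re := gaussParam_re_pos h
  have hμ := ne_zero_of_norm_sq_sub h
  have hs := sub_ne_zero_of_norm_sq_sub h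
  have h1 : (I * ((μ + ν) / (μ - ν)) - I) / (I * ((μ + ν) / (μ - ν)) + I) = ν / μ := by
    have h2 : I * ((μ + ν) / (μ - ν)) - I = 2 * I / (μ - ν) * ν := by
      field_simp
      ring
    have h3 : I * ((μ + ν) / (μ - ν)) + I = 2 * I / (μ - ν) * μ := by
      field_simp
      ring
    rw [h2, h3, mul_div_mul_left _ _ (div_ne_zero (mul_ne_zero two_ne_zero I_ne_zero) hs)]
  rw [IsCoherentStateA, h1]
  refine and_iff_right ?_
  rwa [I_mul_im]

theorem proj_eq_of_eq_smul {φ ψ g : EvenL2} (hφ : ‖φ‖ = 1) (hψ : ‖ψ‖ = 1)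
    (h1 : ∃ c : ℂ, φ = c • g) (h2 : ∃ c : ℂ, ψ = c • g) : proj φ = proj ψ := by
  have h3 : ∀ {φ : EvenL2}, ‖φ‖ = 1 → (∃ c : ℂ, φ = c • g) →
      ∀ f, proj φ f = (⟪g, f⟫_ℂ / (‖g‖ : ℂ) ^ 2) • g := by
    rintro _ hn ⟨c, rfl⟩ f
    have hg : (‖g‖ : ℂ) ≠ 0 := by
      intro h0
      rw [Complex.ofReal_eq_zero, norm_eq_zero] at h0
      simp [h0] at hn
    have hc : conj c * c * (‖g‖ : ℂ) ^ 2 = 1 := by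
      rw [norm_smul] at hn
      rw [mul_comm (conj c), Complex.mul_conj, Complex.normSq_eq_norm_sq, ← Complex.ofReal_pow,
        ← Complex.ofReal_mul, ← mul_pow, hn, one_pow, Complex.ofReal_one]
    rw [proj, InnerProductSpace.rankOne_apply, EvenL2.inner_smul_left, smul_smul]
    congr 1
    field_simp
    linear_combination ⟪g, f⟫_ℂ * hc
  ext1 f
  rw [h3 hφ h1, h3 hψ h2]

theorem proj_unitary (W : UnitaryGp) (φ : EvenL2) :
    (W : EvenL2 →L[ℂ] EvenL2) * proj φ * star (W : EvenL2 →L[ℂ] EvenL2) =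
      proj ((W : EvenL2 →L[ℂ] EvenL2) φ) := by
  ext1 f
  rw [mul_apply_eq_comp, mul_apply_eq_comp, proj, proj, InnerProductSpace.rankOne_apply,
    InnerProductSpace.rankOne_apply, map_smul, ContinuousLinearMap.star_eq_adjoint,
    ContinuousLinearMap.adjoint_inner_right]

/-! ### Squeezed states as Gaussians, and their eigenvalue equations -/

theorem IsEigenvector.smul {E : Type*} [NormedAddCommGroup E] [NormedSpace ℂ E] {T : E →ₗ.[ℂ] E}
    {k c : ℂ} {φ : E} (h : IsEigenvector T k φ) (hc : c ≠ 0) : IsEigenvector T k (c • φ) := by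
  refine ⟨smul_ne_zero hc h.1, ?_⟩
  have := T.graph.smul_mem c h.2
  rwa [Prod.smul_mk, smul_comm] at this

theorem weakRel_of_bogoliubov {μ ν : ℂ} (hμ : μ ≠ 0) {ψ : L2}
    (h : (ψ, (0 : ℂ) • ψ) ∈ (bogoliubov μ ν).graph) : WeakRel ψ ((ν / μ) • ψ) := by
  intro q
  obtain ⟨f1, f2, hf1, hf2, h0⟩ := mem_graph_add.1 h
  obtain ⟨a, ha, rfl⟩ := mem_graph_smul.1 hf1
  obtain ⟨b, hb, rfl⟩ := mem_graph_smul.1 hf2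
  have h1 := inner_J_of_mem_graph_bosonA ha q
  have h2 := inner_J_of_mem_graph_bosonA_adjoint hb q
  have h3 : μ * ⟪J 1 q, a⟫_ℂ + ν * ⟪J 1 q, b⟫_ℂ = 0 := by
    rw [← inner_smul_right, ← inner_smul_right, ← inner_add_right, ← h0, zero_smul,
      inner_zero_right]
  rw [← h1, ← h2, mul_left_comm, mul_left_comm ν, ← mul_add] at h3
  have h4 := (mul_eq_zero.1 h3).resolve_left sqrt_half_ne_zero
  rw [inner_smul_right]
  field_simp
  linear_combination h4

theorem J_mem_graph_bogoliubov {μ ν : ℂ} (h : ‖μ‖ ^ 2 - ‖ν‖ ^ 2 = 1) :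
    (J (gaussParam μ ν) 1, (0 : ℂ) • J (gaussParam μ ν) 1) ∈ (bogoliubov μ ν).graph := by
  have hw := gaussParam_re_pos h
  refine mem_graph_add.2 ⟨_, _, mem_graph_smul.2 ⟨_, J_mem_graph_bosonA hw 1, rfl⟩,
    mem_graph_smul.2 ⟨_, J_mem_graph_bosonA_adjoint hw 1, rfl⟩, ?_⟩
  have hs := sub_ne_zero_of_norm_sq_sub h
  have h1 : μ • (Polynomial.X * 1 + gaussD (gaussParam μ ν) 1) +
      ν • (Polynomial.X * 1 - gaussD (gaussParam μ ν) 1) = 0 := by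
    refine Polynomial.funext fun z => ?_
    simp [gaussD, gaussParam]
    field_simp
    ring
  rw [smul_comm μ, smul_comm ν, ← smul_add, ← map_smul (J _) μ, ← map_smul (J _) ν, ← map_add,
    h1, map_zero, smul_zero, zero_smul]

theorem weakRel_J {μ ν : ℂ} (h : ‖μ‖ ^ 2 - ‖ν‖ ^ 2 = 1) :
    WeakRel (J (gaussParam μ ν) 1) ((ν / μ) • J (gaussParam μ ν) 1) :=
  weakRel_of_bogoliubov (ne_zero_of_norm_sq_sub h) (J_mem_graph_bogoliubov h)

/-- The squeezed states are the normalized Gaussians with `w = (μ + ν)/(μ - ν)`. -/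
theorem isSqueezedVacuum_iff {μ ν : ℂ} (h : ‖μ‖ ^ 2 - ‖ν‖ ^ 2 = 1) {ψ : L2} :
    IsSqueezedVacuum μ ν ψ ↔ ‖ψ‖ = 1 ∧ ∃ c : ℂ, ψ = c • J (gaussParam μ ν) 1 := by
  have h0 := J_ne_zero (gaussParam_re_pos h)
  constructor
  · rintro ⟨h1, -, h2⟩
    exact ⟨h1, exists_eq_smul_of_weakRel
      (weakRel_of_bogoliubov (ne_zero_of_norm_sq_sub h) h2) (weakRel_J h) h0⟩
  · rintro ⟨h1, c, rfl⟩
    have hc : c ≠ 0 := by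
      rintro rfl
      simp at h1
    exact ⟨h1, IsEigenvector.smul ⟨h0, J_mem_graph_bogoliubov h⟩ hc⟩

theorem exists_isSqueezedVacuum {μ ν : ℂ} (h : ‖μ‖ ^ 2 - ‖ν‖ ^ 2 = 1) :
    ∃ ψ, IsSqueezedVacuum μ ν ψ := by
  have h0 := J_ne_zero (gaussParam_re_pos h)
  refine ⟨((‖J (gaussParam μ ν) 1‖ : ℂ)⁻¹) • J (gaussParam μ ν) 1,
    (isSqueezedVacuum_iff h).2 ⟨?_, _, rfl⟩⟩
  rw [norm_smul, norm_inv, Complex.norm_real, norm_norm, inv_mul_cancel₀ (norm_ne_zero_iff.2 h0)]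

theorem JE_ne_zero {w : ℂ} (hw : 0 < w.re) : JE w 1 ≠ 0 := by
  intro h0
  have h1 := coe_JE hw isEvenPoly_one
  rw [h0] at h1
  exact J_ne_zero hw h1.symm

theorem JE_mem_graph_annihilationCore {μ ν : ℂ} (h : ‖μ‖ ^ 2 - ‖ν‖ ^ 2 = 1) :
    (JE (gaussParam μ ν) 1, (ν / μ) • JE (gaussParam μ ν) 1) ∈ annihilationCore.graph := by
  have hw := gaussParam_re_pos h
  have hμ := ne_zero_of_norm_sq_sub h
  have hs := sub_ne_zero_of_norm_sq_sub h
  refine mem_graph_annihilationCore.2 ⟨_, JE_mem_graph_numberOp hw isEvenPoly_one, ?_⟩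
  have h1 : numberPoly (gaussParam μ ν) 1 = (ν / μ) • raisePoly (gaussParam μ ν) 1 := by
    refine Polynomial.funext fun z => ?_
    simp [numberPoly, raisePoly, gaussD, gaussParam]
    field_simp
    ring
  rw [h1, JE_smul hw isEvenPoly_one.raisePoly]
  exact Lplus.graph.smul_mem (ν / μ) (JE_mem_graph_Lplus hw isEvenPoly_one)

theorem isEigenvector_annihilation {μ ν : ℂ} (h : ‖μ‖ ^ 2 - ‖ν‖ ^ 2 = 1) :
    IsEigenvector annihilation (ν / μ) (JE (gaussParam μ ν) 1) :=
  ⟨JE_ne_zero (gaussParam_re_pos h),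
    mem_graph_closure_of_mem (JE_mem_graph_annihilationCore h)⟩

theorem isEigenvector_bosonQuotient {μ ν : ℂ} (h : ‖μ‖ ^ 2 - ‖ν‖ ^ 2 = 1) :
    IsEigenvector bosonQuotient (ν / μ) (JE (gaussParam μ ν) 1) :=
  ⟨JE_ne_zero (gaussParam_re_pos h),
    LinearPMap.le_graph_of_le annihilationCore_le_bosonQuotient (JE_mem_graph_annihilationCore h)⟩

theorem isEigenvector_momentumQuotient {μ ν : ℂ} (h : ‖μ‖ ^ 2 - ‖ν‖ ^ 2 = 1) :
    IsEigenvector momentumQuotient (I * ((μ + ν) / (μ - ν))) (JE (gaussParam μ ν) 1) := by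
  have hw := gaussParam_re_pos h
  refine ⟨JE_ne_zero hw, mem_graph_momentumQuotient.2 ⟨(I * gaussParam μ ν) •
    J (gaussParam μ ν) (Polynomial.X * 1), ?_, ?_⟩⟩
  · rw [coe_JE hw isEvenPoly_one]
    have := J_mem_graph_P hw 1
    convert! this using 2
    rw [← map_smul]
    congr 1
    refine Polynomial.funext fun z => ?_
    simp [gaussD]
    ring
  · rw [Submodule.coe_smul, coe_JE hw isEvenPoly_one]
    exact Q.graph.smul_mem (I * gaussParam μ ν) (J_mem_graph_Q hw 1)

theorem isEigenvector_cayleyA {μ ν : ℂ} (h : ‖μ‖ ^ 2 - ‖ν‖ ^ 2 = 1) :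
    IsEigenvector cayleyA (I * ((μ + ν) / (μ - ν))) (JE (gaussParam μ ν) 1) := by
  have hw := gaussParam_re_pos h
  have hζ := norm_div_lt_one h
  obtain ⟨G, hG, hG0, hGw⟩ := exists_tendsto_partialState hζ
  have hζ1 : ν / μ ≠ 1 := fun h0 => by
    rw [h0, norm_one] at hζ
    exact lt_irrefl _ hζ
  obtain ⟨c, hc⟩ := exists_eq_smul_of_weakRel (weakRel_J h) hGw
    (fun h0 => hG0 (Subtype.ext h0))
  have hc0 : c ≠ 0 := by
    rintro rfl
    rw [zero_smul] at hc
    exact J_ne_zero hw hc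
  have h1 : JE (gaussParam μ ν) 1 = c • G := by
    refine Subtype.ext ?_
    rw [coe_JE hw isEvenPoly_one, hc, Submodule.coe_smul]
  have h2 : (1 + ν / μ) / (1 - ν / μ) = (μ + ν) / (μ - ν) := gaussParam_one_div h
  rw [h1, ← h2]
  exact IsEigenvector.smul ⟨hG0, mem_graph_cayleyA_of_tendsto hζ1 hG⟩ hc0

/-! ### The double cover of `SU(1,1)` -/

theorem norm_sq_sub_of_SU11 (B : SU11) : ‖muOf B‖ ^ 2 - ‖nuOf B‖ ^ 2 = 1 := by
  have h1 := B.1.2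
  rw [Matrix.det_fin_two] at h1
  have h2 : B.1.1 0 0 = conj (muOf B) := B.2.1
  have h3 : B.1.1 1 0 = conj (nuOf B) := B.2.2
  have h4 : conj (muOf B) * muOf B - nuOf B * conj (nuOf B) = 1 := by
    rw [← h2, ← h3]
    exact h1
  rw [mul_comm, Complex.mul_conj, Complex.mul_conj, Complex.normSq_eq_norm_sq,
    Complex.normSq_eq_norm_sq] at h4
  exact_mod_cast h4

/-- The even Gaussian with `w = (μ + ν)/(μ - ν)`, where `ν, μ` is the second column of `B`. -/
def gaussOf (B : SU11) : EvenL2 := JE (gaussParam (muOf B) (nuOf B)) 1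

/-- The unitary operators of the cover act on the rays of Gaussians by left multiplication. -/
theorem exists_apply_gaussOf {p : SU11 × UnitaryGp} (hp : p ∈ CoverSU11) (B : SU11) :
    ∃ c : ℂ, c ≠ 0 ∧ (p.2 : EvenL2 →L[ℂ] EvenL2) (gaussOf B) = c • gaussOf (p.1 * B) := by
  induction hp using Subgroup.closure_induction generalizing B with
  | mem p hp =>
    obtain ⟨r, s, t, hexp, hW⟩ := hp
    obtain ⟨c, hc, h⟩ := hW.apply_gaussian (v := ![nuOf B, muOf B])
      (gaussParam_re_pos (norm_sq_sub_of_SU11 B))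
    refine ⟨c, hc, ?_⟩
    have e1 : ((p.1.1.1 : Matrix (Fin 2) (Fin 2) ℂ).mulVec ![nuOf B, muOf B]) 1 =
        muOf (p.1 * B) := by
      change _ = (p.1.1.1 * B.1.1 : Matrix (Fin 2) (Fin 2) ℂ) 1 1
      rw [Matrix.mul_apply, Fin.sum_univ_two]
      simp [Matrix.mulVec, dotProduct, Fin.sum_univ_two, muOf, nuOf]
    have e2 : ((p.1.1.1 : Matrix (Fin 2) (Fin 2) ℂ).mulVec ![nuOf B, muOf B]) 0 =
        nuOf (p.1 * B) := by
      change _ = (p.1.1.1 * B.1.1 : Matrix (Fin 2) (Fin 2) ℂ) 0 1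
      rw [Matrix.mul_apply, Fin.sum_univ_two]
      simp [Matrix.mulVec, dotProduct, Fin.sum_univ_two, muOf, nuOf]
    rw [← hexp, e1, e2] at h
    exact h
  | one => exact ⟨1, one_ne_zero, by rw [Prod.fst_one, one_mul, one_smul]; rfl⟩
  | mul p q _ _ hp hq =>
    obtain ⟨c, hc, h1⟩ := hq B
    obtain ⟨d, hd, h2⟩ := hp (q.1 * B)
    refine ⟨c * d, mul_ne_zero hc hd, ?_⟩
    rw [Prod.fst_mul, mul_assoc, mul_smul, ← h2, ← map_smul, ← h1]
    rfl
  | inv p _ hp =>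
    obtain ⟨c, hc, h⟩ := hp (p.1⁻¹ * B)
    rw [mul_inv_cancel_left] at h
    refine ⟨c⁻¹, inv_ne_zero hc, ?_⟩
    have h1 : ((p.2⁻¹ : UnitaryGp) : EvenL2 →L[ℂ] EvenL2)
        ((p.2 : EvenL2 →L[ℂ] EvenL2) (gaussOf (p.1⁻¹ * B))) = gaussOf (p.1⁻¹ * B) := by
      have := congrArg (fun U : UnitaryGp => (U : EvenL2 →L[ℂ] EvenL2) (gaussOf (p.1⁻¹ * B)))
        (inv_mul_cancel p.2)
      exact this
    rw [h, map_smul] at h1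
    rw [Prod.fst_inv, ← h1, smul_smul, inv_mul_cancel₀ hc, one_smul]
    rfl

theorem mem_SU11_of_eq {M : Matrix (Fin 2) (Fin 2) ℂ} {μ ν : ℂ}
    (hM : M = !![conj μ, ν; conj ν, μ]) (h : ‖μ‖ ^ 2 - ‖ν‖ ^ 2 = 1) :
    ∃ B : SU11, (B.1.1 : Matrix (Fin 2) (Fin 2) ℂ) = M := by
  subst hM
  have hdet : (!![conj μ, ν; conj ν, μ]).det = 1 := by
    rw [Matrix.det_fin_two_of, mul_comm, Complex.mul_conj, Complex.mul_conj,
      Complex.normSq_eq_norm_sq, Complex.normSq_eq_norm_sq]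
    exact_mod_cast h
  exact ⟨⟨⟨_, hdet⟩, by simp, by simp⟩, rfl⟩

/-- The rotations `diag(e^{-iθ}, e^{iθ})` are exponentials of multiples of `e_- - e_+`. -/
theorem exp_rotation (θ : ℝ) : NormedSpace.exp (algebraElement 0 (-θ) θ) =
    !![conj (Complex.exp (θ * I)), 0; 0, Complex.exp (θ * I)] := by
  have h1 : algebraElement 0 (-θ) θ = Matrix.diagonal ![-(θ * I), θ * I] := by
    rw [diagonal_fin_two]
    ext i j
    fin_cases i <;> fin_cases j <;> apply Complex.ext <;> simp [algebraElement] <;> ring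
  rw [h1, exp_diagonal_fin_two, diagonal_fin_two, ← Complex.exp_conj, map_mul, conj_I,
    Complex.conj_ofReal, mul_neg]

theorem exists_mem_coverSU11 {r s t : ℝ} {B : SU11}
    (hB : (B.1.1 : Matrix (Fin 2) (Fin 2) ℂ) = NormedSpace.exp (algebraElement r s t)) :
    ∃ g : CoverSU11, coverProj g = B := by
  obtain ⟨W, hW⟩ := exists_isExp_algebraAction r s t
  exact ⟨⟨(B, W), Subgroup.subset_closure ⟨r, s, t, hB, hW⟩⟩, rfl⟩

/-- Surjectivity of the covering map, by the polar decomposition of `SU(1,1)`. -/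
theorem exists_coverProj_eq {μ ν : ℂ} (h : ‖μ‖ ^ 2 - ‖ν‖ ^ 2 = 1) :
    ∃ g : CoverSU11, muOf (coverProj g) = μ ∧ nuOf (coverProj g) = ν := by
  have hμ := ne_zero_of_norm_sq_sub h
  obtain ⟨κ, hκ, hκ', he⟩ := exp_coherentParameter (norm_div_lt_one h)
  have hκμ : κ = ‖μ‖ := by
    have h1 : 1 - ‖ν / μ‖ ^ 2 = 1 / ‖μ‖ ^ 2 := by
      rw [norm_div, div_pow, eq_div_iff (pow_ne_zero 2 (norm_ne_zero_iff.2 hμ)), sub_mul,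
        div_mul_cancel₀ _ (pow_ne_zero 2 (norm_ne_zero_iff.2 hμ)), one_mul, h]
    rw [h1, mul_one_div, div_eq_one_iff_eq (pow_ne_zero 2 (norm_ne_zero_iff.2 hμ))] at hκ'
    exact (pow_left_inj₀ hκ.le (norm_nonneg _) two_ne_zero).1 hκ'
  obtain ⟨B₁, hB₁⟩ := mem_SU11_of_eq (M := (κ : ℂ) • !![1, ν / μ; conj (ν / μ), 1])
    (μ := κ) (ν := κ * (ν / μ)) (by
      rw [map_mul, Complex.conj_ofReal, Matrix.smul_of]
      simp only [Matrix.smul_cons, Matrix.smul_empty, smul_eq_mul, mul_one])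
    (by
      rw [norm_mul, Complex.norm_real, Real.norm_of_nonneg hκ.le]
      linarith)
  obtain ⟨B₂, hB₂⟩ := mem_SU11_of_eq (μ := Complex.exp (arg μ * I)) (ν := 0)
    ((exp_rotation (arg μ)).trans (by rw [map_zero])) (by rw [Complex.norm_exp_ofReal_mul_I]; simp)
  obtain ⟨g₁, hg₁⟩ := exists_mem_coverSU11 (hB₁.trans he.symm)
  obtain ⟨g₂, hg₂⟩ := exists_mem_coverSU11 hB₂
  have h1 : ((coverProj (g₁ * g₂)).1.1 : Matrix (Fin 2) (Fin 2) ℂ) = B₁.1.1 * B₂.1.1 := by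
    rw [← hg₁, ← hg₂]
    rfl
  have h2 : (κ : ℂ) * Complex.exp (arg μ * I) = μ := by
    rw [hκμ, Complex.norm_mul_exp_arg_mul_I]
  rw [hB₁, hB₂, exp_rotation] at h1
  refine ⟨g₁ * g₂, ?_, ?_⟩
  · rw [muOf, h1, Matrix.mul_apply, Fin.sum_univ_two]
    simpa using h2
  · rw [nuOf, h1, Matrix.mul_apply, Fin.sum_univ_two]
    have h3 : (κ : ℂ) * (ν / μ) * Complex.exp (arg μ * I) = ν := by
      rw [mul_right_comm, h2, mul_div_cancel₀ _ hμ]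
    simpa using h3

/-- The operators `V(g)` map the vacuum `|0⟩_a` to the Gaussian of `π(g)`. -/
theorem V_apply_coherentState (g : CoverSU11) {φ : EvenL2} (hφ : IsCoherentState 0 φ) :
    ∃ c : ℂ, (V g : EvenL2 →L[ℂ] EvenL2) φ =
      c • JE (gaussParam (muOf (coverProj g)) (nuOf (coverProj g))) 1 := by
  obtain ⟨d, rfl⟩ := hφ.eq_smul
  obtain ⟨c, -, hc⟩ := exists_apply_gaussOf g.2 1
  have h1 : gaussOf 1 = JE (gaussParam 1 0) 1 := by
    simp [gaussOf, muOf, nuOf]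
  rw [h1, mul_one] at hc
  refine ⟨d * c, ?_⟩
  rw [map_smul, mul_smul]
  exact congrArg _ hc

end SqueezedSU11

end

open SqueezedSU11 in
theorem mainTheorem6 :
    -- on their domains, `L_+⁻¹ N` (with closure `a`) is given by `-(a_b^*)⁻¹ a_b`, and
    -- `-i (a + 1)(a - 1)⁻¹` on the number states (with closure `A`) is given by `Q⁻¹ P`
    annihilationCore ≤ bosonQuotient ∧ cayleyCore ≤ momentumQuotient ∧
    ∀ μ ν : ℂ, ‖μ‖ ^ 2 - ‖ν‖ ^ 2 = 1 →
      -- all the objects exist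
      (∃ ψ : L2, IsSqueezedVacuum μ ν ψ) ∧
      (∃ φ : EvenL2, IsCoherentState 0 φ) ∧
      (∃ φ : EvenL2, IsCoherentState (ν / μ) φ) ∧
      (∃ φ : EvenL2, IsCoherentStateA (Complex.I * ((μ + ν) / (μ - ν))) φ) ∧
      (∃ g : CoverSU11, muOf (coverProj g) = μ ∧ nuOf (coverProj g) = ν) ∧
      ∀ ψ : L2, IsSqueezedVacuum μ ν ψ → ∃ hψ : ψ ∈ evenL2,
        -- `|0;μ,ν⟩⟨0;μ,ν| = V(g) |0⟩_a ⟨0| V(g)^*`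
        (∀ g : CoverSU11, muOf (coverProj g) = μ → nuOf (coverProj g) = ν →
          ∀ φ : EvenL2, IsCoherentState 0 φ →
            proj ⟨ψ, hψ⟩ = (V g : EvenL2 →L[ℂ] EvenL2) * proj φ *
              star (V g : EvenL2 →L[ℂ] EvenL2)) ∧
        -- `|0;μ,ν⟩⟨0;μ,ν| = |ν/μ⟩_a ⟨ν/μ|`
        (∀ φ : EvenL2, IsCoherentState (ν / μ) φ → proj ⟨ψ, hψ⟩ = proj φ) ∧
        -- `|0;μ,ν⟩⟨0;μ,ν| = |i(μ+ν)/(μ-ν)⟩_A ⟨i(μ+ν)/(μ-ν)|`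
        (∀ φ : EvenL2, IsCoherentStateA (Complex.I * ((μ + ν) / (μ - ν))) φ →
          proj ⟨ψ, hψ⟩ = proj φ) ∧
        -- the squeezed state is a coherent state, and an eigenvector of `a` and of `A`
        IsCoherentState (ν / μ) ⟨ψ, hψ⟩ ∧
        IsCoherentStateA (Complex.I * ((μ + ν) / (μ - ν))) ⟨ψ, hψ⟩ ∧
        IsEigenvector annihilation (ν / μ) ⟨ψ, hψ⟩ ∧
        IsEigenvector bosonQuotient (ν / μ) ⟨ψ, hψ⟩ ∧
        IsEigenvector cayleyA (Complex.I * ((μ + ν) / (μ - ν))) ⟨ψ, hψ⟩ ∧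
        IsEigenvector momentumQuotient (Complex.I * ((μ + ν) / (μ - ν))) ⟨ψ, hψ⟩ := by
  refine ⟨annihilationCore_le_bosonQuotient, cayleyCore_le_momentumQuotient, fun μ ν h => ?_⟩
  have hw := gaussParam_re_pos h
  have hζ := norm_div_lt_one h
  obtain ⟨φζ, hφζ⟩ := exists_isCoherentState hζ
  refine ⟨exists_isSqueezedVacuum h, exists_isCoherentState (by simp), ⟨φζ, hφζ⟩,
    ⟨φζ, (isCoherentStateA_iff h).2 hφζ⟩, exists_coverProj_eq h, fun ψ hψ => ?_⟩
  obtain ⟨hψ1, c, hc⟩ := (isSqueezedVacuum_iff h).1 hψ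
  have hψE : ψ = ((c • JE (gaussParam μ ν) 1 : EvenL2) : L2) := by
    rw [hc, Submodule.coe_smul, coe_JE hw isEvenPoly_one]
  have hmem : ψ ∈ evenL2 := hψE ▸ (c • JE (gaussParam μ ν) 1 : EvenL2).2
  have hE : (⟨ψ, hmem⟩ : EvenL2) = c • JE (gaussParam μ ν) 1 := Subtype.ext hψE
  have hnorm : ‖(⟨ψ, hmem⟩ : EvenL2)‖ = 1 := hψ1
  have hc0 : c ≠ 0 := by
    rintro rfl
    rw [hc, zero_smul, norm_zero] at hψ1
    exact zero_ne_one hψ1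
  have hcoh : ∀ {φ : EvenL2}, IsCoherentState (ν / μ) φ ↔
      ‖φ‖ = 1 ∧ ∃ c : ℂ, φ = c • JE (gaussParam μ ν) 1 := by
    intro φ
    rw [isCoherentState_iff hζ, gaussParam_one_div h]
  have hproj : ∀ φ, IsCoherentState (ν / μ) φ → proj ⟨ψ, hmem⟩ = proj φ := fun φ hφ =>
    proj_eq_of_eq_smul hnorm (hcoh.1 hφ).1 ⟨c, hE⟩ (hcoh.1 hφ).2
  have hψcoh : IsCoherentState (ν / μ) ⟨ψ, hmem⟩ := hcoh.2 ⟨hnorm, c, hE⟩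
  refine ⟨hmem, ?_, hproj, fun φ hφ => hproj φ ((isCoherentStateA_iff h).1 hφ), hψcoh,
    (isCoherentStateA_iff h).2 hψcoh, ?_, ?_, ?_, ?_⟩
  · rintro g hgμ hgν φ hφ
    obtain ⟨d, hd⟩ := V_apply_coherentState g hφ
    rw [hgμ, hgν] at hd
    rw [proj_unitary]
    exact proj_eq_of_eq_smul hnorm (by rw [norm_unitary_apply, hφ.norm_eq]) ⟨c, hE⟩ ⟨d, hd⟩
  · rw [hE]
    exact (isEigenvector_annihilation h).smul hc0
  · rw [hE]
    exact (isEigenvector_bosonQuotient h).smul hc0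
  · rw [hE]
    exact (isEigenvector_cayleyA h).smul hc0
  · rw [hE]
    exact (isEigenvector_momentumQuotient h).smul hc0
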